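/- Let $H=(V,E,w)$ be a weighted hypergraph: $V$ is finite with $n:=|V|$, $E$ is a set of subsets of $V$, and $w\in\mathbb R_+^E$. Let $D:=\max_{e\in E}|e|$, write $\binom e2$ for the set of unordered pairs of distinct elements of $e$, and for $x\in\mathbb R^V$ let $$Q_H(x):=\sum_{e\in E} w_e\max_{\{u,v\}\in\binom e2}(x_u-x_v)^2 .$$ A weighted hypergraph $\tilde H=(V,\tilde E,\tilde w)$ is a spectral $\epsilon$-sparsifier for $H$ if $\tilde E\subseteq E$ and $|Q_H(x)-Q_{\tilde H}(x)|\le\epsilon\,Q_H(x)$ for all $x\in\mathbb R^V$. Let numbers $c^e_{ij}\ge 0$ ($e\in E$, $\{i,j\}\in\binom e2$) be given with $\sum_{\{i,j\}\in\binom e2}c^e_{ij}=w_e$ for every $e\in E$. Put $F:=\bigcup_{e\in E}\binom e2$, $c_{ij}:=\sum_{e\in E:\{i,j\}\in\binom e2}c^e_{ij}$ for $\{i,j\}\in F$, and $$L_G:=\sum_{\{i,j\}\in F}c_{ij}(\chi_i-\chi_j)(\chi_i-\chi_j)^{*},$$ where $(\chi_i)_{i\in V}$ is the standard basis of $\mathbb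 R^V$. Let $L_G^{+/2}$ be the positive semidefinite square root of the Moore–Penrose pseudoinverse $L_G^+$, and let $$\mathsf R_{ij}:=\|L_G^{+/2}(\chi_i-\chi_j)\|^2,\qquad \mathsf R_{\max}(e):=\max_{\{i,j\}\in\binom e2}\mathsf R_{ij},\qquad K:=\max_{e\in E}\ \max_{\{i,j\}\in\binom e2}\frac{\mathsf R_{\max}(e)}{\mathsf R_{ij}}\,\mathbb 1_{\{c^e_{ij}>0\}},$$ where a term with $c^e_{ij}=0$ counts as $0$ (if $c^e_{ij}>0$ then $\mathsf R_{ij}>0$), and a maximum over the empty set is $0$. Then for every $\epsilon>0$ there is a spectral $\epsilon$-sparsifier $\tilde H=(V,\tilde E,\tilde w)$ for $H$ with $$|\tilde E|\le C\,K\,\frac{\log D}{\epsilon^2}\,n\log n,$$ where $C>0$ is a universal constant. -/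

import Mathlib

open scoped Matrix

noncomputable section

namespace HypergraphSparsification

/-- A weighted hypergraph `(V, E, w)`: `E` is a finite set of subsets of `V`, and `w` is nonnegative
on `E` (the values of `w` outside `E` play no role). -/
structure WeightedHypergraph (V : Type*) where
  edges : Finset (Finset V)
  weight : Finset V → ℝ
  weight_nonneg : ∀ e ∈ edges, 0 ≤ weight e

/-- The maximum of a nonnegative function over a finite set (`0` over the empty set). -/
def maxOver {α : Type*} (s : Finset α) (f : α → ℝ) : ℝ :=
  if h : s.Nonempty then s.sup' h f else 0

section Pairs

variable {V : Type*} [DecidableEq V]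

/-- The set of unordered pairs `{i, j}` of distinct elements of `e`. -/
def pairs (e : Finset V) : Finset (Sym2 V) :=
  e.sym2.filter fun p => ¬ p.IsDiag

/-- `(x_u - x_v)²` as a function of the unordered pair `{u, v}`. -/
def sqDiff (x : V → ℝ) : Sym2 V → ℝ :=
  Sym2.lift ⟨fun u v => (x u - x v) ^ 2, fun u v => by ring⟩

/-- `Q_e(x) = max_{{u,v} ⊆ e} (x_u - x_v)²`. -/
def edgeEnergy (e : Finset V) (x : V → ℝ) : ℝ :=
  maxOver (pairs e) (sqDiff x)

/-- `Q_H(x) = ∑_{e ∈ E} w_e Q_e(x)`. -/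
def energy (H : WeightedHypergraph V) (x : V → ℝ) : ℝ :=
  ∑ e ∈ H.edges, H.weight e * edgeEnergy e x

/-- `Ht` is a spectral `ε`-sparsifier of `H`. -/
def IsSpectralSparsifier (ε : ℝ) (H Ht : WeightedHypergraph V) : Prop :=
  Ht.edges ⊆ H.edges ∧ ∀ x : V → ℝ, |energy H x - energy Ht x| ≤ ε * energy H x

/-- The rank `D = max_{e ∈ E} |e|`. -/
def rank (H : WeightedHypergraph V) : ℕ :=
  H.edges.sup Finset.card

/-- The numbers `c e {i,j}` (for `e ∈ E` and `{i,j}` a pair in `e`) are nonnegative and, for every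
`e ∈ E`, those of the pairs in `e` sum to `w_e`. -/
def IsConductanceSplit (H : WeightedHypergraph V) (c : Finset V → Sym2 V → ℝ) : Prop :=
  (∀ e ∈ H.edges, ∀ p ∈ pairs e, 0 ≤ c e p) ∧
    ∀ e ∈ H.edges, ∑ p ∈ pairs e, c e p = H.weight e

/-- The edge set `F` of the auxiliary graph: the union of the pairs of all hyperedges. -/
def auxEdges (H : WeightedHypergraph V) : Finset (Sym2 V) :=
  H.edges.biUnion pairs

/-- `c_{ij} = ∑_{e ∈ E : {i,j} ⊆ e} c^e_{ij}`. -/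
def conductance (H : WeightedHypergraph V) (c : Finset V → Sym2 V → ℝ) (p : Sym2 V) : ℝ :=
  ∑ e ∈ H.edges with p ∈ pairs e, c e p

/-- `χ_i - χ_j`, where `χ` is the standard basis. -/
def basisDiff (i j : V) : V → ℝ :=
  Pi.single i 1 - Pi.single j 1

theorem basisDiff_swap (i j : V) : basisDiff j i = -basisDiff i j := by
  simp [basisDiff]

/-- The rank-one matrix `(χ_i - χ_j)(χ_i - χ_j)ᵀ` as a function of the pair `{i, j}`. -/
def pairMatrix : Sym2 V → Matrix V V ℝ :=
  Sym2.lift ⟨fun i j => Matrix.vecMulVec (basisDiff i j) (basisDiff i j), fun i j => by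
    simp only [basisDiff_swap i j, Matrix.neg_vecMulVec, Matrix.vecMulVec_neg, neg_neg]⟩

/-- The weighted Laplacian `L_G = ∑_{{i,j} ∈ F} c_{ij} (χ_i - χ_j)(χ_i - χ_j)ᵀ`. -/
def laplacian (H : WeightedHypergraph V) (c : Finset V → Sym2 V → ℝ) : Matrix V V ℝ :=
  ∑ p ∈ auxEdges H, conductance H c p • pairMatrix p

variable [Fintype V]

/-- `L^{+/2}`, the square root of the Moore-Penrose pseudoinverse of a positive semidefinite matrix:
it has the eigenvectors of `L`, with eigenvalue `t^{-1/2}` where `L` has `t > 0`, and `0` where `L`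
has `0` (here `(√0)⁻¹ = 0`). -/
def pinvSqrt (L : Matrix V V ℝ) : Matrix V V ℝ :=
  cfc (fun t : ℝ => (√t)⁻¹) L

/-- The effective resistance `R_{ij} = ‖L_G^{+/2} (χ_i - χ_j)‖²` (Euclidean norm). -/
def resistance (H : WeightedHypergraph V) (c : Finset V → Sym2 V → ℝ) : Sym2 V → ℝ :=
  Sym2.lift ⟨fun i j => ‖WithLp.toLp 2 (pinvSqrt (laplacian H c) *ᵥ basisDiff i j)‖ ^ 2,
    fun i j => by
      simp only [basisDiff_swap i j, Matrix.mulVec_neg, WithLp.toLp_neg, norm_neg]⟩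

/-- `R_max(e) = max_{{i,j} ⊆ e} R_{ij}`. -/
def maxResistance (H : WeightedHypergraph V) (c : Finset V → Sym2 V → ℝ) (e : Finset V) : ℝ :=
  maxOver (pairs e) (resistance H c)

/-- `K = max_{e ∈ E} max_{{i,j} ⊆ e} (R_max(e) / R_{ij}) 1_{c^e_{ij} > 0}`. A pair with
`c^e_{ij} > 0` has `R_{ij} > 0`, so no division by zero enters. -/
def balanceRatio (H : WeightedHypergraph V) (c : Finset V → Sym2 V → ℝ) : ℝ :=
  maxOver H.edges fun e => maxOver (pairs e) fun p =>
    if 0 < c e p then maxResistance H c e / resistance H c p else 0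

end Pairs

end HypergraphSparsification

end

open HypergraphSparsification

/-!
Spectral sparsification of hypergraphs by discrepancy and generic chaining.

**The bound does not need the given conductances.** If some hyperedge has positive weight, then
`K ≥ 1` (`one_le_balanceRatio`), so it suffices to find a sparsifier with
`O(ε⁻² n log n log D)` hyperedges. The given split of the weights enters only as a witness that
splits exist. A better one is obtained by maximizing `det (η + L)` over all splits, where `L` is the
Laplacian and `η > 0` is small (`exists_balanced_split`): moving weight from one pair of a hyperedge
to another changes the determinant at a rate given by the difference of their effective resistances,
so at the maximum all pairs of a hyperedge `e` that carry weight have the largest resistance `ρ e`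
of a pair in `e`. Hence `∑ w e * ρ e` is the trace of a matrix that is at most the identity, and so
at most `n`. The perturbation by `η`, harmless because the energy is coercive modulo the vectors on
which it vanishes (`exists_coercive`), makes the argument independent of the connectivity of the
graph. After the change of variables by the square root of `η + L`, the coordinates become
`x u = ⟪g u, z⟫` with `‖g u - g v‖² ≤ ρ e` for `u, v ∈ e`, and `‖z‖² ≤ 2 Q_H(x)`
(`exists_balanced_realization`).

**Halving.** All hyperedges with `w e * ρ e ≤ R²` are deleted or doubled according to signs `s e`
with `|∑ s e * w e * Q_e(x)| ≤ C R √(log n log D) Q_H(x)` for all `x` at once (`exists_halving`); of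
`s` and `-s`, one does not increase the mass `∑ w e * ρ e`. The thresholds `R²` double from round to
round, so the errors form a geometric series (`exists_reweighting`), and the process stops when all
remaining hyperedges have mass of order `ε² / (log n log D)`. As the total mass is at most `n`,
their number is as claimed (`exists_sparsifier_card_le`).

**The signs.** The core is `exists_signs_sum_sq_le`: for seminorms `N i`, there are signs such that
`|∑ s i * N i z ^ 2| ≤ C κ S` for all `z` in the body `‖z‖ ≤ 1`, `∑ N i z ^ 2 ≤ S²`. Here `κ` is
such that the Gaussian measure gives at least `1/2` to each set `Near`, in which a seminorm `Nm`
dominating all `N i` and a weighted `ℓ²`-sum of the `N i` are bounded. The proof is a chaining over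
a tree of cells, at scales that decrease by the factor `8`. A cell is subdivided
(`exists_subdivision`) by means of the minimal squared norm over the convex hull of the points near
a given point: by uniform convexity, points with nearly the same minimum have near-minimizers in a
small Euclidean ball, so the dual Sudakov inequality (`card_le_of_gaussian_separated`) bounds the
number of cells by an exponential in the gain of the minimum. As the minimum lies between `0` and
`1`, the gains telescope along a chain, and no logarithm is lost. The increments are built from the
squares `N i ^ 2` truncated at a multiple of the scale (`truncSq`). The truncation confines the
increments to indices where `N i` is large against the scale, which permits weights in the `ℓ²`-sums
that are monotone along chains (`cellWeight_mono`), and its own contribution telescopes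
(`sq_truncSq_sub_le`). Hoeffding's inequality and a union bound over the tree give signs that are
good for all chains (`exists_goodChain`), and `abs_signSum_le_of_goodChain` adds up the increments.
Only the motion of the reference points contributes at every one of the `O(log n)` scales; this is
the source of the factor `log n`, while `log D` comes from the second moment of a maximum of `D²`
Gaussian variables (`lintegral_sq_max_gaussian_le`, `exists_signs_edges`).
-/

open HypergraphSparsification MeasureTheory
open scoped ENNReal Matrix

/-! ### Random signs -/

/-- The moment generating function of a sum with uniformly random signs. -/
theorem sum_exp_signs {ι : Type*} [Fintype ι] [DecidableEq ι] (b : ι → ℝ) :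
    ∑ s : ι → ℤˣ, Real.exp (∑ i, ((s i : ℤ) : ℝ) * b i) = ∏ i, (2 * Real.cosh (b i)) := by
  have h : ∀ i, 2 * Real.cosh (b i) = ∑ u : ℤˣ, Real.exp (((u : ℤ) : ℝ) * b i) := by
    intro i
    rw [show (Finset.univ : Finset ℤˣ) = {1, -1} from rfl, Finset.sum_pair (by decide),
      Real.cosh_eq]
    simp
    ring
  simp_rw [h, Real.exp_sum]
  rw [Finset.prod_univ_sum, Fintype.piFinset_univ]

theorem sum_exp_signs_le {ι : Type*} [Fintype ι] [DecidableEq ι] (b : ι → ℝ) :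
    ∑ s : ι → ℤˣ, Real.exp (∑ i, ((s i : ℤ) : ℝ) * b i) ≤
      Fintype.card (ι → ℤˣ) * Real.exp ((∑ i, b i ^ 2) / 2) := by
  rw [sum_exp_signs, Finset.prod_mul_distrib, Finset.sum_div, Real.exp_sum]
  have : (∏ _i : ι, (2 : ℝ)) = Fintype.card (ι → ℤˣ) := by
    simp
  rw [this]
  gcongr with i _
  exact Real.cosh_le_exp_half_sq _

/-- Hoeffding's inequality for uniformly random signs. -/
theorem card_signs_large_le {ι : Type*} [Fintype ι] [DecidableEq ι] (b : ι → ℝ) {M : ℝ}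
    (hM : 0 ≤ M) :
    ((Finset.univ.filter fun s : ι → ℤˣ =>
      √(∑ i, b i ^ 2) * √(2 * M) < |∑ i, ((s i : ℤ) : ℝ) * b i|).card : ℝ) ≤
      2 * Real.exp (-M) * Fintype.card (ι → ℤˣ) := by
  set v := ∑ i, b i ^ 2 with hv
  have hv0 : 0 ≤ v := Finset.sum_nonneg fun i _ => sq_nonneg _
  rcases hv0.eq_or_lt with h0 | hpos
  · have hb : ∀ i, b i = 0 := by
      intro i
      have := (Finset.sum_eq_zero_iff_of_nonneg (fun i _ => sq_nonneg (b i))).1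
        (hv.symm.trans h0.symm) i (Finset.mem_univ i)
      simpa using this
    have : (Finset.univ.filter fun s : ι → ℤˣ =>
        √v * √(2 * M) < |∑ i, ((s i : ℤ) : ℝ) * b i|) = ∅ := by
      ext s
      simp [hb, ← h0]
    rw [this]
    simp only [Finset.card_empty, Nat.cast_zero]
    positivity
  · set w := √v with hw
    have hw0 : 0 < w := Real.sqrt_pos.2 hpos
    have hw2 : w ^ 2 = v := Real.sq_sqrt hv0
    set r := √(2 * M) with hr
    have hr2 : r ^ 2 = 2 * M := Real.sq_sqrt (by positivity)
    have hr0 : 0 ≤ r := Real.sqrt_nonneg _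
    set t := r / w with ht
    have ht0 : 0 ≤ t := by positivity
    have htw : t * w = r := by rw [ht]; field_simp
    have key : ∀ s : ι → ℤˣ, (if w * r < |∑ i, ((s i : ℤ) : ℝ) * b i| then (1 : ℝ) else 0) ≤
        Real.exp (-(2 * M)) * (Real.exp (∑ i, ((s i : ℤ) : ℝ) * (t * b i)) +
          Real.exp (∑ i, ((s i : ℤ) : ℝ) * (-t * b i))) := by
      intro s
      have e1 : ∑ i, ((s i : ℤ) : ℝ) * (t * b i) = t * ∑ i, ((s i : ℤ) : ℝ) * b i := by
        rw [Finset.mul_sum]; exact Finset.sum_congr rfl fun i _ => by ring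
      have e2 : ∑ i, ((s i : ℤ) : ℝ) * (-t * b i) = -(t * ∑ i, ((s i : ℤ) : ℝ) * b i) := by
        rw [Finset.mul_sum, ← Finset.sum_neg_distrib]
        exact Finset.sum_congr rfl fun i _ => by ring
      rw [e1, e2]
      set x := ∑ i, ((s i : ℤ) : ℝ) * b i
      split_ifs with h
      · have h1 : 2 * M ≤ t * |x| := by
          calc 2 * M = t * (w * r) := by rw [← mul_assoc, htw, ← hr2]; ring
            _ ≤ t * |x| := by gcongr
        have h2 : Real.exp (2 * M) ≤ Real.exp (t * x) + Real.exp (-(t * x)) := by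
          rcases abs_cases x with ⟨hx, _⟩ | ⟨hx, _⟩ <;> rw [hx] at h1
          · linarith [Real.exp_le_exp.2 h1, Real.exp_pos (-(t * x))]
          · rw [mul_neg] at h1
            linarith [Real.exp_le_exp.2 h1, Real.exp_pos (t * x)]
        calc (1 : ℝ) = Real.exp (-(2 * M)) * Real.exp (2 * M) := by
              rw [← Real.exp_add]; simp
          _ ≤ _ := by gcongr
      · positivity
    have hq : (t * w) ^ 2 / 2 = M := by rw [htw, hr2]; ring
    have s1 : ∑ i, (t * b i) ^ 2 = (t * w) ^ 2 := by
      simp_rw [mul_pow, ← Finset.mul_sum, hw2, ← hv]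
    have s2 : ∑ i, (-t * b i) ^ 2 = (t * w) ^ 2 := by
      simp_rw [mul_pow, ← Finset.mul_sum, hw2, ← hv, neg_sq]
    have b1 := sum_exp_signs_le fun i => t * b i
    have b2 := sum_exp_signs_le fun i => -t * b i
    rw [s1, hq] at b1
    rw [s2, hq] at b2
    rw [Finset.card_filter]
    push_cast
    calc _ ≤ ∑ s : ι → ℤˣ, Real.exp (-(2 * M)) * (Real.exp (∑ i, ((s i : ℤ) : ℝ) * (t * b i)) +
          Real.exp (∑ i, ((s i : ℤ) : ℝ) * (-t * b i))) := Finset.sum_le_sum fun s _ => key s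
      _ ≤ Real.exp (-(2 * M)) * (Fintype.card (ι → ℤˣ) * Real.exp M +
          Fintype.card (ι → ℤˣ) * Real.exp M) := by
          rw [← Finset.mul_sum, Finset.sum_add_distrib]
          gcongr
      _ = 2 * (Real.exp (-(2 * M)) * Real.exp M) * Fintype.card (ι → ℤˣ) := by ring
      _ = _ := by rw [← Real.exp_add]; ring_nf

/-! ### The Gaussian measure and the dual Sudakov inequality -/

section Gaussian

variable (E : Type*) [NormedAddCommGroup E] [InnerProductSpace ℝ E] [FiniteDimensional ℝ E]
  [MeasurableSpace E] [BorelSpace E]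

/-- The Gaussian measure with density `exp (-‖x‖² / 2)`, not normalized. -/
noncomputable def rawGaussian : Measure E :=
  volume.withDensity fun x => ENNReal.ofReal (Real.exp (-‖x‖ ^ 2 / 2))

/-- The standard Gaussian probability measure on a Euclidean space. -/
noncomputable def gaussianMeasure : Measure E :=
  (rawGaussian E Set.univ)⁻¹ • rawGaussian E

variable {E}

omit [InnerProductSpace ℝ E] [FiniteDimensional ℝ E] in
theorem measurable_gaussianDensity :
    Measurable fun x : E => ENNReal.ofReal (Real.exp (-‖x‖ ^ 2 / 2)) := by
  fun_prop

theorem rawGaussian_univ_ne_zero : rawGaussian E Set.univ ≠ 0 := by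
  rw [rawGaussian, withDensity_apply _ MeasurableSet.univ, Measure.restrict_univ, ne_eq,
    lintegral_eq_zero_iff measurable_gaussianDensity]
  intro h
  have : ∀ᵐ x ∂(volume : Measure E), False := by
    filter_upwards [h] with x hx
    simp only [Pi.zero_apply, ENNReal.ofReal_eq_zero] at hx
    exact absurd (Real.exp_pos _) (not_lt.2 hx)
  rw [Filter.eventually_false_iff_eq_bot, ae_eq_bot] at this
  exact NeZero.ne _ this

theorem rawGaussian_univ_ne_top : rawGaussian E Set.univ ≠ ∞ := by
  rw [rawGaussian, withDensity_apply _ MeasurableSet.univ, Measure.restrict_univ]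
  have h := GaussianFourier.integrable_cexp_neg_mul_sq_norm_add (V := E) (b := (1 / 2 : ℂ))
    (by norm_num) 0 0
  have h2 := h.norm
  have h3 : Integrable fun x : E => Real.exp (-‖x‖ ^ 2 / 2) := by
    refine h2.congr (Filter.Eventually.of_forall fun x => ?_)
    simp only [Complex.norm_exp]
    congr 1
    have : (-(1 / 2 : ℂ) * (‖x‖ : ℂ) ^ 2 + 0 * ((inner ℝ (0 : E) x : ℝ) : ℂ)) =
      ((-‖x‖ ^ 2 / 2 : ℝ) : ℂ) := by
      push_cast; ring
    rw [this, Complex.ofReal_re]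
  exact (Integrable.lintegral_lt_top h3).ne

instance isProbabilityMeasure_gaussianMeasure : IsProbabilityMeasure (gaussianMeasure E) :=
  ⟨by simpa [gaussianMeasure] using
    ENNReal.inv_mul_cancel rawGaussian_univ_ne_zero rawGaussian_univ_ne_top⟩

theorem lintegral_gaussianMeasure (f : E → ℝ≥0∞) (hf : Measurable f) :
    ∫⁻ x, f x ∂(gaussianMeasure E) = (rawGaussian E Set.univ)⁻¹ *
      ∫⁻ x, ENNReal.ofReal (Real.exp (-‖x‖ ^ 2 / 2)) * f x := by
  rw [gaussianMeasure, lintegral_smul_measure, rawGaussian,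
    lintegral_withDensity_eq_lintegral_mul _ measurable_gaussianDensity hf]
  rfl

omit [FiniteDimensional ℝ E] [MeasurableSpace E] [BorelSpace E] in
/-- Completing the square in the exponent. -/
theorem exp_gaussian_shift (a x : E) : Real.exp (-‖x‖ ^ 2 / 2) * Real.exp (inner ℝ a x) =
    Real.exp (‖a‖ ^ 2 / 2) * Real.exp (-‖x - a‖ ^ 2 / 2) := by
  rw [← Real.exp_add, ← Real.exp_add, norm_sub_sq_real, real_inner_comm]
  ring_nf

/-- The moment generating function of a Gaussian vector. -/
theorem lintegral_exp_inner_gaussianMeasure (a : E) :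
    ∫⁻ x, ENNReal.ofReal (Real.exp (inner ℝ a x)) ∂(gaussianMeasure E) =
      ENNReal.ofReal (Real.exp (‖a‖ ^ 2 / 2)) := by
  rw [lintegral_gaussianMeasure _ (by fun_prop)]
  simp_rw [← ENNReal.ofReal_mul (Real.exp_pos _).le, exp_gaussian_shift,
    ENNReal.ofReal_mul (Real.exp_pos _).le]
  rw [lintegral_const_mul _ (by fun_prop),
    lintegral_sub_right_eq_self (fun x : E => ENNReal.ofReal (Real.exp (-‖x‖ ^ 2 / 2))) a,
    mul_left_comm]
  have : ∫⁻ x : E, ENNReal.ofReal (Real.exp (-‖x‖ ^ 2 / 2)) = rawGaussian E Set.univ := by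
    rw [rawGaussian, withDensity_apply _ MeasurableSet.univ, Measure.restrict_univ]
  rw [this, ENNReal.inv_mul_cancel rawGaussian_univ_ne_zero rawGaussian_univ_ne_top, mul_one]

/-- A translate by `z` of a symmetric set keeps at least the fraction `exp (-‖z‖² / 2)` of its
Gaussian measure. -/
theorem gaussianMeasure_translate_ge (z : E) {K : Set E} (hK : MeasurableSet K)
    (hsymm : ∀ x ∈ K, -x ∈ K) :
    ENNReal.ofReal (Real.exp (-‖z‖ ^ 2 / 2)) * gaussianMeasure E K ≤
      gaussianMeasure E ((fun x => x - z) ⁻¹' K) := by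
  have hK' : MeasurableSet ((fun x => x - z) ⁻¹' K) := by measurability
  rw [← lintegral_indicator_one hK, ← lintegral_indicator_one hK',
    lintegral_gaussianMeasure _ (measurable_one.indicator hK),
    lintegral_gaussianMeasure _ (measurable_one.indicator hK'), mul_left_comm]
  gcongr
  set f : E → ℝ≥0∞ := K.indicator 1 with hf
  have hfm : Measurable f := measurable_one.indicator hK
  have hfs : ∀ x, f (-x) = f x := by
    intro x
    by_cases hx : x ∈ K
    · simp [hf, hx, hsymm x hx]
    · have : -x ∉ K := fun h => hx (by simpa using hsymm _ h)
      simp [hf, hx, this]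
  have e1 : ∫⁻ x, ENNReal.ofReal (Real.exp (-‖x‖ ^ 2 / 2)) *
      ((fun x => x - z) ⁻¹' K).indicator 1 x =
      ∫⁻ x, ENNReal.ofReal (Real.exp (-‖x + z‖ ^ 2 / 2)) * f x := by
    rw [← lintegral_add_right_eq_self _ z]
    refine lintegral_congr fun x => ?_
    congr 1
    have hmem : x + z ∈ (fun x => x - z) ⁻¹' K ↔ x ∈ K := by
      rw [Set.mem_preimage, add_sub_cancel_right]
    by_cases hx : x ∈ K
    · rw [hf, Set.indicator_of_mem (hmem.2 hx), Set.indicator_of_mem hx]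
      rfl
    · rw [hf, Set.indicator_of_notMem (mt hmem.1 hx), Set.indicator_of_notMem hx]
  -- By symmetry of `K`, the density may be averaged over `x + z` and `x - z`, which leaves a factor
  -- `cosh ⟪x, z⟫ ≥ 1`.
  have e2 : ∫⁻ x, ENNReal.ofReal (Real.exp (-‖x + z‖ ^ 2 / 2)) * f x =
      ∫⁻ x, ENNReal.ofReal (Real.exp (-‖x - z‖ ^ 2 / 2)) * f x := by
    rw [← lintegral_neg_eq_self]
    refine lintegral_congr fun x => ?_
    rw [hfs, show -x + z = -(x - z) by abel, norm_neg]
  have hm1 : Measurable fun x : E => ENNReal.ofReal (Real.exp (-‖x + z‖ ^ 2 / 2)) * f x :=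
    (by fun_prop : Measurable fun x : E => ENNReal.ofReal (Real.exp (-‖x + z‖ ^ 2 / 2))).mul hfm
  have hm0 : Measurable fun x : E => ENNReal.ofReal (Real.exp (-‖x‖ ^ 2 / 2)) * f x :=
    measurable_gaussianDensity.mul hfm
  rw [e1]
  have key : 2 * (ENNReal.ofReal (Real.exp (-‖z‖ ^ 2 / 2)) *
      ∫⁻ x, ENNReal.ofReal (Real.exp (-‖x‖ ^ 2 / 2)) * f x) ≤
      2 * ∫⁻ x, ENNReal.ofReal (Real.exp (-‖x + z‖ ^ 2 / 2)) * f x := by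
    rw [two_mul (∫⁻ x, _)]
    nth_rw 2 [e2]
    rw [← lintegral_add_left hm1, ← mul_assoc, ← lintegral_const_mul _ hm0]
    refine lintegral_mono fun x => ?_
    simp only []
    rw [← add_mul, ← mul_assoc]
    gcongr
    rw [show (2 : ℝ≥0∞) = ENNReal.ofReal 2 by simp, ← ENNReal.ofReal_mul (by norm_num),
      ← ENNReal.ofReal_mul (by positivity), ← ENNReal.ofReal_add (by positivity) (by positivity)]
    apply ENNReal.ofReal_le_ofReal
    have h1 : Real.exp (-‖x + z‖ ^ 2 / 2) =
        Real.exp (-‖z‖ ^ 2 / 2) * Real.exp (-‖x‖ ^ 2 / 2) * Real.exp (-inner ℝ x z) := by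
      rw [← Real.exp_add, ← Real.exp_add, norm_add_sq_real]; ring_nf
    have h2 : Real.exp (-‖x - z‖ ^ 2 / 2) =
        Real.exp (-‖z‖ ^ 2 / 2) * Real.exp (-‖x‖ ^ 2 / 2) * Real.exp (inner ℝ x z) := by
      rw [← Real.exp_add, ← Real.exp_add, norm_sub_sq_real]; ring_nf
    rw [h1, h2]
    have h3 : 2 ≤ Real.exp (-inner ℝ x z) + Real.exp (inner ℝ x z) := by
      have := Real.one_le_cosh (inner ℝ x z)
      rw [Real.cosh_eq] at this
      linarith
    calc 2 * Real.exp (-‖z‖ ^ 2 / 2) * Real.exp (-‖x‖ ^ 2 / 2) =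
        Real.exp (-‖z‖ ^ 2 / 2) * Real.exp (-‖x‖ ^ 2 / 2) * 2 := by ring
      _ ≤ Real.exp (-‖z‖ ^ 2 / 2) * Real.exp (-‖x‖ ^ 2 / 2) *
          (Real.exp (-inner ℝ x z) + Real.exp (inner ℝ x z)) := by gcongr
      _ = _ := by ring
  exact (ENNReal.mul_le_mul_iff_right (by norm_num) (by norm_num)).1 key

/-- The volumetric form of the dual Sudakov inequality: points of a Euclidean ball of radius `ρ`
whose pairwise differences avoid `σ (K - K)`, where `K` is symmetric of Gaussian measure at least
`1/2`, number at most `2 exp (ρ² / (2σ²))`. -/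
theorem card_le_of_gaussian_separated {K : Set E} (hK : MeasurableSet K)
    (hsymm : ∀ x ∈ K, -x ∈ K) (hhalf : 1 / 2 ≤ gaussianMeasure E K) {σ ρ : ℝ} (hσ : 0 < σ)
    (u : E) (F : Finset E) (hF : ∀ y ∈ F, ‖y - u‖ ≤ ρ)
    (hsep : ∀ y ∈ F, ∀ y' ∈ F, y ≠ y' → ∀ a ∈ K, ∀ b ∈ K, y - y' ≠ σ • (a - b)) :
    (F.card : ℝ) ≤ 2 * Real.exp (ρ ^ 2 / (2 * σ ^ 2)) := by
  -- The translates of `K` centred at the points of `(F - u) / σ` are disjoint.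
  set T : E → Set E := fun y => (fun x => x - σ⁻¹ • (y - u)) ⁻¹' K with hT
  have hTm : ∀ y, MeasurableSet (T y) := fun y => by
    simp only [hT]; measurability
  have hdisj : (F : Set E).PairwiseDisjoint T := by
    intro y hy y' hy' hne
    rw [Function.onFun, Set.disjoint_left]
    intro x hx hx'
    refine hsep y hy y' hy' hne _ hx' _ hx ?_
    have : x - σ⁻¹ • (y' - u) - (x - σ⁻¹ • (y - u)) = σ⁻¹ • (y - y') := by
      rw [smul_sub, smul_sub, smul_sub]; abel
    simp only [this]
    rw [smul_inv_smul₀ hσ.ne']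
  have h1 : ∑ y ∈ F, gaussianMeasure E (T y) ≤ 1 := by
    rw [← measure_biUnion_finset hdisj fun y _ => hTm y]
    exact prob_le_one
  have h2 : ∀ y ∈ F, ENNReal.ofReal (Real.exp (-(ρ ^ 2 / (2 * σ ^ 2))) / 2) ≤
      gaussianMeasure E (T y) := by
    intro y hy
    refine le_trans ?_ (gaussianMeasure_translate_ge (σ⁻¹ • (y - u)) hK hsymm)
    rw [div_eq_mul_inv, ENNReal.ofReal_mul (Real.exp_pos _).le]
    gcongr
    · rw [norm_smul, mul_pow, norm_inv, Real.norm_of_nonneg hσ.le, neg_div]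
      have := hF y hy
      have h3 : (σ⁻¹) ^ 2 * ‖y - u‖ ^ 2 / 2 ≤ ρ ^ 2 / (2 * σ ^ 2) := by
        calc (σ⁻¹) ^ 2 * ‖y - u‖ ^ 2 / 2 ≤ (σ⁻¹) ^ 2 * ρ ^ 2 / 2 := by gcongr
          _ = _ := by field_simp
      linarith
    · refine le_trans (le_of_eq ?_) hhalf
      rw [ENNReal.ofReal_inv_of_pos (by norm_num)]
      simp
  have h3 : (F.card : ℝ≥0∞) * ENNReal.ofReal (Real.exp (-(ρ ^ 2 / (2 * σ ^ 2))) / 2) ≤ 1 := by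
    refine le_trans ?_ h1
    rw [← nsmul_eq_mul]
    exact Finset.card_nsmul_le_sum _ _ _ h2
  have h4 : (F.card : ℝ) * (Real.exp (-(ρ ^ 2 / (2 * σ ^ 2))) / 2) ≤ 1 := by
    rw [← ENNReal.ofReal_natCast, ← ENNReal.ofReal_mul (by positivity),
      ← ENNReal.ofReal_one] at h3
    exact (ENNReal.ofReal_le_ofReal_iff (by norm_num)).1 h3
  rw [Real.exp_neg] at h4
  have := Real.exp_pos (ρ ^ 2 / (2 * σ ^ 2))
  field_simp at h4
  linarith

/-- Gaussian tail bound for a linear functional. -/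
theorem gaussianMeasure_abs_inner_gt_le (a : E) {R t : ℝ} (hR : 0 < R) (ha : ‖a‖ ≤ R)
    (ht : 0 ≤ t) :
    gaussianMeasure E {x | t * R < |inner ℝ a x|} ≤
      ENNReal.ofReal (2 * Real.exp (-(t ^ 2 / 2))) := by
  have one : ∀ b : E, ‖b‖ ≤ R → gaussianMeasure E {x | t * R < inner ℝ b x} ≤
      ENNReal.ofReal (Real.exp (-(t ^ 2 / 2))) := by
    intro b hb
    -- Chernoff's bound with the exponent that is optimal for variance `R²`.
    set c : E := (t / R) • b
    have hc : ‖c‖ ^ 2 / 2 ≤ t ^ 2 / 2 := by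
      have : ‖c‖ ≤ t := by
        rw [norm_smul, Real.norm_of_nonneg (by positivity)]
        calc t / R * ‖b‖ ≤ t / R * R := by gcongr
          _ = t := by field_simp
      gcongr
    have hmk : ENNReal.ofReal (Real.exp (t ^ 2)) * gaussianMeasure E {x | t * R < inner ℝ b x} ≤
        ENNReal.ofReal (Real.exp (t ^ 2 / 2)) := by
      refine le_trans ?_ (le_trans (mul_meas_ge_le_lintegral₀ (μ := gaussianMeasure E)
        (f := fun x => ENNReal.ofReal (Real.exp (inner ℝ c x))) (by fun_prop)
        (ENNReal.ofReal (Real.exp (t ^ 2)))) ?_)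
      · refine mul_le_mul' le_rfl (measure_mono fun x (hx : t * R < inner ℝ b x) => ?_)
        simp only [Set.mem_ofPred_eq]
        apply ENNReal.ofReal_le_ofReal
        apply Real.exp_le_exp.2
        rw [inner_smul_left]
        simp only [conj_trivial]
        calc t ^ 2 = t / R * (t * R) := by field_simp
          _ ≤ t / R * inner ℝ b x := by gcongr
      · rw [lintegral_exp_inner_gaussianMeasure]
        gcongr
    have h5 : ENNReal.ofReal (Real.exp (-t ^ 2)) * (ENNReal.ofReal (Real.exp (t ^ 2)) *
        gaussianMeasure E {x | t * R < inner ℝ b x}) ≤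
        ENNReal.ofReal (Real.exp (-t ^ 2)) * ENNReal.ofReal (Real.exp (t ^ 2 / 2)) := by gcongr
    rw [← mul_assoc, ← ENNReal.ofReal_mul (Real.exp_pos _).le,
      ← ENNReal.ofReal_mul (Real.exp_pos _).le, ← Real.exp_add, ← Real.exp_add] at h5
    simp only [neg_add_cancel, Real.exp_zero, ENNReal.ofReal_one, one_mul] at h5
    convert h5 using 3
    ring
  have hsub : {x : E | t * R < |inner ℝ a x|} ⊆
      {x | t * R < inner ℝ a x} ∪ {x | t * R < inner ℝ (-a) x} := by
    intro x (hx : t * R < |inner ℝ a x|)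
    rcases lt_abs.1 hx with h | h
    · exact Or.inl h
    · exact Or.inr (by simpa [inner_neg_left] using h)
  calc _ ≤ _ := measure_mono hsub
    _ ≤ _ := measure_union_le _ _
    _ ≤ ENNReal.ofReal (Real.exp (-(t ^ 2 / 2))) + ENNReal.ofReal (Real.exp (-(t ^ 2 / 2))) :=
        add_le_add (one a ha) (one (-a) (by simpa using ha))
    _ = _ := by rw [← ENNReal.ofReal_add (by positivity) (by positivity)]; ring_nf

/-- A square is bounded by an exponential with the parameter `t` that suits a maximum of `exp (t²)`
Gaussian variables. -/
theorem sq_le_of_one_le {t y : ℝ} (ht : 1 ≤ t) (hy : 0 ≤ y) :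
    y ^ 2 ≤ 4 * t ^ 2 * (1 + Real.exp (t * y - 2 * t ^ 2)) := by
  have h1 : 1 + (t * y - 2 * t ^ 2) / 2 ≤ Real.exp ((t * y - 2 * t ^ 2) / 2) := by
    linarith [Real.add_one_le_exp ((t * y - 2 * t ^ 2) / 2)]
  have hE := Real.exp_pos (t * y - 2 * t ^ 2)
  rcases le_or_gt y (2 * t) with h | h
  · nlinarith [mul_pos (mul_pos (by linarith : 0 < t) (by linarith : 0 < t)) hE]
  · have h0 : 0 ≤ t * y - 2 * t ^ 2 := by nlinarith
    have h2 : (1 + (t * y - 2 * t ^ 2) / 2) ^ 2 ≤ Real.exp (t * y - 2 * t ^ 2) := by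
      calc _ ≤ Real.exp ((t * y - 2 * t ^ 2) / 2) ^ 2 := by gcongr
        _ = _ := by rw [← Real.exp_nat_mul]; congr 1; push_cast; ring
    have h3 : y ≤ 2 * t * (1 + (t * y - 2 * t ^ 2) / 2) := by
      have : 0 ≤ (t ^ 2 - 1) * (y - 2 * t) := by
        apply mul_nonneg <;> nlinarith
      nlinarith
    calc y ^ 2 ≤ (2 * t * (1 + (t * y - 2 * t ^ 2) / 2)) ^ 2 := by gcongr
      _ = 4 * t ^ 2 * (1 + (t * y - 2 * t ^ 2) / 2) ^ 2 := by ring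
      _ ≤ 4 * t ^ 2 * Real.exp (t * y - 2 * t ^ 2) := by gcongr
      _ ≤ _ := by nlinarith [sq_nonneg t]

/-- The second moment of a maximum of Gaussian linear functionals, here a function `N` dominated
by such a maximum, is at most logarithmic in their number. -/
theorem lintegral_sq_max_gaussian_le {P : Type*} (s : Finset P) (a : P → E) {R t : ℝ}
    (hR : 0 < R) (ha : ∀ p ∈ s, ‖a p‖ ≤ R) (ht : 1 ≤ t) (hcard : (s.card : ℝ) ≤ Real.exp (t ^ 2))
    (N : E → ℝ) (hN : ∀ x, N x = 0 ∨ ∃ p ∈ s, N x = |inner ℝ (a p) x|) :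
    ∫⁻ x, ENNReal.ofReal (N x ^ 2) ∂(gaussianMeasure E) ≤ ENNReal.ofReal (12 * R ^ 2 * t ^ 2) := by
  set g : P → E → ℝ := fun p x => Real.exp (inner ℝ ((t / R) • a p) x) +
    Real.exp (inner ℝ (-((t / R) • a p)) x)
  have hbound : ∀ x, N x ^ 2 ≤ 4 * R ^ 2 * t ^ 2 +
      4 * R ^ 2 * t ^ 2 * Real.exp (-(2 * t ^ 2)) * ∑ p ∈ s, g p x := by
    intro x
    have hg : ∀ p, 0 ≤ g p x := fun p => by positivity
    have hsum : 0 ≤ ∑ p ∈ s, g p x := Finset.sum_nonneg fun p _ => hg p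
    rcases hN x with h | ⟨p, hp, h⟩
    · rw [h]; simp only [ne_eq, OfNat.ofNat_ne_zero, not_false_eq_true, zero_pow]; positivity
    · have h1 := sq_le_of_one_le ht (y := |inner ℝ (a p) x| / R) (by positivity)
      have h2 : Real.exp (t * (|inner ℝ (a p) x| / R)) ≤ g p x := by
        have e : t * (|inner ℝ (a p) x| / R) = |inner ℝ ((t / R) • a p) x| := by
          rw [inner_smul_left, abs_mul]
          simp only [conj_trivial]
          rw [abs_of_nonneg (by positivity : 0 ≤ t / R)]; ring
        rw [e]
        simp only [g, inner_neg_left]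
        rcases abs_cases (inner ℝ ((t / R) • a p) x) with ⟨h, _⟩ | ⟨h, _⟩ <;> rw [h]
        · linarith [Real.exp_pos (-(inner ℝ ((t / R) • a p) x))]
        · linarith [Real.exp_pos (inner ℝ ((t / R) • a p) x)]
      have h3 : g p x ≤ ∑ p ∈ s, g p x := Finset.single_le_sum (fun p _ => hg p) hp
      rw [h]
      calc |inner ℝ (a p) x| ^ 2 = R ^ 2 * (|inner ℝ (a p) x| / R) ^ 2 := by field_simp
        _ ≤ R ^ 2 * (4 * t ^ 2 * (1 + Real.exp (t * (|inner ℝ (a p) x| / R) - 2 * t ^ 2))) := by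
            gcongr
        _ = 4 * R ^ 2 * t ^ 2 + 4 * R ^ 2 * t ^ 2 * Real.exp (-(2 * t ^ 2)) *
            Real.exp (t * (|inner ℝ (a p) x| / R)) := by
            rw [sub_eq_add_neg, Real.exp_add]; ring
        _ ≤ _ := by gcongr; exact h2.trans h3
  have hmg : ∀ p, Measurable fun x => ENNReal.ofReal (g p x) := fun p => by
    simp only [g]; fun_prop
  have hint : ∀ p ∈ s, ∫⁻ x, ENNReal.ofReal (g p x) ∂(gaussianMeasure E) ≤
      ENNReal.ofReal (2 * Real.exp (t ^ 2 / 2)) := by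
    intro p hp
    have hn : ‖(t / R) • a p‖ ≤ t := by
      rw [norm_smul, Real.norm_of_nonneg (by positivity)]
      calc t / R * ‖a p‖ ≤ t / R * R := by gcongr; exact ha p hp
        _ = t := by field_simp
    have e : ∀ x, ENNReal.ofReal (g p x) = ENNReal.ofReal (Real.exp (inner ℝ ((t / R) • a p) x)) +
        ENNReal.ofReal (Real.exp (inner ℝ (-((t / R) • a p)) x)) := fun x =>
      ENNReal.ofReal_add (Real.exp_pos _).le (Real.exp_pos _).le
    simp_rw [e]
    rw [lintegral_add_left (by fun_prop), lintegral_exp_inner_gaussianMeasure,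
      lintegral_exp_inner_gaussianMeasure, norm_neg, ← ENNReal.ofReal_add (Real.exp_pos _).le
      (Real.exp_pos _).le, ← two_mul]
    gcongr
  calc ∫⁻ x, ENNReal.ofReal (N x ^ 2) ∂(gaussianMeasure E)
      ≤ ∫⁻ x, (ENNReal.ofReal (4 * R ^ 2 * t ^ 2) +
        ENNReal.ofReal (4 * R ^ 2 * t ^ 2 * Real.exp (-(2 * t ^ 2))) *
          ∑ p ∈ s, ENNReal.ofReal (g p x)) ∂(gaussianMeasure E) := by
        refine lintegral_mono fun x => ?_
        rw [← ENNReal.ofReal_sum_of_nonneg (fun p _ => by positivity),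
          ← ENNReal.ofReal_mul (by positivity), ← ENNReal.ofReal_add (by positivity)
          (mul_nonneg (by positivity) (Finset.sum_nonneg fun p _ => by positivity))]
        exact ENNReal.ofReal_le_ofReal (hbound x)
    _ = ENNReal.ofReal (4 * R ^ 2 * t ^ 2) +
        ENNReal.ofReal (4 * R ^ 2 * t ^ 2 * Real.exp (-(2 * t ^ 2))) *
          ∑ p ∈ s, ∫⁻ x, ENNReal.ofReal (g p x) ∂(gaussianMeasure E) := by
        rw [lintegral_add_left measurable_const, lintegral_const, measure_univ, mul_one,
          lintegral_const_mul _ (Finset.measurable_fun_sum _ fun p _ => hmg p),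
          lintegral_finsetSum _ fun p _ => hmg p]
    _ ≤ ENNReal.ofReal (4 * R ^ 2 * t ^ 2) +
        ENNReal.ofReal (4 * R ^ 2 * t ^ 2 * Real.exp (-(2 * t ^ 2))) *
          ∑ p ∈ s, ENNReal.ofReal (2 * Real.exp (t ^ 2 / 2)) := by
        gcongr with p hp
        exact hint p hp
    _ = ENNReal.ofReal (4 * R ^ 2 * t ^ 2 + 4 * R ^ 2 * t ^ 2 * Real.exp (-(2 * t ^ 2)) *
          (s.card * (2 * Real.exp (t ^ 2 / 2)))) := by
        rw [Finset.sum_const, nsmul_eq_mul, ← ENNReal.ofReal_natCast,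
          ← ENNReal.ofReal_mul (by positivity), ← ENNReal.ofReal_mul (by positivity),
          ← ENNReal.ofReal_add (by positivity) (by positivity)]
    _ ≤ _ := by
        apply ENNReal.ofReal_le_ofReal
        have h1 : Real.exp (-(2 * t ^ 2)) * (s.card * (2 * Real.exp (t ^ 2 / 2))) ≤ 2 := by
          calc _ ≤ Real.exp (-(2 * t ^ 2)) * (Real.exp (t ^ 2) * (2 * Real.exp (t ^ 2 / 2))) := by
                gcongr
            _ = 2 * Real.exp (-(t ^ 2 / 2)) := by
                rw [mul_left_comm (Real.exp (t ^ 2)), mul_left_comm, ← Real.exp_add,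
                  ← Real.exp_add]
                ring_nf
            _ ≤ 2 * 1 := by
                gcongr
                exact Real.exp_le_one_iff.2 (by nlinarith [sq_nonneg t])
            _ = 2 := by norm_num
        have h2 : 0 ≤ 4 * R ^ 2 * t ^ 2 := by positivity
        calc _ = 4 * R ^ 2 * t ^ 2 + 4 * R ^ 2 * t ^ 2 * (Real.exp (-(2 * t ^ 2)) *
              (s.card * (2 * Real.exp (t ^ 2 / 2)))) := by ring
          _ ≤ 4 * R ^ 2 * t ^ 2 + 4 * R ^ 2 * t ^ 2 * 2 := by gcongr
          _ = _ := by ring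

end Gaussian

/-! ### Nets, minimal norms over convex hulls, and mixed balls -/

/-- A maximal family of pairwise far points is a net. -/
theorem exists_finset_net {X : Type*} (A : Set X) (near : X → X → Prop) (hrefl : ∀ x, near x x)
    (hsymm : ∀ x y, near x y → near y x) (b : ℝ)
    (hcard : ∀ F : Finset X, ↑F ⊆ A → (∀ y ∈ F, ∀ y' ∈ F, y ≠ y' → ¬ near y y') →
      (F.card : ℝ) ≤ b) :
    ∃ F : Finset X, ↑F ⊆ A ∧ (F.card : ℝ) ≤ b ∧ ∀ x ∈ A, ∃ y ∈ F, near x y := by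
  classical
  let P : ℕ → Prop := fun n => ∃ F : Finset X, ↑F ⊆ A ∧
    (∀ y ∈ F, ∀ y' ∈ F, y ≠ y' → ¬ near y y') ∧ F.card = n
  have hP0 : P 0 := ⟨∅, by simp, by simp, rfl⟩
  have hbd : ∀ n, P n → n ≤ ⌊b⌋₊ := by
    rintro n ⟨F, h1, h2, rfl⟩
    exact Nat.le_floor (hcard F h1 h2)
  obtain ⟨F, h1, h2, h3⟩ : P (Nat.findGreatest P ⌊b⌋₊) :=
    Nat.findGreatest_spec (P := P) (Nat.zero_le _) hP0
  refine ⟨F, h1, hcard F h1 h2, fun x hx => ?_⟩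
  by_contra! hfar
  have hxF : x ∉ F := fun h => hfar x h (hrefl x)
  have hP : P (F.card + 1) := by
    refine ⟨insert x F, ?_, ?_, Finset.card_insert_of_notMem hxF⟩
    · rw [Finset.coe_insert]
      exact Set.insert_subset hx h1
    · intro y hy y' hy' hne
      rcases Finset.mem_insert.1 hy with rfl | hyF <;>
        rcases Finset.mem_insert.1 hy' with rfl | hyF'
      · exact absurd rfl hne
      · exact hfar _ hyF'
      · exact fun h => hfar _ hyF (hsymm _ _ h)
      · exact h2 y hyF y' hyF' hne
  have := Nat.le_findGreatest (hbd _ hP) hP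
  omega

section Net

variable {E : Type*} [NormedAddCommGroup E] [InnerProductSpace ℝ E] [FiniteDimensional ℝ E]

open Metric Module in
/-- The volumetric bound for the number of separated points of the unit ball. -/
theorem card_le_of_norm_separated {δ : ℝ} (hδ : 0 < δ) (F : Finset E) (hF : ∀ x ∈ F, ‖x‖ ≤ 1)
    (hsep : ∀ x ∈ F, ∀ y ∈ F, x ≠ y → δ < ‖x - y‖) :
    (F.card : ℝ) ≤ (1 + 2 / δ) ^ finrank ℝ E := by
  borelize E
  let μ : Measure E := Measure.addHaar
  have hδ2 : 0 < δ / 2 := by positivity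
  have hρ : 0 < 1 + δ / 2 := by positivity
  have D : Set.Pairwise (F : Set E) (Function.onFun Disjoint fun c => ball (c : E) (δ / 2)) := by
    rintro c hc d hd hcd
    apply ball_disjoint_ball
    rw [dist_eq_norm]
    linarith [hsep c hc d hd hcd]
  have hsub : (⋃ c ∈ F, ball (c : E) (δ / 2)) ⊆ ball (0 : E) (1 + δ / 2) := by
    refine Set.iUnion₂_subset fun x hx => ball_subset_ball' ?_
    rw [dist_zero_right]
    linarith [hF x hx]
  have I : (F.card : ℝ≥0∞) * ENNReal.ofReal ((δ / 2) ^ finrank ℝ E) * μ (ball 0 1) ≤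
      ENNReal.ofReal ((1 + δ / 2) ^ finrank ℝ E) * μ (ball 0 1) :=
    calc (F.card : ℝ≥0∞) * ENNReal.ofReal ((δ / 2) ^ finrank ℝ E) * μ (ball 0 1)
        = μ (⋃ c ∈ F, ball (c : E) (δ / 2)) := by
          rw [measure_biUnion_finset D fun c _ => measurableSet_ball]
          simp only [μ.addHaar_ball_of_pos _ hδ2]
          simp only [Finset.sum_const, nsmul_eq_mul, mul_assoc]
      _ ≤ μ (ball (0 : E) (1 + δ / 2)) := measure_mono hsub
      _ = _ := by simp only [μ.addHaar_ball_of_pos _ hρ]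
  have J : (F.card : ℝ≥0∞) * ENNReal.ofReal ((δ / 2) ^ finrank ℝ E) ≤
      ENNReal.ofReal ((1 + δ / 2) ^ finrank ℝ E) :=
    (ENNReal.mul_le_mul_iff_left (measure_ball_pos _ _ zero_lt_one).ne' measure_ball_lt_top.ne).1 I
  have K := ENNReal.toReal_le_of_le_ofReal (pow_nonneg hρ.le _) J
  rw [ENNReal.toReal_mul, ENNReal.toReal_natCast, ENNReal.toReal_ofReal (by positivity)] at K
  have e : (1 + 2 / δ) = (1 + δ / 2) / (δ / 2) := by field_simp; ring
  rw [e, div_pow, le_div_iff₀ (by positivity)]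
  exact K

theorem exists_norm_net {δ : ℝ} (hδ : 0 < δ) (A : Set E) (hA : ∀ x ∈ A, ‖x‖ ≤ 1) :
    ∃ F : Finset E, ↑F ⊆ A ∧ (F.card : ℝ) ≤ (1 + 2 / δ) ^ Module.finrank ℝ E ∧
      ∀ x ∈ A, ∃ y ∈ F, ‖x - y‖ ≤ δ := by
  refine exists_finset_net A (fun x y => ‖x - y‖ ≤ δ) (fun x => by simpa using hδ.le)
    (fun x y h => by rwa [norm_sub_rev]) _ fun F hFA hF => ?_
  exact card_le_of_norm_separated hδ F (fun x hx => hA x (hFA hx))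
    fun x hx y hy hne => not_le.1 (hF x hx y hy hne)

end Net

section MinNorm

variable {E : Type*} [NormedAddCommGroup E] [InnerProductSpace ℝ E]

/-- The least squared norm over the convex hull of a set (an infimum). -/
noncomputable def minNormSq (C : Set E) : ℝ :=
  sInf ((fun y => ‖y‖ ^ 2) '' convexHull ℝ C)

omit [InnerProductSpace ℝ E] in
theorem bddBelow_normSq (C : Set E) : BddBelow ((fun y => ‖y‖ ^ 2) '' C) :=
  ⟨0, by rintro _ ⟨y, -, rfl⟩; positivity⟩

theorem minNormSq_le {C : Set E} {y : E} (hy : y ∈ convexHull ℝ C) : minNormSq C ≤ ‖y‖ ^ 2 :=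
  csInf_le (bddBelow_normSq _) ⟨y, hy, rfl⟩

theorem minNormSq_nonneg (C : Set E) : 0 ≤ minNormSq C :=
  Real.sInf_nonneg (by rintro _ ⟨y, -, rfl⟩; positivity)

theorem minNormSq_anti {C D : Set E} (hC : C.Nonempty) (h : C ⊆ D) :
    minNormSq D ≤ minNormSq C :=
  csInf_le_csInf (bddBelow_normSq _) (hC.convexHull.image _)
    (Set.image_mono (convexHull_mono h))

theorem minNormSq_le_one {C : Set E} (hC : C.Nonempty) (h : ∀ x ∈ C, ‖x‖ ≤ 1) :
    minNormSq C ≤ 1 := by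
  obtain ⟨x, hx⟩ := hC
  refine (minNormSq_le (subset_convexHull ℝ C hx)).trans ?_
  have := h x hx
  nlinarith [norm_nonneg x]

theorem exists_normSq_lt {C : Set E} (hC : C.Nonempty) {b : ℝ} (h : minNormSq C < b) :
    ∃ y ∈ convexHull ℝ C, ‖y‖ ^ 2 < b := by
  obtain ⟨_, ⟨y, hy, rfl⟩, hlt⟩ := exists_lt_of_csInf_lt (hC.convexHull.image _) h
  exact ⟨y, hy, hlt⟩

/-- Uniform convexity of the Euclidean ball: near-minimizers of the norm are close together. -/
theorem norm_sub_sq_le_of_near_min {C : Set E} {y z : E} {η : ℝ} (hy : y ∈ convexHull ℝ C)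
    (hz : z ∈ convexHull ℝ C) (hy' : ‖y‖ ^ 2 ≤ minNormSq C + η)
    (hz' : ‖z‖ ^ 2 ≤ minNormSq C + η) : ‖y - z‖ ^ 2 ≤ 4 * η := by
  have hm : (1 / 2 : ℝ) • y + (1 / 2 : ℝ) • z ∈ convexHull ℝ C :=
    convex_convexHull ℝ C hy hz (by norm_num) (by norm_num) (by norm_num)
  have h1 := minNormSq_le hm
  rw [← smul_add, norm_smul, mul_pow] at h1
  have h2 := parallelogram_law_with_norm ℝ y z
  norm_num at h1
  nlinarith

end MinNorm

section Near

variable {E : Type*} [NormedAddCommGroup E] [InnerProductSpace ℝ E]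
  {ι : Type*} [Fintype ι]

/-- `z` has size at most `s` both in the seminorm `Nm` and in the `α`-weighted `ℓ²`-sum of the
seminorms `N i`, the latter measured in units of `β`. -/
def Near (N : ι → Seminorm ℝ E) (Nm : Seminorm ℝ E) (β : ℝ) (α : ι → ℝ) (s : ℝ) (z : E) : Prop :=
  Nm z ≤ s ∧ ∑ i, α i * N i z ^ 2 ≤ (β * s) ^ 2

variable {N : ι → Seminorm ℝ E} {Nm : Seminorm ℝ E} {β : ℝ} {α : ι → ℝ} {s : ℝ} {z w : E}

theorem near_zero (hs : 0 ≤ s) : Near N Nm β α s 0 := by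
  refine ⟨by simpa using hs, ?_⟩
  simp only [map_zero]
  simp only [ne_eq, OfNat.ofNat_ne_zero, not_false_eq_true, zero_pow, mul_zero,
    Finset.sum_const_zero]
  positivity

theorem Near.neg (h : Near N Nm β α s z) : Near N Nm β α s (-z) := by
  simpa [Near] using h

theorem Near.sub_comm (h : Near N Nm β α s (z - w)) : Near N Nm β α s (w - z) := by
  simpa using h.neg

theorem Near.smul (h : Near N Nm β α s z) {c : ℝ} (hc : 0 ≤ c) :
    Near N Nm β α (c * s) (c • z) := by
  refine ⟨?_, ?_⟩
  · rw [map_smul_eq_mul, Real.norm_of_nonneg hc]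
    exact mul_le_mul_of_nonneg_left h.1 hc
  · have : ∀ i, α i * N i (c • z) ^ 2 = c ^ 2 * (α i * N i z ^ 2) := fun i => by
      rw [map_smul_eq_mul, Real.norm_of_nonneg hc]; ring
    simp_rw [this, ← Finset.mul_sum]
    calc _ ≤ c ^ 2 * (β * s) ^ 2 := mul_le_mul_of_nonneg_left h.2 (sq_nonneg c)
      _ = _ := by ring

theorem Near.anti_weight {α' : ι → ℝ} (h : Near N Nm β α' s z) (hα : ∀ i, α i ≤ α' i) :
    Near N Nm β α s z :=
  ⟨h.1, (Finset.sum_le_sum fun i _ => mul_le_mul_of_nonneg_right (hα i) (sq_nonneg _)).trans h.2⟩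

theorem Near.convex_comb (hα : ∀ i, 0 ≤ α i) (hz : Near N Nm β α s z) (hw : Near N Nm β α s w)
    {a b : ℝ} (ha : 0 ≤ a) (hb : 0 ≤ b) (hab : a + b = 1) : Near N Nm β α s (a • z + b • w) := by
  have tri : ∀ p : Seminorm ℝ E, p (a • z + b • w) ≤ a * p z + b * p w := fun p => by
    refine (map_add_le_add p _ _).trans ?_
    rw [map_smul_eq_mul, map_smul_eq_mul, Real.norm_of_nonneg ha, Real.norm_of_nonneg hb]
  refine ⟨(tri Nm).trans ?_, ?_⟩
  · calc _ ≤ a * s + b * s := by gcongr <;> [exact hz.1; exact hw.1]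
      _ = s := by rw [← add_mul, hab, one_mul]
  · calc ∑ i, α i * N i (a • z + b • w) ^ 2 ≤
          ∑ i, (a * (α i * N i z ^ 2) + b * (α i * N i w ^ 2)) := by
          refine Finset.sum_le_sum fun i _ => ?_
          have h1 : N i (a • z + b • w) ^ 2 ≤ (a * N i z + b * N i w) ^ 2 := by
            gcongr
            exact tri (N i)
          have h2 : (a * N i z + b * N i w) ^ 2 ≤ a * N i z ^ 2 + b * N i w ^ 2 := by
            have hb' : b = 1 - a := by linarith
            subst hb'
            nlinarith [mul_nonneg (mul_nonneg ha hb) (sq_nonneg (N i z - N i w))]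
          calc α i * N i (a • z + b • w) ^ 2 ≤ α i * (a * N i z ^ 2 + b * N i w ^ 2) :=
                mul_le_mul_of_nonneg_left (h1.trans h2) (hα i)
            _ = _ := by ring
      _ ≤ a * (β * s) ^ 2 + b * (β * s) ^ 2 := by
          rw [Finset.sum_add_distrib, ← Finset.mul_sum, ← Finset.mul_sum]
          gcongr <;> [exact hz.2; exact hw.2]
      _ = _ := by rw [← add_mul, hab, one_mul]

theorem Near.add (hα : ∀ i, 0 ≤ α i) (hz : Near N Nm β α s z) (hw : Near N Nm β α s w) :
    Near N Nm β α (2 * s) (z + w) := by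
  have h := (hz.convex_comb hα hw (a := 1 / 2) (b := 1 / 2) (by norm_num) (by norm_num)
    (by norm_num)).smul (c := 2) (by norm_num)
  rw [← smul_add, smul_smul] at h
  norm_num at h
  exact h

theorem Near.sub (hα : ∀ i, 0 ≤ α i) (hz : Near N Nm β α s z) (hw : Near N Nm β α s w) :
    Near N Nm β α (2 * s) (z - w) := by
  rw [sub_eq_add_neg]
  exact hz.add hα hw.neg

/-- If every point of `C` is near `t`, so is every point of its convex hull. -/
theorem near_of_mem_convexHull (hα : ∀ i, 0 ≤ α i) {C : Set E} {t y : E}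
    (hC : ∀ x ∈ C, Near N Nm β α s (x - t)) (hy : y ∈ convexHull ℝ C) :
    Near N Nm β α s (y - t) := by
  have hconv : Convex ℝ {x : E | Near N Nm β α s (x - t)} := by
    intro x hx x' hx' a b ha hb hab
    have := Near.convex_comb hα hx hx' ha hb hab
    have e : a • (x - t) + b • (x' - t) = a • x + b • x' - t := by
      rw [smul_sub, smul_sub, sub_add_sub_comm, ← add_smul, hab, one_smul]
    rw [e] at this
    exact this
  exact convexHull_min (fun x hx => hC x hx) hconv hy

theorem measurableSet_near [MeasurableSpace E] [BorelSpace E] (hN : ∀ i, Continuous (N i))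
    (hNm : Continuous Nm) : MeasurableSet {z : E | Near N Nm β α s z} := by
  have h1 : IsClosed {z : E | Nm z ≤ s} := isClosed_le hNm continuous_const
  have h2 : IsClosed {z : E | ∑ i, α i * N i z ^ 2 ≤ (β * s) ^ 2} :=
    isClosed_le (continuous_finsetSum _ fun i _ => ((hN i).pow 2).const_mul _) continuous_const
  exact (h1.inter h2).measurableSet

end Near

/-! ### The partitioning scheme and chains of cells -/

section Subdivide

variable {E : Type*} [NormedAddCommGroup E] [InnerProductSpace ℝ E] [FiniteDimensional ℝ E]
  [MeasurableSpace E] [BorelSpace E] {ι : Type*} [Fintype ι]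
  {N : ι → Seminorm ℝ E} {Nm : Seminorm ℝ E} {β κ : ℝ} {α : ι → ℝ}

/-- The dual Sudakov bound for points that are separated with respect to `Near`. -/
theorem card_le_of_near_separated (hN : ∀ i, Continuous (N i)) (hNm : Continuous Nm)
    (hκ : 0 < κ) (hα : ∀ i, 0 ≤ α i)
    (hhalf : 1 / 2 ≤ gaussianMeasure E {z | Near N Nm β α κ z}) {s ρ : ℝ} (hs : 0 < s) (u : E)
    (F : Finset E) (hF : ∀ y ∈ F, ‖y - u‖ ≤ ρ)
    (hsep : ∀ y ∈ F, ∀ y' ∈ F, y ≠ y' → ¬ Near N Nm β α s (y - y')) :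
    (F.card : ℝ) ≤ 2 * Real.exp (2 * ρ ^ 2 * κ ^ 2 / s ^ 2) := by
  have h := card_le_of_gaussian_separated (K := {z : E | Near N Nm β α κ z})
    (measurableSet_near hN hNm) (fun x hx => Near.neg hx) hhalf (σ := s / (2 * κ)) (ρ := ρ)
    (by positivity) u F hF ?_
  · convert h using 3
    field_simp
  · intro y hy y' hy' hne a ha b hb heq
    apply hsep y hy y' hy' hne
    rw [heq]
    have := (Near.sub hα ha hb).smul (c := s / (2 * κ)) (by positivity)
    rwa [show s / (2 * κ) * (2 * κ) = s by field_simp] at this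

/-- One step of the partitioning scheme. The points `x` of `A` are sorted by the integer part `i`
of `κ² / r²` times the gain in `minNormSq` from `A` to its part near `x`. Near-minimizers for the
points of one such stratum lie in a small Euclidean ball, so the stratum has an `r`-net of size
exponential in `i`; the cost `34 (i + 1)` of a cell therefore satisfies Kraft's inequality, and it
is paid for by the gain of every subset of the cell that is small at the next scale. -/
theorem exists_subdivision (hN : ∀ i, Continuous (N i)) (hNm : Continuous Nm)
    (hκ : 0 < κ) (hα : ∀ i, 0 ≤ α i)
    (hhalf : 1 / 2 ≤ gaussianMeasure E {z | Near N Nm β α κ z}) {r : ℝ} (hr : 0 < r)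
    {A : Set E} (hA1 : ∀ x ∈ A, ‖x‖ ≤ 1) :
    ∃ (J : Finset (Σ _ : ℕ, E)) (cell : (Σ _ : ℕ, E) → Set E) (m : (Σ _ : ℕ, E) → ℝ),
      (∀ x ∈ A, ∃ j ∈ J, x ∈ cell j) ∧ ∑ j ∈ J, Real.exp (-m j) ≤ 1 ∧
      ∀ j ∈ J, 0 ≤ m j ∧ cell j ⊆ A ∧ (cell j).Nonempty ∧
        (∀ x ∈ cell j, ∀ y ∈ cell j, Near N Nm β α (2 * r) (x - y)) ∧
        ∀ C ⊆ cell j, C.Nonempty → (∀ x ∈ C, ∀ y ∈ C, Near N Nm β α (r / 4) (x - y)) →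
          m j ≤ 34 * (1 + (minNormSq C - minNormSq A) * κ ^ 2 / r ^ 2) := by
  classical
  set loc : E → Set E := fun x => {x' ∈ A | Near N Nm β α (r / 4) (x' - x)} with hloc
  have hlocA : ∀ x, loc x ⊆ A := fun x x' h => h.1
  have hlocne : ∀ x ∈ A, (loc x).Nonempty := fun x hx =>
    ⟨x, hx, by rw [sub_self]; exact near_zero (by positivity)⟩
  set ψ : E → ℝ := fun x => minNormSq (loc x) with hψ
  have hψA : ∀ x ∈ A, minNormSq A ≤ ψ x := fun x hx => minNormSq_anti (hlocne x hx) (hlocA x)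
  have hψ1 : ∀ x ∈ A, ψ x ≤ 1 := fun x hx =>
    minNormSq_le_one (hlocne x hx) fun y hy => hA1 y (hlocA x hy)
  -- The stratum of a point, and for each point a near-minimizer `y x` of the norm.
  set lev : E → ℕ := fun x => ⌊(ψ x - minNormSq A) * κ ^ 2 / r ^ 2⌋₊ with hlev
  set η : ℕ → ℝ := fun i => (i + 1) * r ^ 2 / κ ^ 2 with hη
  have hlt : ∀ x, ψ x < minNormSq A + η (lev x) := by
    intro x
    have h := Nat.lt_floor_add_one ((ψ x - minNormSq A) * κ ^ 2 / r ^ 2)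
    rw [div_lt_iff₀ (by positivity), ← lt_div_iff₀ (by positivity)] at h
    simp only [hη, hlev]
    linarith
  have hy : ∀ x : E, ∃ y, x ∈ A → y ∈ convexHull ℝ (loc x) ∧
      ‖y‖ ^ 2 < minNormSq A + η (lev x) := by
    intro x
    by_cases hx : x ∈ A
    · obtain ⟨y, h1, h2⟩ := exists_normSq_lt (hlocne x hx) (hlt x)
      exact ⟨y, fun _ => ⟨h1, h2⟩⟩
    · exact ⟨0, fun h => absurd h hx⟩
  choose y hyx using hy
  have hynear : ∀ x ∈ A, Near N Nm β α (r / 4) (y x - x) := fun x hx =>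
    near_of_mem_convexHull hα (fun x' hx' => hx'.2) (hyx x hx).1
  have hnet : ∀ i : ℕ, ∃ F : Finset E, ↑F ⊆ {x ∈ A | lev x = i} ∧
      (F.card : ℝ) ≤ 2 * Real.exp (32 * (i + 1)) ∧
      ∀ x ∈ {x ∈ A | lev x = i}, ∃ t ∈ F, Near N Nm β α r (x - t) := by
    intro i
    refine exists_finset_net _ (fun x t => Near N Nm β α r (x - t))
      (fun x => by rw [sub_self]; exact near_zero hr.le) (fun _ _ h => h.sub_comm) _ ?_
    intro F hF hsep
    rcases F.eq_empty_or_nonempty with rfl | ⟨t₀, ht₀⟩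
    · simp only [Finset.card_empty, Nat.cast_zero]; positivity
    have hdiff : ∀ t ∈ F, ∀ t' ∈ F, Near N Nm β α (r / 2) (y t - y t') →
        Near N Nm β α r (t - t') := by
      intro t ht t' ht' h
      have h1 := (hynear t' (hF ht').1).sub hα (hynear t (hF ht).1)
      rw [show 2 * (r / 4) = r / 2 by ring] at h1
      have h2 := h.add hα h1
      rw [show 2 * (r / 2) = r by ring] at h2
      convert h2 using 1
      abel
    have hinj : Set.InjOn y F := by
      intro t ht t' ht' heq
      by_contra hne
      refine hsep t ht t' ht' hne (hdiff t ht t' ht' ?_)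
      rw [heq, sub_self]
      exact near_zero (by positivity)
    have hcard := card_le_of_near_separated hN hNm hκ hα hhalf (s := r / 2)
      (ρ := √(4 * η i)) (by positivity) (y t₀) (F.image y) ?_ ?_
    · rw [Finset.card_image_of_injOn hinj, Real.sq_sqrt (by positivity)] at hcard
      convert hcard using 3
      simp only [hη]
      field_simp
      ring
    · intro z hz
      obtain ⟨t, ht, rfl⟩ := Finset.mem_image.1 hz
      apply Real.le_sqrt_of_sq_le
      have e1 : lev t = i := (hF ht).2
      have e2 : lev t₀ = i := (hF ht₀).2
      have h1 := hyx t (hF ht).1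
      have h2 := hyx t₀ (hF ht₀).1
      rw [e1] at h1
      rw [e2] at h2
      exact norm_sub_sq_le_of_near_min (convexHull_mono (hlocA t) h1.1)
        (convexHull_mono (hlocA t₀) h2.1) h1.2.le h2.2.le
    · intro z hz z' hz' hne h
      obtain ⟨t, ht, rfl⟩ := Finset.mem_image.1 hz
      obtain ⟨t', ht', rfl⟩ := Finset.mem_image.1 hz'
      exact hsep t ht t' ht' (fun e => hne (by rw [e])) (hdiff t ht t' ht' h)
  choose F hFA hFcard hFnet using hnet
  refine ⟨(Finset.range (⌊κ ^ 2 / r ^ 2⌋₊ + 1)).sigma fun i => F i,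
    fun j => {x ∈ A | lev x = j.1 ∧ Near N Nm β α r (x - j.2)}, fun j => 34 * (j.1 + 1),
    ?_, ?_, ?_⟩
  · intro x hx
    obtain ⟨t, ht, hn⟩ := hFnet (lev x) x ⟨hx, rfl⟩
    refine ⟨⟨lev x, t⟩, ?_, hx, rfl, hn⟩
    simp only [Finset.mem_sigma, Finset.mem_range]
    refine ⟨Nat.lt_succ_of_le (Nat.floor_le_floor ?_), ht⟩
    gcongr
    have := minNormSq_nonneg A
    have := hψ1 x hx
    calc (ψ x - minNormSq A) * κ ^ 2 ≤ 1 * κ ^ 2 := by gcongr; linarith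
      _ = _ := one_mul _
  · rw [Finset.sum_sigma]
    simp only [Finset.sum_const, nsmul_eq_mul]
    have hterm : ∀ i : ℕ, ((F i).card : ℝ) * Real.exp (-(34 * ((i : ℝ) + 1))) ≤
        (1 / 2 : ℝ) ^ (i + 1) := by
      intro i
      have e2 : Real.exp (-2) ≤ 1 / 4 := by
        rw [Real.exp_neg, one_div]
        apply inv_anti₀ (by norm_num)
        have h1 : (2 : ℝ) ≤ Real.exp 1 := by linarith [Real.add_one_le_exp (1 : ℝ)]
        calc (4 : ℝ) = 2 * 2 := by norm_num
          _ ≤ Real.exp 1 * Real.exp 1 := by gcongr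
          _ = Real.exp 2 := by rw [← Real.exp_add]; norm_num
      calc ((F i).card : ℝ) * Real.exp (-(34 * ((i : ℝ) + 1)))
          ≤ 2 * Real.exp (32 * (i + 1)) * Real.exp (-(34 * ((i : ℝ) + 1))) := by
            gcongr; exact hFcard i
        _ = 2 * Real.exp (-2) ^ (i + 1) := by
            rw [mul_assoc, ← Real.exp_add, ← Real.exp_nat_mul]
            congr 2
            push_cast
            ring
        _ ≤ 2 * (1 / 4) ^ (i + 1) := by gcongr
        _ = (2 * (1 / 2) ^ (i + 1)) * (1 / 2) ^ (i + 1) := by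
            rw [mul_assoc, ← mul_pow]; norm_num
        _ ≤ 1 * (1 / 2) ^ (i + 1) := by
            gcongr
            rw [pow_succ]
            have : (1 / 2 : ℝ) ^ i ≤ 1 := pow_le_one₀ (by norm_num) (by norm_num)
            linarith
        _ = _ := one_mul _
    refine (Finset.sum_le_sum fun i _ => hterm i).trans ?_
    have hgeom : ∀ n : ℕ, ∑ i ∈ Finset.range n, (1 / 2 : ℝ) ^ (i + 1) = 1 - (1 / 2) ^ n := by
      intro n
      induction n with
      | zero => simp
      | succ n ih => rw [Finset.sum_range_succ, ih, pow_succ]; ring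
    rw [hgeom]
    have : (0 : ℝ) ≤ (1 / 2) ^ (⌊κ ^ 2 / r ^ 2⌋₊ + 1) := by positivity
    linarith
  · rintro ⟨i, t⟩ hj
    rw [Finset.mem_sigma] at hj
    have ht := hFA i hj.2
    refine ⟨by positivity, fun x hx => hx.1, ⟨t, ht.1, ht.2, ?_⟩, ?_, ?_⟩
    · rw [sub_self]; exact near_zero hr.le
    · intro x hx x' hx'
      have := hx.2.2.sub hα hx'.2.2
      simpa using this
    · intro C hC hCne hsmall
      obtain ⟨x, hx⟩ := hCne
      have hxA := hC hx
      have h1 : ψ x ≤ minNormSq C :=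
        minNormSq_anti ⟨x, hx⟩ fun x' hx' => ⟨(hC hx').1, hsmall x' hx' x hx⟩
      have h2 : (i : ℝ) ≤ (ψ x - minNormSq A) * κ ^ 2 / r ^ 2 := by
        have h3 : lev x = i := hxA.2.1
        rw [← h3]
        apply Nat.floor_le
        have := hψA x hxA.1
        apply div_nonneg (mul_nonneg (by linarith) (by positivity)) (by positivity)
      have h4 : (ψ x - minNormSq A) * κ ^ 2 / r ^ 2 ≤
          (minNormSq C - minNormSq A) * κ ^ 2 / r ^ 2 := by gcongr
      simp only
      linarith

end Subdivide

section Chain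

variable {E : Type*} [NormedAddCommGroup E] [InnerProductSpace ℝ E] {ι : Type*} [Fintype ι]

/-- A point chosen in a set (an arbitrary point if the set is empty). -/
noncomputable def refPt (A : Set E) : E := Classical.epsilon fun x => x ∈ A

omit [InnerProductSpace ℝ E] in
theorem refPt_mem {A : Set E} (h : A.Nonempty) : refPt A ∈ A := Classical.epsilon_spec h

/-- The unit ball of the norm `‖·‖` intersected with the ball of radius `S` of the seminorm
`(∑ N_i²)^{1/2}`. -/
def energyBody (N : ι → Seminorm ℝ E) (S : ℝ) : Set E :=
  {x | ‖x‖ ≤ 1 ∧ ∑ i, N i x ^ 2 ≤ S ^ 2}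

/-- The weights, attached to a cell `A` at scale `r`, in the `ℓ²`-sum that measures the size of the
next cells. The subtracted multiple of `r` exceeds the variation of `N i` over `A`, so that the
weights grow along a chain of cells although the reference point changes. -/
noncomputable def cellWeight (N : ι → Seminorm ℝ E) (r : ℝ) (A : Set E) (i : ι) : ℝ :=
  (max (N i (refPt A) - 2 * r) 0) ^ 2

/-- The part of `a²` in excess of `(50 r)²`. It vanishes for `a ≤ 50 r`, and the factor `50` leaves
room for the variation of the seminorms between neighbouring scales. -/
def truncSq (r a : ℝ) : ℝ := max (a ^ 2 - (50 * r) ^ 2) 0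

/-- The coefficients of the increment of the sign process from a cell `A` at scale `r` to a cell
`A'` at scale `r / 8`. -/
noncomputable def linkVec (N : ι → Seminorm ℝ E) (r : ℝ) (A A' : Set E) (i : ι) : ℝ :=
  truncSq (r / 8) (N i (refPt A')) - truncSq r (N i (refPt A))

/-- The coefficients of the last increment, from a cell `A` at scale `r` to a point `y`. -/
noncomputable def endVec (N : ι → Seminorm ℝ E) (r : ℝ) (A : Set E) (y : E) (i : ι) : ℝ :=
  N i y ^ 2 - truncSq r (N i (refPt A))

/-- `A'` is a cell of the subdivision of the cell `A` (at scale `r`) into cells at scale `r / 8`,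
of cost `m`. -/
structure IsChild (N : ι → Seminorm ℝ E) (Nm : Seminorm ℝ E) (β κ r : ℝ) (A A' : Set E)
    (m : ℝ) : Prop where
  cost_nonneg : 0 ≤ m
  subset : A' ⊆ A
  nonempty : A'.Nonempty
  near : ∀ x ∈ A', ∀ y ∈ A', Near N Nm β (cellWeight N r A) (r / 8) (x - y)
  cost_le : ∀ C ⊆ A', C.Nonempty →
    (∀ x ∈ C, ∀ y ∈ C, Near N Nm β (cellWeight N r A) (r / 64) (x - y)) →
    m ≤ 34 * (1 + 256 * ((minNormSq C - minNormSq A) * κ ^ 2 / r ^ 2))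

/-- The value of the sign process at the vector `b`. -/
def signSum (s : ι → ℤˣ) (b : ι → ℝ) : ℝ := ∑ i, ((s i : ℤ) : ℝ) * b i

/-- For the signs `s`, there is a chain of `d` successive cells from `A` (at scale `r`, with the
cost `M` accumulated so far) down to cells containing `x`, and then a point `y` within `δ` of `x`,
such that each increment of the sign process obeys the Hoeffding bound at its accumulated cost;
`q` is the cost of the last step. -/
def GoodChain (N : ι → Seminorm ℝ E) (Nm : Seminorm ℝ E) (β κ δ q : ℝ) (s : ι → ℤˣ) (x : E) :
    ℕ → ℝ → Set E → ℝ → Prop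
  | 0, r, A, M => ∃ y ∈ A, ‖x - y‖ ≤ δ ∧
      |signSum s (endVec N r A y)| ≤ √(∑ i, endVec N r A y i ^ 2) * √(2 * (M + q + 1))
  | d + 1, r, A, M => ∃ A' m, IsChild N Nm β κ r A A' m ∧ x ∈ A' ∧
      |signSum s (linkVec N r A A')| ≤ √(∑ i, linkVec N r A A' i ^ 2) * √(2 * (M + m + 1)) ∧
      GoodChain N Nm β κ δ q s x d (r / 8) A' (M + m + 1)

theorem abs_sub_le_of_le {N Nm : Seminorm ℝ E} (h : ∀ x, N x ≤ Nm x) {s : ℝ} {x y : E}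
    (hxy : Nm (x - y) ≤ s) : |N x - N y| ≤ s :=
  (abs_sub_map_le_sub N x y).trans ((h _).trans hxy)

theorem sum_cellWeight_le {N : ι → Seminorm ℝ E} {S r : ℝ} (hr : 0 ≤ r) {A : Set E}
    (hA : A.Nonempty) (hAT : A ⊆ energyBody N S) : ∑ i, cellWeight N r A i ≤ S ^ 2 := by
  refine le_trans (Finset.sum_le_sum fun i _ => ?_) (hAT (refPt_mem hA)).2
  rw [cellWeight]
  have h0 : 0 ≤ N i (refPt A) := apply_nonneg _ _
  gcongr
  exact max_le (by linarith) h0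

theorem exp_neg_one_le_half : Real.exp (-1) ≤ 1 / 2 := by
  rw [Real.exp_neg, one_div]
  apply inv_anti₀ (by norm_num)
  linarith [Real.add_one_le_exp (1 : ℝ)]

/-- All but a fraction `2 exp (-M)` of the signs admit good chains for all points of the cell `A`
of accumulated cost `M`: the union bound over the tree of cells, whose costs satisfy Kraft's
inequality. -/
theorem exists_goodChain [DecidableEq ι] [FiniteDimensional ℝ E] [MeasurableSpace E]
    [BorelSpace E] {N : ι → Seminorm ℝ E} {Nm : Seminorm ℝ E} (hN : ∀ i, Continuous (N i))
    (hNm : Continuous Nm) {β κ S δ q : ℝ} (hκ : 0 < κ)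
    (hhalf : ∀ α : ι → ℝ, (∀ i, 0 ≤ α i) → ∑ i, α i ≤ S ^ 2 →
      1 / 2 ≤ gaussianMeasure E {z | Near N Nm β α κ z}) (hδ : 0 < δ)
    (hq : (1 + 2 / δ) ^ Module.finrank ℝ E ≤ Real.exp q) (hq0 : 0 ≤ q) (d : ℕ) :
    ∀ (r : ℝ) (A : Set E) (M : ℝ), 0 < r → A.Nonempty → A ⊆ energyBody N S → 0 ≤ M →
      ∃ Bad : Finset (ι → ℤˣ), (Bad.card : ℝ) ≤ 2 * Real.exp (-M) * Fintype.card (ι → ℤˣ) ∧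
        ∀ s ∉ Bad, ∀ x ∈ A, GoodChain N Nm β κ δ q s x d r A M := by
  classical
  induction d with
  | zero =>
    intro r A M hr hne hAT hM
    obtain ⟨F, hFA, hFc, hFn⟩ := exists_norm_net hδ A fun x hx => (hAT hx).1
    refine ⟨F.biUnion fun y => Finset.univ.filter fun s : ι → ℤˣ =>
      √(∑ i, endVec N r A y i ^ 2) * √(2 * (M + q + 1)) <
        |∑ i, ((s i : ℤ) : ℝ) * endVec N r A y i|, ?_, ?_⟩
    · calc _ ≤ ((∑ y ∈ F, (Finset.univ.filter fun s : ι → ℤˣ =>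
            √(∑ i, endVec N r A y i ^ 2) * √(2 * (M + q + 1)) <
            |∑ i, ((s i : ℤ) : ℝ) * endVec N r A y i|).card : ℕ) : ℝ) := by
            exact_mod_cast Finset.card_biUnion_le
        _ ≤ ∑ y ∈ F, 2 * Real.exp (-(M + q + 1)) * Fintype.card (ι → ℤˣ) := by
            push_cast
            exact Finset.sum_le_sum fun y _ => card_signs_large_le _ (by linarith)
        _ = F.card * (2 * Real.exp (-(M + q + 1)) * Fintype.card (ι → ℤˣ)) := by
            rw [Finset.sum_const, nsmul_eq_mul]
        _ ≤ Real.exp q * (2 * Real.exp (-(M + q + 1)) * Fintype.card (ι → ℤˣ)) := by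
            gcongr; exact hFc.trans hq
        _ = Real.exp (-1) * (2 * Real.exp (-M) * Fintype.card (ι → ℤˣ)) := by
            rw [show -(M + q + 1) = -M + -q + -1 by ring, Real.exp_add, Real.exp_add,
              Real.exp_neg q]
            field_simp
        _ ≤ 1 * (2 * Real.exp (-M) * Fintype.card (ι → ℤˣ)) := by
            gcongr
            linarith [exp_neg_one_le_half]
        _ = _ := one_mul _
    · intro s hs x hx
      obtain ⟨y, hy, hxy⟩ := hFn x hx
      refine ⟨y, hFA hy, hxy, ?_⟩
      by_contra! h
      exact hs (Finset.mem_biUnion.2 ⟨y, hy, Finset.mem_filter.2 ⟨Finset.mem_univ _, h⟩⟩)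
  | succ d ih =>
    intro r A M hr hne hAT hM
    obtain ⟨J, cell, m, hcov, hkraft, hJ⟩ := exists_subdivision (A := A) hN hNm hκ
      (fun i => sq_nonneg (max (N i (refPt A) - 2 * r) 0))
      (hhalf (cellWeight N r A) (fun i => sq_nonneg _) (sum_cellWeight_le hr.le hne hAT))
      (r := r / 16) (by positivity) (fun x hx => (hAT hx).1)
    have hchild : ∀ j ∈ J, IsChild N Nm β κ r A (cell j) (m j) := by
      intro j hj
      obtain ⟨h0, h1, h2, h3, h4⟩ := hJ j hj
      refine ⟨h0, h1, h2, ?_, ?_⟩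
      · intro x hx y hy
        have := h3 x hx y hy
        rwa [show 2 * (r / 16) = r / 8 by ring] at this
      · intro C hC hCne hCn
        have := h4 C hC hCne fun x hx y hy => by
          rw [show r / 16 / 4 = r / 64 by ring]
          exact hCn x hx y hy
        convert this using 3
        field_simp
        ring
    have hrec : ∀ j : (Σ _ : ℕ, E), ∃ Bad : Finset (ι → ℤˣ), j ∈ J →
        (Bad.card : ℝ) ≤ 2 * Real.exp (-(M + m j + 1)) * Fintype.card (ι → ℤˣ) ∧
        ∀ s ∉ Bad, ∀ x ∈ cell j, GoodChain N Nm β κ δ q s x d (r / 8) (cell j) (M + m j + 1) := by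
      intro j
      by_cases hj : j ∈ J
      · have hc := hchild j hj
        obtain ⟨Bad, h1, h2⟩ := ih (r / 8) (cell j) (M + m j + 1) (by positivity) hc.nonempty
          (hc.subset.trans hAT) (by linarith [hc.cost_nonneg])
        exact ⟨Bad, fun _ => ⟨h1, h2⟩⟩
      · exact ⟨∅, fun h => absurd h hj⟩
    choose Bad hBad using hrec
    refine ⟨J.biUnion fun j => (Finset.univ.filter fun s : ι → ℤˣ =>
      √(∑ i, linkVec N r A (cell j) i ^ 2) * √(2 * (M + m j + 1)) <
        |∑ i, ((s i : ℤ) : ℝ) * linkVec N r A (cell j) i|) ∪ Bad j, ?_, ?_⟩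
    · have hone : ∀ j ∈ J, (((Finset.univ.filter fun s : ι → ℤˣ =>
          √(∑ i, linkVec N r A (cell j) i ^ 2) * √(2 * (M + m j + 1)) <
          |∑ i, ((s i : ℤ) : ℝ) * linkVec N r A (cell j) i|) ∪ Bad j).card : ℝ) ≤
          (2 * Real.exp (-M) * Fintype.card (ι → ℤˣ)) * Real.exp (-m j) := by
        intro j hj
        have h1 := card_signs_large_le (linkVec N r A (cell j)) (M := M + m j + 1)
          (by linarith [(hchild j hj).cost_nonneg])
        have h2 := (hBad j hj).1
        have h3 : Real.exp (-(M + m j + 1)) = Real.exp (-M) * Real.exp (-m j) * Real.exp (-1) := by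
          rw [← Real.exp_add, ← Real.exp_add]; ring_nf
        rw [h3] at h1 h2
        have h4 : (0 : ℝ) ≤ Real.exp (-M) * Real.exp (-m j) * Fintype.card (ι → ℤˣ) := by
          positivity
        have h5 := mul_le_mul_of_nonneg_left exp_neg_one_le_half h4
        refine (Nat.cast_le.2 (Finset.card_union_le _ _)).trans ?_
        push_cast
        linarith
      calc _ ≤ ∑ j ∈ J, (((Finset.univ.filter fun s : ι → ℤˣ =>
            √(∑ i, linkVec N r A (cell j) i ^ 2) * √(2 * (M + m j + 1)) <
            |∑ i, ((s i : ℤ) : ℝ) * linkVec N r A (cell j) i|) ∪ Bad j).card : ℝ) := by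
            exact_mod_cast Finset.card_biUnion_le
        _ ≤ ∑ j ∈ J, (2 * Real.exp (-M) * Fintype.card (ι → ℤˣ)) * Real.exp (-m j) :=
            Finset.sum_le_sum hone
        _ = (2 * Real.exp (-M) * Fintype.card (ι → ℤˣ)) * ∑ j ∈ J, Real.exp (-m j) := by
            rw [Finset.mul_sum]
        _ ≤ (2 * Real.exp (-M) * Fintype.card (ι → ℤˣ)) * 1 := by gcongr
        _ = _ := mul_one _
    · intro s hs x hx
      obtain ⟨j, hj, hxj⟩ := hcov x hx
      refine ⟨cell j, m j, hchild j hj, hxj, ?_, (hBad j hj).2 s (fun h => hs ?_) x hxj⟩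
      · by_contra! h
        exact hs (Finset.mem_biUnion.2 ⟨j, hj, Finset.mem_union_left _
          (Finset.mem_filter.2 ⟨Finset.mem_univ _, h⟩)⟩)
      · exact Finset.mem_biUnion.2 ⟨j, hj, Finset.mem_union_right _ h⟩

end Chain

/-! ### The sum of the increments along a chain -/

theorem truncSq_eq_zero {r a : ℝ} (ha : 0 ≤ a) (h : a ≤ 50 * r) : truncSq r a = 0 := by
  rw [truncSq, max_eq_right]
  nlinarith

/-- The change of the truncated square when the point moves. The bound carries the factor
`w - 16 r`, for the value `w` at the reference point one scale up, as in `cellWeight`: where this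
factor is small, both truncated squares vanish. -/
theorem abs_truncSq_sub_le {r a b w q : ℝ} (hr : 0 < r) (ha : 0 ≤ a) (hb : 0 ≤ b)
    (hab : |a - b| ≤ q) (hq : q ≤ r) (hw : |w - a| ≤ 8 * r) :
    |truncSq r b - truncSq r a| ≤ 6 * q * max (w - 2 * (8 * r)) 0 := by
  have hq0 : 0 ≤ q := (abs_nonneg _).trans hab
  have hR : 0 ≤ 6 * q * max (w - 2 * (8 * r)) 0 := by positivity
  by_cases h : a ≤ 50 * r ∧ b ≤ 50 * r
  · rw [truncSq_eq_zero ha h.1, truncSq_eq_zero hb h.2]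
    simpa using hR
  · have hab' := abs_le.1 hab
    have hw' := abs_le.1 hw
    have ha49 : 49 * r ≤ a := by
      by_contra hlt
      exact h ⟨by linarith, by linarith⟩
    have h1 : |truncSq r b - truncSq r a| ≤ |b ^ 2 - a ^ 2| := by
      refine (abs_max_sub_max_le_abs _ _ _).trans (le_of_eq ?_)
      congr 1
      ring
    have h2 : |b ^ 2 - a ^ 2| ≤ q * (a + b) := by
      rw [show b ^ 2 - a ^ 2 = (b - a) * (a + b) by ring, abs_mul, abs_of_nonneg (add_nonneg ha hb),
        abs_sub_comm]
      gcongr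
    have h3 : a / 2 ≤ max (w - 2 * (8 * r)) 0 := le_max_of_le_left (by linarith)
    calc _ ≤ q * (a + b) := h1.trans h2
      _ ≤ q * (6 * (a / 2)) := by gcongr; linarith
      _ ≤ q * (6 * max (w - 2 * (8 * r)) 0) := by gcongr
      _ = _ := by ring

/-- Lowering the truncation threshold matters only where the seminorm exceeds the scale, and there
the change is controlled by the growth of `min (n²) (r²)`, which telescopes over scales. -/
theorem sq_truncSq_sub_le {r b n : ℝ} (hr : 0 < r) (hb : 0 ≤ b) (hn : |n - b| ≤ r / 8) :
    (truncSq (r / 8) b - truncSq r b) ^ 2 ≤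
      2 * 50 ^ 4 * r ^ 2 * (min (n ^ 2) (r ^ 2) - min (n ^ 2) ((r / 8) ^ 2)) := by
  have hmono : min (n ^ 2) ((r / 8) ^ 2) ≤ min (n ^ 2) (r ^ 2) := by
    apply min_le_min_left
    gcongr
    linarith
  have hR : 0 ≤ 2 * 50 ^ 4 * r ^ 2 * (min (n ^ 2) (r ^ 2) - min (n ^ 2) ((r / 8) ^ 2)) :=
    mul_nonneg (by positivity) (by linarith)
  rcases le_or_gt b (50 * (r / 8)) with h | h
  · rw [truncSq_eq_zero hb h, truncSq_eq_zero hb (by linarith)]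
    simpa using hR
  · have hn' := abs_le.1 hn
    have hn6 : 6 * r ≤ n := by linarith
    have e1 : min (n ^ 2) (r ^ 2) = r ^ 2 := min_eq_right (by gcongr; linarith)
    have e2 : min (n ^ 2) ((r / 8) ^ 2) = (r / 8) ^ 2 := min_eq_right (by gcongr; linarith)
    rw [e1, e2]
    have h0 : 0 ≤ truncSq (r / 8) b - truncSq r b := by
      rw [sub_nonneg, truncSq, truncSq]
      apply max_le_max_right
      have : (50 * (r / 8)) ^ 2 ≤ (50 * r) ^ 2 := by gcongr; linarith
      linarith
    have h1 : truncSq (r / 8) b - truncSq r b ≤ (50 * r) ^ 2 := by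
      have hA : truncSq (r / 8) b ≤ b ^ 2 := max_le (by linarith [sq_nonneg (50 * (r / 8))])
        (sq_nonneg _)
      have hB : b ^ 2 - (50 * r) ^ 2 ≤ truncSq r b := le_max_left _ _
      linarith
    calc _ ≤ ((50 * r) ^ 2) ^ 2 := by gcongr
      _ = 50 ^ 4 * r ^ 2 * r ^ 2 := by ring
      _ ≤ 50 ^ 4 * r ^ 2 * (2 * (r ^ 2 - (r / 8) ^ 2)) := by gcongr; nlinarith [sq_nonneg r]
      _ = _ := by ring

/-- The change in the last step of a chain, where the truncation is removed. -/
theorem abs_sub_truncSq_le {r a c : ℝ} (hr : 0 < r) (ha : 0 ≤ a) (hc : 0 ≤ c)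
    (hac : |a - c| ≤ r) : |c ^ 2 - truncSq r a| ≤ r * (c + 51 * a) := by
  have h1 : |c ^ 2 - a ^ 2| ≤ r * (c + a) := by
    rw [show c ^ 2 - a ^ 2 = (c - a) * (c + a) by ring, abs_mul, abs_of_nonneg (add_nonneg hc ha),
      abs_sub_comm]
    gcongr
  have h2 : |a ^ 2 - truncSq r a| ≤ 50 * r * a := by
    have hA : truncSq r a ≤ a ^ 2 := max_le (by linarith [sq_nonneg (50 * r)]) (sq_nonneg _)
    rw [abs_of_nonneg (by linarith)]
    rcases le_or_gt a (50 * r) with h | h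
    · rw [truncSq_eq_zero ha h]; nlinarith
    · have hB : a ^ 2 - (50 * r) ^ 2 ≤ truncSq r a := le_max_left _ _
      nlinarith
  calc _ = |(c ^ 2 - a ^ 2) + (a ^ 2 - truncSq r a)| := by congr 1; ring
    _ ≤ _ := abs_add_le _ _
    _ ≤ r * (c + a) + 50 * r * a := add_le_add h1 h2
    _ = _ := by ring

section ChainSum

variable {E : Type*} [NormedAddCommGroup E] [InnerProductSpace ℝ E] {ι : Type*} [Fintype ι]
  {N : ι → Seminorm ℝ E} {Nm : Seminorm ℝ E}

theorem signSum_add (s : ι → ℤˣ) (b c : ι → ℝ) :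
    signSum s (fun i => b i + c i) = signSum s b + signSum s c := by
  simp [signSum, mul_add, Finset.sum_add_distrib]

theorem abs_signSum_le (s : ι → ℤˣ) (b : ι → ℝ) : |signSum s b| ≤ ∑ i, |b i| := by
  refine (Finset.abs_sum_le_sum_abs _ _).trans (le_of_eq (Finset.sum_congr rfl fun i _ => ?_))
  rw [abs_mul]
  rcases Int.units_eq_one_or (s i) with h | h <;> simp [h]

/-- The variance of an increment of the sign process along a chain, with a first part from moving
the reference point and a second, telescoping part from lowering the truncation. -/
theorem sum_linkVec_sq_le (hle : ∀ i x, N i x ≤ Nm x) {β κ r m m' : ℝ} (hr : 0 < r)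
    {A A' A'' : Set E} (hAd : ∀ x ∈ A, ∀ y ∈ A, Nm (x - y) ≤ 8 * r)
    (h1 : IsChild N Nm β κ (8 * r) A A' m) (h2 : IsChild N Nm β κ r A' A'' m') {x : E}
    (hx : x ∈ A'') :
    ∑ i, linkVec N r A' A'' i ^ 2 ≤ r ^ 2 * (72 * β ^ 2 + 4 * 50 ^ 4 *
      (∑ i, min (N i x ^ 2) (r ^ 2) - ∑ i, min (N i x ^ 2) ((r / 8) ^ 2))) := by
  have m0 := refPt_mem (h1.nonempty.mono h1.subset)
  have m1 := refPt_mem h1.nonempty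
  have m2 := refPt_mem h2.nonempty
  have hn1 := h1.near _ m1 _ (h2.subset m2)
  rw [show 8 * r / 8 = r by ring] at hn1
  have hn2 := h2.near _ hx _ m2
  have hpt : ∀ i, linkVec N r A' A'' i ^ 2 ≤
      72 * (cellWeight N (8 * r) A i * N i (refPt A' - refPt A'') ^ 2) +
      2 * (2 * 50 ^ 4 * r ^ 2 * (min (N i x ^ 2) (r ^ 2) - min (N i x ^ 2) ((r / 8) ^ 2))) := by
    intro i
    have a1 := abs_truncSq_sub_le (w := N i (refPt A)) hr (apply_nonneg (N i) (refPt A'))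
      (apply_nonneg (N i) (refPt A'')) (abs_sub_map_le_sub (N i) _ _) ((hle i _).trans hn1.1)
      (abs_sub_le_of_le (hle i) (hAd _ m0 _ (h1.subset m1)))
    have a2 := sq_truncSq_sub_le hr (apply_nonneg (N i) (refPt A''))
      (abs_sub_le_of_le (hle i) hn2.1)
    have a3 := sq_le_sq' (abs_le.1 a1).1 (abs_le.1 a1).2
    have e : (6 * N i (refPt A' - refPt A'') * max (N i (refPt A) - 2 * (8 * r)) 0) ^ 2 =
        36 * (cellWeight N (8 * r) A i * N i (refPt A' - refPt A'') ^ 2) := by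
      rw [cellWeight]; ring
    rw [e] at a3
    rw [linkVec]
    set u := truncSq (r / 8) (N i (refPt A''))
    set v := truncSq r (N i (refPt A''))
    set w := truncSq r (N i (refPt A'))
    have : (u - w) ^ 2 ≤ 2 * (v - w) ^ 2 + 2 * (u - v) ^ 2 := by
      nlinarith [sq_nonneg ((v - w) - (u - v))]
    linarith
  refine (Finset.sum_le_sum fun i _ => hpt i).trans ?_
  rw [Finset.sum_add_distrib, ← Finset.mul_sum, ← Finset.mul_sum, ← Finset.mul_sum,
    Finset.sum_sub_distrib]
  have := hn1.2
  nlinarith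

/-- A weighted form of the inequality of arithmetic and geometric means. -/
theorem mul_sqrt_two_mul_le {v X t : ℝ} (ht : 0 < t) (hv : 0 ≤ v) (hX : 0 ≤ X) :
    √v * √(2 * X) ≤ t * X + v / (2 * t) := by
  have h1 := Real.sq_sqrt hv
  have h2 := Real.sq_sqrt (by positivity : 0 ≤ 2 * X)
  have h3 : √v * √(2 * X) = (√v / √t) * (√t * √(2 * X)) := by
    have := (Real.sqrt_pos.2 ht).ne'
    field_simp
  have h4 : (√v / √t) ^ 2 = v / t := by rw [div_pow, h1, Real.sq_sqrt ht.le]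
  have h5 : (√t * √(2 * X)) ^ 2 = t * (2 * X) := by rw [mul_pow, h2, Real.sq_sqrt ht.le]
  rw [h3]
  have h6 := two_mul_le_add_sq (√v / √t) (√t * √(2 * X))
  rw [h4, h5] at h6
  have h7 : v / (2 * t) = v / t / 2 := by field_simp
  rw [h7]
  linarith

omit [Fintype ι] in
theorem cellWeight_mono (hle : ∀ i x, N i x ≤ Nm x) {r : ℝ} {A A' : Set E} (hr : 0 < r)
    (hAd : ∀ x ∈ A, ∀ y ∈ A, Nm (x - y) ≤ 8 * r) (hne : A'.Nonempty) (hsub : A' ⊆ A) (i : ι) :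
    cellWeight N (8 * r) A i ≤ cellWeight N r A' i := by
  rw [cellWeight, cellWeight]
  have := (abs_le.1 (abs_sub_le_of_le (hle i)
    (hAd _ (refPt_mem (hne.mono hsub)) _ (hsub (refPt_mem hne))))).2
  exact pow_le_pow_left₀ (le_max_right _ _) (max_le_max_right _ (by linarith)) 2

/-- Points closer than `|ι|^(-1/2)` have nearly the same value of the sign process, whatever the
signs. -/
theorem abs_signSum_sq_sub_le {S R δ : ℝ} (hleR : ∀ i x, N i x ≤ R * ‖x‖) (hR : 0 ≤ R)
    (hS : 0 ≤ S) (hcard : δ ^ 2 * Fintype.card ι ≤ 1) (s : ι → ℤˣ) {x y : E}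
    (hx : x ∈ energyBody N S) (hy : y ∈ energyBody N S) (hxy : ‖x - y‖ ≤ δ) :
    |signSum s fun i => N i x ^ 2 - N i y ^ 2| ≤ 2 * R * S := by
  have h1 : ∀ i, |N i x ^ 2 - N i y ^ 2| ≤ R * δ * (N i x + N i y) := by
    intro i
    rw [show N i x ^ 2 - N i y ^ 2 = (N i x - N i y) * (N i x + N i y) by ring, abs_mul,
      abs_of_nonneg (add_nonneg (apply_nonneg (N i) x) (apply_nonneg (N i) y))]
    refine mul_le_mul_of_nonneg_right ?_
      (add_nonneg (apply_nonneg (N i) x) (apply_nonneg (N i) y))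
    exact (abs_sub_map_le_sub (N i) x y).trans ((hleR i _).trans (by gcongr))
  refine (abs_signSum_le _ _).trans ((Finset.sum_le_sum fun i _ => h1 i).trans ?_)
  rw [← Finset.mul_sum]
  have h2 : (∑ i, (N i x + N i y)) ^ 2 ≤ Fintype.card ι * (4 * S ^ 2) := by
    refine (sq_sum_le_card_mul_sum_sq (s := Finset.univ)).trans ?_
    rw [Finset.card_univ]
    gcongr
    calc ∑ i, (N i x + N i y) ^ 2 ≤ ∑ i, (2 * N i x ^ 2 + 2 * N i y ^ 2) :=
          Finset.sum_le_sum fun i _ => by nlinarith [sq_nonneg (N i x - N i y)]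
      _ = 2 * ∑ i, N i x ^ 2 + 2 * ∑ i, N i y ^ 2 := by
          rw [Finset.sum_add_distrib, Finset.mul_sum, Finset.mul_sum]
      _ ≤ _ := by linarith [hx.2, hy.2]
  have h3 : δ * ∑ i, (N i x + N i y) ≤ 2 * S := by
    apply le_of_sq_le_sq _ (by positivity)
    calc (δ * ∑ i, (N i x + N i y)) ^ 2 = δ ^ 2 * (∑ i, (N i x + N i y)) ^ 2 := by ring
      _ ≤ δ ^ 2 * (Fintype.card ι * (4 * S ^ 2)) := by gcongr
      _ = (δ ^ 2 * Fintype.card ι) * (4 * S ^ 2) := by ring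
      _ ≤ 1 * (4 * S ^ 2) := by gcongr
      _ = _ := by ring
  calc R * δ * ∑ i, (N i x + N i y) = R * (δ * ∑ i, (N i x + N i y)) := by ring
    _ ≤ R * (2 * S) := by gcongr
    _ = _ := by ring

/-- The sum of the Hoeffding bounds along a good chain. The increment at scale `r` is estimated by
the inequality of arithmetic and geometric means with a parameter proportional to `r²`, so that all
terms but the number `d` of steps telescope: the accumulated costs against `minNormSq`, the
increments against `min (N i x ^ 2) (r ^ 2)`. The cost `m` of the cell `A'` is paid together with
the next step, where the gain in `minNormSq` that bounds it becomes available. -/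
theorem abs_signSum_le_of_goodChain (hle : ∀ i x, N i x ≤ Nm x) {R β κ S δ q : ℝ}
    (hleR : ∀ i x, N i x ≤ R * ‖x‖) (hR : 0 ≤ R) (hS : 0 < S) (hκ : 0 < κ)
    (hq : 0 ≤ q) (hcard : δ ^ 2 * Fintype.card ι ≤ 1) (s : ι → ℤˣ) (x : E) (d : ℕ) :
    ∀ (r M m : ℝ) (A A' : Set E), 0 < r → 0 ≤ M → IsChild N Nm β κ (8 * r) A A' m →
      (∀ x ∈ A, ∀ y ∈ A, Nm (x - y) ≤ 8 * r) → A ⊆ energyBody N S → x ∈ A' →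
      GoodChain N Nm β κ δ q s x d r A' M →
      2 * S / κ * (64 * r ^ 2 * m) +
        |signSum s fun i => N i x ^ 2 - truncSq r (N i (refPt A'))| ≤
      2 * S / κ * (r ^ 2 * M + 2300 * r ^ 2 +
          8704 * κ ^ 2 * (2 - minNormSq A - minNormSq A')) +
        S / κ * ((r / 8 ^ d) ^ 2 * q) +
        κ / S * (36 * β ^ 2 * d + 2 * 50 ^ 4 * ∑ i, min (N i x ^ 2) (r ^ 2)) +
        (2602 * κ * S + 2 * R * S) := by
  have pay : ∀ {r m : ℝ} {A A' C : Set E}, 0 < r → IsChild N Nm β κ (8 * r) A A' m → C ⊆ A' →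
      C.Nonempty → (∀ x ∈ C, ∀ y ∈ C, Near N Nm β (cellWeight N (8 * r) A) (r / 8) (x - y)) →
      2 * S / κ * (64 * r ^ 2 * m) ≤
        2 * S / κ * (2176 * r ^ 2 + 8704 * κ ^ 2 * (minNormSq C - minNormSq A)) := by
    intro r m A A' C hr hch hC hCne hCn
    have := hch.cost_le C hC hCne (by rwa [show 8 * r / 64 = r / 8 by ring])
    gcongr
    calc 64 * r ^ 2 * m ≤ 64 * r ^ 2 *
          (34 * (1 + 256 * ((minNormSq C - minNormSq A) * κ ^ 2 / (8 * r) ^ 2))) := by gcongr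
      _ = _ := by field_simp; ring
  induction d with
  | zero =>
    intro r M m A A' hr hM hch hAd hAT hx hgc
    obtain ⟨y, hy, hxy, hb⟩ := hgc
    have hA'T := hch.subset.trans hAT
    have m1 := refPt_mem hch.nonempty
    have p1 := pay hr hch (Set.singleton_subset_iff.2 hx) (Set.singleton_nonempty x) (by
      rintro _ rfl _ rfl
      rw [sub_self]
      exact near_zero (by positivity))
    have f1 : minNormSq {x} ≤ 1 := minNormSq_le_one (Set.singleton_nonempty x) (by
      rintro _ rfl
      exact (hA'T hx).1)
    have f2 : minNormSq A' ≤ 1 := minNormSq_le_one hch.nonempty fun z hz => (hA'T hz).1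
    have hbsum : ∑ i, endVec N r A' y i ^ 2 ≤ 5204 * S ^ 2 * r ^ 2 := by
      have hpt : ∀ i, endVec N r A' y i ^ 2 ≤
          r ^ 2 * (2 * N i y ^ 2 + 5202 * N i (refPt A') ^ 2) := by
        intro i
        have hn := hch.near _ m1 _ hy
        rw [show 8 * r / 8 = r by ring] at hn
        have a1 := abs_sub_truncSq_le hr (apply_nonneg (N i) (refPt A')) (apply_nonneg (N i) y)
          (abs_sub_le_of_le (hle i) hn.1)
        have a2 := sq_le_sq' (abs_le.1 a1).1 (abs_le.1 a1).2
        rw [endVec]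
        refine a2.trans ?_
        rw [mul_pow]
        gcongr
        nlinarith [sq_nonneg (N i y - 51 * N i (refPt A'))]
      refine (Finset.sum_le_sum fun i _ => hpt i).trans ?_
      rw [← Finset.mul_sum, Finset.sum_add_distrib, ← Finset.mul_sum, ← Finset.mul_sum]
      have t1 := (hA'T hy).2
      have t2 := (hA'T m1).2
      calc _ ≤ r ^ 2 * (2 * S ^ 2 + 5202 * S ^ 2) := by gcongr
        _ = _ := by ring
    have hend := hb.trans (mul_sqrt_two_mul_le (t := S / κ * r ^ 2) (by positivity)
      (Finset.sum_nonneg fun i _ => sq_nonneg _) (by linarith))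
    have hv : (∑ i, endVec N r A' y i ^ 2) / (2 * (S / κ * r ^ 2)) ≤ 2602 * κ * S := by
      rw [div_le_iff₀ (by positivity)]
      refine hbsum.trans (le_of_eq ?_)
      field_simp
      ring
    have hrem := abs_signSum_sq_sub_le hleR hR hS.le hcard s (hA'T hx) (hA'T hy) hxy
    have hsplit : |signSum s fun i => N i x ^ 2 - truncSq r (N i (refPt A'))| ≤
        |signSum s fun i => N i x ^ 2 - N i y ^ 2| + |signSum s (endVec N r A' y)| := by
      refine le_trans (le_of_eq ?_) (abs_add_le _ _)
      rw [← signSum_add]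
      congr 2
      funext i
      rw [endVec]
      ring
    have hΨ : 0 ≤ κ / S * (36 * β ^ 2 * ((0 : ℕ) : ℝ) +
        2 * 50 ^ 4 * ∑ i, min (N i x ^ 2) (r ^ 2)) := by
      have : 0 ≤ ∑ i, min (N i x ^ 2) (r ^ 2) :=
        Finset.sum_nonneg fun i _ => le_min (sq_nonneg _) (sq_nonneg _)
      simp only [CharP.cast_eq_zero, mul_zero, zero_add]
      positivity
    have hfin : 2 * S / κ * (2176 * r ^ 2 + 8704 * κ ^ 2 * (minNormSq {x} - minNormSq A)) +
        S / κ * r ^ 2 * (M + q + 1) ≤ 2 * S / κ * (r ^ 2 * M + 2300 * r ^ 2 +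
          8704 * κ ^ 2 * (2 - minNormSq A - minNormSq A')) + S / κ * ((r / 8 ^ 0) ^ 2 * q) := by
      have e : S / κ * r ^ 2 * (M + q + 1) = 2 * S / κ * (r ^ 2 * (M + 1) / 2) +
          S / κ * ((r / 8 ^ 0) ^ 2 * q) := by
        simp only [pow_zero, div_one]; ring
      rw [e, ← add_assoc, ← mul_add]
      refine add_le_add_left (mul_le_mul_of_nonneg_left ?_ (by positivity)) _
      have : 8704 * κ ^ 2 * (minNormSq {x} - minNormSq A) ≤
          8704 * κ ^ 2 * (2 - minNormSq A - minNormSq A') :=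
        mul_le_mul_of_nonneg_left (by linarith) (by positivity)
      nlinarith [mul_nonneg (sq_nonneg r) hM, sq_nonneg r]
    linarith
  | succ d ih =>
    intro r M m A A' hr hM hch hAd hAT hx hgc
    obtain ⟨A'', m', hch', hx', hb, hgc'⟩ := hgc
    have hA'T := hch.subset.trans hAT
    have hAd' : ∀ x ∈ A', ∀ y ∈ A', Nm (x - y) ≤ 8 * (r / 8) := by
      intro x hx y hy
      have := (hch.near x hx y hy).1
      linarith
    have hih := ih (r / 8) (M + m' + 1) m' A' A'' (by positivity)
      (by linarith [hch'.cost_nonneg]) (by rwa [show 8 * (r / 8) = r by ring]) hAd' hA'T hx' hgc'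
    have p1 := pay hr hch hch'.subset hch'.nonempty fun x hx y hy =>
      (hch'.near x hx y hy).anti_weight fun i =>
        cellWeight_mono hle hr hAd hch.nonempty hch.subset i
    have hlink := hb.trans (mul_sqrt_two_mul_le (t := S / κ * r ^ 2) (by positivity)
      (Finset.sum_nonneg fun i _ => sq_nonneg _) (by linarith [hch'.cost_nonneg]))
    have hv : (∑ i, linkVec N r A' A'' i ^ 2) / (2 * (S / κ * r ^ 2)) ≤
        κ / S * (36 * β ^ 2 + 2 * 50 ^ 4 * (∑ i, min (N i x ^ 2) (r ^ 2) -
          ∑ i, min (N i x ^ 2) ((r / 8) ^ 2))) := by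
      rw [div_le_iff₀ (by positivity)]
      refine (sum_linkVec_sq_le hle hr hAd hch hch' hx').trans (le_of_eq ?_)
      field_simp
      ring
    have hsplit : |signSum s fun i => N i x ^ 2 - truncSq r (N i (refPt A'))| ≤
        |signSum s (linkVec N r A' A'')| +
          |signSum s fun i => N i x ^ 2 - truncSq (r / 8) (N i (refPt A''))| := by
      refine le_trans (le_of_eq ?_) (abs_add_le _ _)
      rw [← signSum_add]
      congr 2
      funext i
      rw [linkVec]
      ring
    have e8 : r / 8 / 8 ^ d = r / 8 ^ (d + 1) := by rw [pow_succ]; field_simp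
    rw [e8] at hih
    set P := 2 * S / κ with hP
    have hP0 : 0 < P := by positivity
    have ePS : S / κ = P / 2 := by rw [hP]; ring
    have hm' := hch'.cost_nonneg
    -- The cost of the next cell enters with coefficient below `1` and is absorbed on the left.
    have hcost : P / 2 * r ^ 2 * (M + m' + 1) + P * ((r / 8) ^ 2 * (M + m' + 1)) ≤
        P * (r ^ 2 * M + r ^ 2) + P * (64 * (r / 8) ^ 2 * m') := by
      have : P / 2 * r ^ 2 * (M + m' + 1) + P * ((r / 8) ^ 2 * (M + m' + 1)) =
          P * (r ^ 2 * (33 / 64 * (M + m' + 1))) := by ring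
      rw [this, ← mul_add]
      gcongr
      nlinarith [mul_nonneg (sq_nonneg r) hM, mul_nonneg (sq_nonneg r) hm', sq_nonneg r]
    rw [ePS] at hlink hih ⊢
    rw [ePS] at hv
    have hκS : 0 < κ / S := by positivity
    have hPr : 0 ≤ P * r ^ 2 := by positivity
    push_cast
    set Ψ := ∑ i, min (N i x ^ 2) (r ^ 2)
    set Ψ' := ∑ i, min (N i x ^ 2) ((r / 8) ^ 2)
    set Z := P / 2 * ((r / 8 ^ (d + 1)) ^ 2 * q)
    set X := |signSum s fun i => N i x ^ 2 - truncSq r (N i (refPt A'))|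
    set X' := |signSum s fun i => N i x ^ 2 - truncSq (r / 8) (N i (refPt A''))|
    set Y := |signSum s (linkVec N r A' A'')|
    set G := κ / S
    set V := (∑ i, linkVec N r A' A'' i ^ 2) / (2 * (P / 2 * r ^ 2))
    have r1 : P * (2176 * r ^ 2 + 8704 * κ ^ 2 * (minNormSq A'' - minNormSq A)) +
        P * (2300 * (r / 8) ^ 2 + 8704 * κ ^ 2 * (2 - minNormSq A' - minNormSq A'')) +
        P * (r ^ 2 * M + r ^ 2) ≤
        P * (r ^ 2 * M + 2300 * r ^ 2 + 8704 * κ ^ 2 * (2 - minNormSq A - minNormSq A')) := by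
      rw [← mul_add, ← mul_add]
      refine mul_le_mul_of_nonneg_left ?_ hP0.le
      nlinarith [sq_nonneg r]
    have r2 : G * (36 * β ^ 2 * (d + 1) + 2 * 50 ^ 4 * Ψ) =
        G * (36 * β ^ 2 + 2 * 50 ^ 4 * (Ψ - Ψ')) + G * (36 * β ^ 2 * d + 2 * 50 ^ 4 * Ψ') := by
      ring
    have r3 : P * ((r / 8) ^ 2 * (M + m' + 1) + 2300 * (r / 8) ^ 2 +
        8704 * κ ^ 2 * (2 - minNormSq A' - minNormSq A'')) =
        P * ((r / 8) ^ 2 * (M + m' + 1)) + P * (2300 * (r / 8) ^ 2 +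
        8704 * κ ^ 2 * (2 - minNormSq A' - minNormSq A'')) := by ring
    rw [r3] at hih
    rw [r2]
    linarith

end ChainSum

/-! ### Signs for sums of squared seminorms -/

theorem continuous_of_le_mul_norm {E : Type*} [NormedAddCommGroup E] [InnerProductSpace ℝ E]
    {p : Seminorm ℝ E} {R : ℝ} (hR : 0 ≤ R) (h : ∀ x, p x ≤ R * ‖x‖) : Continuous p := by
  refine LipschitzWith.continuous (K := ⟨R, hR⟩) (LipschitzWith.of_dist_le_mul fun x y => ?_)
  rw [Real.dist_eq, dist_eq_norm]
  exact (abs_sub_map_le_sub p x y).trans (h _)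

section Core

variable {E : Type*} [NormedAddCommGroup E] [InnerProductSpace ℝ E] [FiniteDimensional ℝ E]
  [MeasurableSpace E] [BorelSpace E] {ι : Type*} [Fintype ι] [DecidableEq ι]

/-- Some choice of signs makes `∑ ± N i x ^ 2` at most of order `κ S` simultaneously for all `x` in
the unit ball with `∑ N i x ^ 2 ≤ S ^ 2`. -/
theorem exists_signs_sum_sq_le {N : ι → Seminorm ℝ E} {Nm : Seminorm ℝ E}
    (hle : ∀ i x, N i x ≤ Nm x) {R κ S : ℝ} (hNmR : ∀ x, Nm x ≤ R * ‖x‖) (hR : 0 < R)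
    (hRκ : R ≤ κ) (hS : 0 < S) {L n : ℕ} (hL : 1 ≤ L) (hn : Module.finrank ℝ E ≤ n) (hn1 : 1 ≤ n)
    (hnL : n ≤ 2 ^ L) (hcard : Fintype.card ι ≤ 4 ^ n)
    (hhalf : ∀ α : ι → ℝ, (∀ i, 0 ≤ α i) → ∑ i, α i ≤ S ^ 2 →
      1 / 2 ≤ gaussianMeasure E {z | Near N Nm (S / √L) α κ z}) :
    ∃ s : ι → ℤˣ, ∀ x ∈ energyBody N S,
      |signSum s fun i => N i x ^ 2| ≤ 20000000 * κ * S := by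
  have hκ : 0 < κ := hR.trans_le hRκ
  have hleR : ∀ i x, N i x ≤ R * ‖x‖ := fun i x => (hle i x).trans (hNmR x)
  have hcN : ∀ i, Continuous (N i) := fun i => continuous_of_le_mul_norm hR.le (hleR i)
  have hcNm : Continuous Nm := continuous_of_le_mul_norm hR.le hNmR
  set T := energyBody N S with hT
  have h0T : (0 : E) ∈ T := by
    refine ⟨by simp, ?_⟩
    simp only [map_zero]
    simp only [ne_eq, OfNat.ofNat_ne_zero, not_false_eq_true, zero_pow, Finset.sum_const_zero]
    positivity
  have hTd : ∀ x ∈ T, ∀ y ∈ T, Nm (x - y) ≤ 2 * R := by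
    intro x hx y hy
    refine (hNmR _).trans ?_
    have : ‖x - y‖ ≤ 2 := by linarith [norm_sub_le x y, hx.1, hy.1]
    nlinarith
  have hNR : ∀ i, ∀ x ∈ T, N i x ≤ R := fun i x hx => by
    have := hleR i x
    have := hx.1
    nlinarith
  -- The last net has mesh `2⁻ⁿ`, so that `δ² |ι| ≤ 1`. Its cost `q`, of order `n²`, is harmless at
  -- the last scale `2 R / 8 ^ L ≤ 2 R / n`.
  set δ : ℝ := 1 / 2 ^ n with hδ
  set q : ℝ := 3 * (n : ℝ) ^ 2 with hq
  have hδq : (1 + 2 / δ) ^ Module.finrank ℝ E ≤ Real.exp q := by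
    have e1 : 1 + 2 / δ ≤ 8 ^ n := by
      have h1 : (1 : ℝ) ≤ 2 ^ n := one_le_pow₀ (by norm_num)
      have h2 : (4 : ℝ) ≤ 4 ^ n := by
        calc (4 : ℝ) = 4 ^ 1 := by norm_num
          _ ≤ 4 ^ n := pow_le_pow_right₀ (by norm_num) hn1
      have h3 : (8 : ℝ) ^ n = 2 ^ n * 4 ^ n := by rw [← mul_pow]; norm_num
      rw [h3, hδ, div_div_eq_mul_div, div_one]
      nlinarith
    have e2 : (8 : ℝ) ≤ Real.exp 3 := by
      have h1 : (2 : ℝ) ≤ Real.exp 1 := by linarith [Real.add_one_le_exp (1 : ℝ)]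
      calc (8 : ℝ) = 2 ^ 3 := by norm_num
        _ ≤ Real.exp 1 ^ 3 := by gcongr
        _ = Real.exp 3 := by rw [← Real.exp_nat_mul]; norm_num
    calc (1 + 2 / δ) ^ Module.finrank ℝ E ≤ (8 ^ n) ^ Module.finrank ℝ E := by gcongr
      _ ≤ (8 ^ n) ^ n := pow_le_pow_right₀ (one_le_pow₀ (by norm_num)) hn
      _ ≤ (Real.exp 3 ^ n) ^ n := by gcongr
      _ = Real.exp q := by
          rw [← pow_mul, ← Real.exp_nat_mul]
          congr 1
          push_cast
          ring
  have hδc : δ ^ 2 * Fintype.card ι ≤ 1 := by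
    have h1 : (Fintype.card ι : ℝ) ≤ 4 ^ n := by exact_mod_cast hcard
    have h2 : δ ^ 2 = 1 / 4 ^ n := by
      rw [hδ, div_pow, one_pow, ← pow_mul, mul_comm n 2, pow_mul]
      norm_num
    rw [h2, one_div, inv_mul_le_iff₀ (by positivity), mul_one]
    exact h1
  obtain ⟨Bad, hBad, hgood⟩ := exists_goodChain (N := N) (Nm := Nm) (β := S / √L) (κ := κ) (S := S)
    (δ := δ) (q := q) hcN hcNm hκ hhalf (by positivity) hδq (by positivity) L (2 * R) T 2
    (by positivity) ⟨0, h0T⟩ subset_rfl (by norm_num)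
  have hex : ∃ s, s ∉ Bad := by
    by_contra! hall
    have h1 : Bad = Finset.univ := Finset.eq_univ_iff_forall.2 hall
    rw [h1, Finset.card_univ] at hBad
    have h2 : (0 : ℝ) < Fintype.card (ι → ℤˣ) := by exact_mod_cast Fintype.card_pos
    have h3 : Real.exp (-2) ≤ 1 / 4 := by
      calc Real.exp (-2) = Real.exp (-1) * Real.exp (-1) := by rw [← Real.exp_add]; norm_num
        _ ≤ 1 / 2 * (1 / 2) := by gcongr <;> exact exp_neg_one_le_half
        _ = 1 / 4 := by norm_num
    nlinarith
  obtain ⟨s, hs⟩ := hex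
  refine ⟨s, fun x hx => ?_⟩
  -- The whole body serves as its own parent: all weights vanish at the scale `16 R`.
  have hw0 : ∀ i, cellWeight N (8 * (2 * R)) T i = 0 := by
    intro i
    have := hNR i _ (refPt_mem ⟨0, h0T⟩)
    rw [cellWeight, max_eq_right (by linarith)]
    norm_num
  have hchild : IsChild N Nm (S / √L) κ (8 * (2 * R)) T T 0 := by
    refine ⟨le_rfl, subset_rfl, ⟨0, h0T⟩, fun y hy z hz => ⟨?_, ?_⟩, fun C hC hCne _ => ?_⟩
    · have := hTd y hy z hz
      linarith
    · simp only [hw0, zero_mul, Finset.sum_const_zero]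
      positivity
    · have := minNormSq_anti hCne hC
      have : 0 ≤ (minNormSq C - minNormSq T) * κ ^ 2 / (8 * (2 * R)) ^ 2 := by
        apply div_nonneg (mul_nonneg (by linarith) (by positivity)) (by positivity)
      linarith
  have hmain := abs_signSum_le_of_goodChain hle hleR hR.le hS hκ (q := q) (by positivity) hδc s x L
    (2 * R) 2 0 T T (by positivity) (by norm_num) hchild
    (fun y hy z hz => (hTd y hy z hz).trans (by linarith)) subset_rfl hx (hgood s hs x hx)
  have htr : ∀ i, truncSq (2 * R) (N i (refPt T)) = 0 := fun i =>
    truncSq_eq_zero (apply_nonneg _ _) (by linarith [hNR i _ (refPt_mem ⟨0, h0T⟩)])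
  simp only [htr, sub_zero, mul_zero, zero_add] at hmain
  refine hmain.trans ?_
  have hφ := minNormSq_nonneg T
  have hRR : R ^ 2 ≤ κ ^ 2 := by gcongr
  have t1 : 2 * S / κ * ((2 * R) ^ 2 * 2 + 2300 * (2 * R) ^ 2 +
      8704 * κ ^ 2 * (2 - minNormSq T - minNormSq T)) ≤ 53232 * κ * S := by
    calc _ ≤ 2 * S / κ * (26616 * κ ^ 2) := by
          refine mul_le_mul_of_nonneg_left ?_ (by positivity)
          nlinarith [mul_nonneg (sq_nonneg κ) hφ]
      _ = _ := by field_simp; ring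
  have t2 : S / κ * ((2 * R / 8 ^ L) ^ 2 * q) ≤ 12 * κ * S := by
    have h1 : (n : ℝ) ≤ 8 ^ L := by
      calc (n : ℝ) ≤ 2 ^ L := by exact_mod_cast hnL
        _ ≤ 8 ^ L := by gcongr; norm_num
    have h2 : (2 * R / 8 ^ L) ^ 2 * q ≤ 12 * κ ^ 2 := by
      rw [hq, div_pow, div_mul_eq_mul_div, div_le_iff₀ (by positivity)]
      calc (2 * R) ^ 2 * (3 * (n : ℝ) ^ 2) = 12 * R ^ 2 * (n : ℝ) ^ 2 := by ring
        _ ≤ 12 * κ ^ 2 * (8 ^ L) ^ 2 := by gcongr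
    calc _ ≤ S / κ * (12 * κ ^ 2) := by gcongr
      _ = _ := by field_simp
  have t3 : κ / S * (36 * (S / √L) ^ 2 * L + 2 * 50 ^ 4 * ∑ i, min (N i x ^ 2) ((2 * R) ^ 2)) ≤
      12500036 * κ * S := by
    have hL0 : (0 : ℝ) < L := by exact_mod_cast hL
    have h1 : 36 * (S / √L) ^ 2 * L = 36 * S ^ 2 := by
      rw [div_pow, Real.sq_sqrt hL0.le]
      field_simp
    have h2 : ∑ i, min (N i x ^ 2) ((2 * R) ^ 2) ≤ S ^ 2 :=
      (Finset.sum_le_sum fun i _ => min_le_left _ _).trans hx.2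
    rw [h1]
    calc _ ≤ κ / S * (36 * S ^ 2 + 2 * 50 ^ 4 * S ^ 2) := by gcongr
      _ = _ := by field_simp; ring
  have t4 : 2 * R * S ≤ 2 * κ * S := by gcongr
  nlinarith [mul_pos hκ hS]

omit [DecidableEq ι] in
/-- By Markov's inequality, `Near` at the scale `κ` has Gaussian measure at least `1/2` as soon as
`Nm` exceeds `κ` with probability at most `1/4` and the second moments of the `N i` are small. -/
theorem half_le_gaussianMeasure_near {N : ι → Seminorm ℝ E} {Nm : Seminorm ℝ E}
    (hNc : ∀ i, Continuous (N i)) (hNmc : Continuous Nm) {β κ S Λ : ℝ}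
    (hNm : gaussianMeasure E {z | κ < Nm z} ≤ ENNReal.ofReal (1 / 4)) (hΛ : 0 ≤ Λ)
    (hlam : ∀ i, ∫⁻ z, ENNReal.ofReal (N i z ^ 2) ∂(gaussianMeasure E) ≤ ENNReal.ofReal Λ)
    (hβ : 0 < (β * κ) ^ 2) (hS : S ^ 2 * Λ ≤ (β * κ) ^ 2 * (1 / 4)) {α : ι → ℝ}
    (hα : ∀ i, 0 ≤ α i) (hαS : ∑ i, α i ≤ S ^ 2) :
    1 / 2 ≤ gaussianMeasure E {z | Near N Nm β α κ z} := by
  set B := (β * κ) ^ 2 with hB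
  have hsecond : gaussianMeasure E {z | B < ∑ i, α i * N i z ^ 2} ≤ ENNReal.ofReal (1 / 4) := by
    have hmeas : ∀ i, Measurable fun z => ENNReal.ofReal (N i z ^ 2) := fun i =>
      (((hNc i).pow 2).measurable).ennreal_ofReal
    have hint : ∫⁻ z, ENNReal.ofReal (∑ i, α i * N i z ^ 2) ∂(gaussianMeasure E) ≤
        ENNReal.ofReal (S ^ 2 * Λ) := by
      calc _ = ∫⁻ z, ∑ i, ENNReal.ofReal (α i) * ENNReal.ofReal (N i z ^ 2)
            ∂(gaussianMeasure E) := by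
            refine lintegral_congr fun z => ?_
            rw [ENNReal.ofReal_sum_of_nonneg fun i _ => mul_nonneg (hα i) (sq_nonneg _)]
            exact Finset.sum_congr rfl fun i _ => ENNReal.ofReal_mul (hα i)
        _ = ∑ i, ENNReal.ofReal (α i) * ∫⁻ z, ENNReal.ofReal (N i z ^ 2)
            ∂(gaussianMeasure E) := by
            rw [lintegral_finsetSum _ fun i _ => (hmeas i).const_mul _]
            exact Finset.sum_congr rfl fun i _ => lintegral_const_mul _ (hmeas i)
        _ ≤ ∑ i, ENNReal.ofReal (α i) * ENNReal.ofReal Λ := by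
            gcongr with i
            exact hlam i
        _ = ENNReal.ofReal ((∑ i, α i) * Λ) := by
            rw [← Finset.sum_mul, ← ENNReal.ofReal_sum_of_nonneg fun i _ => hα i,
              ← ENNReal.ofReal_mul (Finset.sum_nonneg fun i _ => hα i)]
        _ ≤ _ := ENNReal.ofReal_le_ofReal (mul_le_mul_of_nonneg_right hαS hΛ)
    have hcont : Continuous fun z => ∑ i, α i * N i z ^ 2 :=
      continuous_finsetSum _ fun i _ => ((hNc i).pow 2).const_mul _
    have hmk := mul_meas_ge_le_lintegral₀ (μ := gaussianMeasure E)
      (f := fun z => ENNReal.ofReal (∑ i, α i * N i z ^ 2))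
      hcont.measurable.ennreal_ofReal.aemeasurable (ENNReal.ofReal B)
    have hsub : {z : E | B < ∑ i, α i * N i z ^ 2} ⊆
        {z | ENNReal.ofReal B ≤ ENNReal.ofReal (∑ i, α i * N i z ^ 2)} :=
      fun z (hz : B < _) => ENNReal.ofReal_le_ofReal hz.le
    have h1 : ENNReal.ofReal B * gaussianMeasure E {z | B < ∑ i, α i * N i z ^ 2} ≤
        ENNReal.ofReal B * ENNReal.ofReal (1 / 4) := by
      calc _ ≤ ENNReal.ofReal B * gaussianMeasure E
            {z | ENNReal.ofReal B ≤ ENNReal.ofReal (∑ i, α i * N i z ^ 2)} :=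
            mul_le_mul' le_rfl (measure_mono hsub)
        _ ≤ ∫⁻ z, ENNReal.ofReal (∑ i, α i * N i z ^ 2) ∂(gaussianMeasure E) := hmk
        _ ≤ ENNReal.ofReal (S ^ 2 * Λ) := hint
        _ ≤ ENNReal.ofReal (B * (1 / 4)) := ENNReal.ofReal_le_ofReal hS
        _ = _ := ENNReal.ofReal_mul hβ.le
    exact (ENNReal.mul_le_mul_iff_right (by simpa using hβ) ENNReal.ofReal_ne_top).1 h1
  have hm : MeasurableSet {z : E | Near N Nm β α κ z} := measurableSet_near hNc hNmc
  have hcompl : gaussianMeasure E {z | Near N Nm β α κ z}ᶜ ≤ 1 / 2 := by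
    have hsub : {z : E | Near N Nm β α κ z}ᶜ ⊆
        {z | κ < Nm z} ∪ {z | B < ∑ i, α i * N i z ^ 2} := by
      intro z hz
      by_contra hcon
      rw [Set.mem_union, not_or] at hcon
      exact hz ⟨not_lt.1 hcon.1, not_lt.1 hcon.2⟩
    calc _ ≤ _ := measure_mono hsub
      _ ≤ _ := measure_union_le _ _
      _ ≤ ENNReal.ofReal (1 / 4) + ENNReal.ofReal (1 / 4) := add_le_add hNm hsecond
      _ = ENNReal.ofReal (1 / 2) := by
          rw [← ENNReal.ofReal_add (by norm_num) (by norm_num)]; norm_num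
      _ = 1 / 2 := by rw [ENNReal.ofReal_div_of_pos (by norm_num)]; simp
  have htot : gaussianMeasure E {z | Near N Nm β α κ z} +
      gaussianMeasure E {z | Near N Nm β α κ z}ᶜ = 1 := by
    rw [measure_add_measure_compl hm, measure_univ]
  by_contra hlt
  rw [not_le] at hlt
  have := ENNReal.add_lt_add_of_lt_of_le (ne_top_of_le_ne_top (by simp) hcompl) hlt hcompl
  rw [htot, ENNReal.add_halves] at this
  exact lt_irrefl _ this

end Core

section Pairs

variable {E : Type*} [NormedAddCommGroup E] [InnerProductSpace ℝ E] {V : Type*}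

/-- The seminorm `z ↦ |⟪a, z⟫|`. -/
noncomputable def innerSeminorm (a : E) : Seminorm ℝ E :=
  (innerSL ℝ a).toLinearMap.toSeminorm

theorem innerSeminorm_apply (a z : E) : innerSeminorm a z = |inner ℝ a z| := by
  simp [innerSeminorm]

/-- The seminorm `z ↦ max_{u, v ∈ e} |⟪g u - g v, z⟫|`. -/
noncomputable def edgeSeminorm (g : V → E) (e : Finset V) : Seminorm ℝ E :=
  e.offDiag.sup fun p => innerSeminorm (g p.1 - g p.2)

theorem edgeSeminorm_eq (g : V → E) (e : Finset V) (z : E) :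
    edgeSeminorm g e z = 0 ∨ ∃ p ∈ e.offDiag, edgeSeminorm g e z = |inner ℝ (g p.1 - g p.2) z| := by
  rcases e.offDiag.eq_empty_or_nonempty with h | h
  · left
    rw [edgeSeminorm, h]
    simp
  · right
    obtain ⟨p, hp, hpe⟩ := Seminorm.exists_apply_eq_finset_sup
      (fun p : V × V => innerSeminorm (g p.1 - g p.2)) h z
    exact ⟨p, hp, by rw [edgeSeminorm, hpe, innerSeminorm_apply]⟩

theorem le_edgeSeminorm (g : V → E) {e : Finset V} {p : V × V} (hp : p ∈ e.offDiag) (z : E) :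
    |inner ℝ (g p.1 - g p.2) z| ≤ edgeSeminorm g e z := by
  rw [← innerSeminorm_apply]
  exact Seminorm.le_finset_sup_apply (p := fun p : V × V => innerSeminorm (g p.1 - g p.2)) hp

variable [FiniteDimensional ℝ E] [MeasurableSpace E] [BorelSpace E] [Fintype V]

/-- The union bound for the maximum of Gaussian linear functionals. -/
theorem gaussianMeasure_sup_innerSeminorm_gt_le {P : Type*} (s : Finset P) (a : P → E)
    (ha : ∀ p ∈ s, ‖a p‖ ≤ 1) {R t : ℝ} (hR : 0 < R) (ht : 0 ≤ t) :
    gaussianMeasure E {z | R * t < R * s.sup (fun p => innerSeminorm (a p)) z} ≤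
      ENNReal.ofReal (s.card * (2 * Real.exp (-(t ^ 2 / 2)))) := by
  have hsub : {z : E | R * t < R * s.sup (fun p => innerSeminorm (a p)) z} ⊆
      ⋃ p ∈ s, {z | t * 1 < |inner ℝ (a p) z|} := by
    intro z (hz : R * t < R * s.sup (fun p => innerSeminorm (a p)) z)
    by_contra hcon
    simp only [Set.mem_iUnion, not_exists] at hcon
    refine absurd hz (not_lt.2 (mul_le_mul_of_nonneg_left ?_ hR.le))
    refine Seminorm.finset_sup_apply_le ht fun p hp => ?_
    rw [innerSeminorm_apply]
    have h2 : ¬ t * 1 < |inner ℝ (a p) z| := hcon p hp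
    linarith [not_lt.1 h2]
  refine (measure_mono hsub).trans ((measure_biUnion_finset_le _ _).trans ?_)
  refine (Finset.sum_le_sum fun p hp =>
    gaussianMeasure_abs_inner_gt_le _ one_pos (ha p hp) ht).trans ?_
  rw [Finset.sum_const, nsmul_eq_mul, ← ENNReal.ofReal_natCast,
    ← ENNReal.ofReal_mul (by positivity)]

/-- The sign bound for the functions `w_i max_{u, v ∈ e_i} ⟪g u - g v, z⟫²`, all of whose terms
have `w_i ‖g u - g v‖² ≤ R²`. The second moment of a maximum over the pairs of one set is of order
`R² log D`, and it is multiplied by the number of scales, of order `log n`. The product also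
dominates the maximum over all pairs of normalized vectors, which is of order `R² log n`. -/
theorem exists_signs_edges (g : V → E) (hg : ∀ u v, u ≠ v → g u ≠ g v)
    (hV : 2 ≤ Fintype.card V) (hE : Module.finrank ℝ E ≤ Fintype.card V) {D : ℕ} (hD : 2 ≤ D)
    {ι : Type*} [Fintype ι] [DecidableEq ι] (e : ι → Finset V) (he : ∀ i, (e i).card ≤ D)
    (w : ι → ℝ) (hw : ∀ i, 0 ≤ w i) {R S : ℝ} (hR : 0 < R) (hS : 0 < S)
    (hwR : ∀ i, ∀ u ∈ e i, ∀ v ∈ e i, w i * ‖g u - g v‖ ^ 2 ≤ R ^ 2)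
    (hι : Fintype.card ι ≤ 4 ^ Fintype.card V) :
    ∃ s : ι → ℤˣ, ∀ z : E, ‖z‖ ≤ 1 → ∑ i, w i * edgeSeminorm g (e i) z ^ 2 ≤ S ^ 2 →
      |signSum s fun i => w i * edgeSeminorm g (e i) z ^ 2| ≤
        360000000 * R * √(Real.log (Fintype.card V) * Real.log D) * S := by
  set n := Fintype.card V with hn
  set ℓ := Real.log n with hℓ
  set ℓD := Real.log D with hℓD
  have hlog2 : (0.69 : ℝ) ≤ Real.log 2 := by linarith [Real.log_two_gt_d9]
  have hℓ2 : Real.log 2 ≤ ℓ := Real.log_le_log (by norm_num) (by exact_mod_cast hV)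
  have hℓD2 : Real.log 2 ≤ ℓD := Real.log_le_log (by norm_num) (by exact_mod_cast hD)
  have hn0 : (0 : ℝ) < n := by exact_mod_cast (by omega : 0 < n)
  have hD0 : (0 : ℝ) < D := by exact_mod_cast (by omega : 0 < D)
  -- The level `κ` satisfies `4 λ² L ≤ κ²` for the second moment `λ² = 24 R² ℓD` and
  -- `L ≤ 3 ℓ` scales.
  set κ := R * (18 * √(ℓ * ℓD)) with hκ
  have hℓℓ : 0.47 ≤ ℓ * ℓD := by nlinarith
  have hsq : (18 * √(ℓ * ℓD)) ^ 2 = 324 * (ℓ * ℓD) := by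
    rw [mul_pow, Real.sq_sqrt (by linarith)]; norm_num
  have h18 : 1 ≤ 18 * √(ℓ * ℓD) := by
    have : 0 ≤ 18 * √(ℓ * ℓD) := by positivity
    nlinarith
  set c : ι → NNReal := fun i => ⟨√(w i), Real.sqrt_nonneg _⟩ with hc
  set N : ι → Seminorm ℝ E := fun i => c i • edgeSeminorm g (e i) with hN
  have hNapp : ∀ i z, N i z = √(w i) * edgeSeminorm g (e i) z := fun i z => rfl
  have hNsq : ∀ i z, N i z ^ 2 = w i * edgeSeminorm g (e i) z ^ 2 := fun i z => by
    rw [hNapp, mul_pow, Real.sq_sqrt (hw i)]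
  set cR : NNReal := ⟨R, hR.le⟩ with hcR
  set Nm : Seminorm ℝ E := cR • (Finset.univ : Finset V).offDiag.sup
    (fun p : V × V => innerSeminorm (‖g p.1 - g p.2‖⁻¹ • (g p.1 - g p.2))) with hNm
  have hNmapp : ∀ z, Nm z = R * (Finset.univ : Finset V).offDiag.sup
    (fun p : V × V => innerSeminorm (‖g p.1 - g p.2‖⁻¹ • (g p.1 - g p.2))) z := fun z => rfl
  have hpos : ∀ p ∈ (Finset.univ : Finset V).offDiag, 0 < ‖g p.1 - g p.2‖ := by
    intro p hp
    rw [Finset.mem_offDiag] at hp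
    exact norm_pos_iff.2 (sub_ne_zero.2 (hg _ _ hp.2.2))
  have hunit : ∀ p ∈ (Finset.univ : Finset V).offDiag,
      ‖‖g p.1 - g p.2‖⁻¹ • (g p.1 - g p.2)‖ ≤ 1 := by
    intro p hp
    rw [norm_smul, norm_inv, norm_norm, inv_mul_cancel₀ (hpos p hp).ne']
  have hwp : ∀ i, ∀ p ∈ (e i).offDiag, √(w i) * ‖g p.1 - g p.2‖ ≤ R := by
    intro i p hp
    rw [Finset.mem_offDiag] at hp
    apply le_of_sq_le_sq _ hR.le
    rw [mul_pow, Real.sq_sqrt (hw i)]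
    exact hwR i _ hp.1 _ hp.2.1
  have hle : ∀ i z, N i z ≤ Nm z := by
    intro i z
    rw [hNapp, hNmapp]
    rcases edgeSeminorm_eq g (e i) z with h | ⟨p, hp, h⟩
    · rw [h, mul_zero]
      positivity
    · have hpu : p ∈ (Finset.univ : Finset V).offDiag := by
        rw [Finset.mem_offDiag] at hp ⊢
        exact ⟨Finset.mem_univ _, Finset.mem_univ _, hp.2.2⟩
      have h1 := Seminorm.le_finset_sup_apply (p := fun p : V × V =>
        innerSeminorm (‖g p.1 - g p.2‖⁻¹ • (g p.1 - g p.2))) (x := z) hpu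
      rw [innerSeminorm_apply, real_inner_smul_left, abs_mul,
        abs_of_nonneg (inv_nonneg.2 (hpos p hpu).le)] at h1
      rw [h]
      calc √(w i) * |inner ℝ (g p.1 - g p.2) z| = (√(w i) * ‖g p.1 - g p.2‖) *
            (‖g p.1 - g p.2‖⁻¹ * |inner ℝ (g p.1 - g p.2) z|) := by
            have := (hpos p hpu).ne'
            field_simp
        _ ≤ _ := by gcongr; exact hwp i p hp
  have hNmR : ∀ z, Nm z ≤ R * ‖z‖ := by
    intro z
    rw [hNmapp]
    gcongr
    refine Seminorm.finset_sup_apply_le (norm_nonneg z) fun p hp => ?_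
    rw [innerSeminorm_apply]
    refine (abs_real_inner_le_norm _ _).trans ?_
    calc _ ≤ 1 * ‖z‖ := by gcongr; exact hunit p hp
      _ = _ := one_mul _
  set L := Nat.log 2 n + 1 with hL
  have hnL : n ≤ 2 ^ L := (Nat.lt_pow_succ_log_self (by norm_num) n).le
  have hL3 : (L : ℝ) ≤ 3 * ℓ := by
    have h1 : (2 : ℝ) ^ Nat.log 2 n ≤ n := by
      exact_mod_cast Nat.pow_log_le_self 2 (by omega)
    have h2 := Real.log_le_log (by positivity) h1
    rw [Real.log_pow] at h2
    rw [hL]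
    push_cast
    nlinarith
  have htail : gaussianMeasure E {z | κ < Nm z} ≤ ENNReal.ofReal (1 / 4) := by
    have h1 := gaussianMeasure_sup_innerSeminorm_gt_le (Finset.univ : Finset V).offDiag
      (fun p => ‖g p.1 - g p.2‖⁻¹ • (g p.1 - g p.2)) hunit hR (t := 18 * √(ℓ * ℓD)) (by positivity)
    refine h1.trans (ENNReal.ofReal_le_ofReal ?_)
    rw [hsq]
    have hcardp : ((Finset.univ : Finset V).offDiag.card : ℝ) ≤ n ^ 2 := by
      rw [Finset.offDiag_card, Finset.card_univ]
      exact_mod_cast (Nat.sub_le _ _).trans (le_of_eq (by rw [sq]))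
    have hexp : Real.exp (-(324 * (ℓ * ℓD) / 2)) ≤ ((n : ℝ) ^ 5)⁻¹ := by
      rw [Real.exp_neg]
      apply inv_anti₀ (by positivity)
      rw [← Real.log_le_iff_le_exp (by positivity), Real.log_pow]
      push_cast
      nlinarith
    have hn2 : (2 : ℝ) ≤ n := by exact_mod_cast hV
    calc _ ≤ (n : ℝ) ^ 2 * (2 * ((n : ℝ) ^ 5)⁻¹) := by gcongr
      _ = 2 / (n : ℝ) ^ 3 := by field_simp
      _ ≤ 2 / 2 ^ 3 := by gcongr
      _ = 1 / 4 := by norm_num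
  have hlam : ∀ i, ∫⁻ z, ENNReal.ofReal (N i z ^ 2) ∂(gaussianMeasure E) ≤
      ENNReal.ofReal (12 * R ^ 2 * √(2 * ℓD) ^ 2) := by
    intro i
    refine lintegral_sq_max_gaussian_le (e i).offDiag
      (fun p => √(w i) • (g p.1 - g p.2)) hR ?_ ?_ ?_ _ ?_
    · intro p hp
      rw [norm_smul, Real.norm_of_nonneg (Real.sqrt_nonneg _)]
      exact hwp i p hp
    · rw [Real.one_le_sqrt]
      linarith
    · rw [Real.sq_sqrt (by linarith), two_mul, Real.exp_add, Real.exp_log hD0]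
      have h1 : (e i).offDiag.card ≤ D * D := by
        rw [Finset.offDiag_card]
        exact (Nat.sub_le _ _).trans (Nat.mul_le_mul (he i) (he i))
      exact_mod_cast h1
    · intro z
      rw [hNapp]
      rcases edgeSeminorm_eq g (e i) z with h | ⟨p, hp, h⟩
      · left; rw [h, mul_zero]
      · right
        refine ⟨p, hp, ?_⟩
        rw [h, real_inner_smul_left, abs_mul, abs_of_nonneg (Real.sqrt_nonneg _)]
  have hNc : ∀ i, Continuous (N i) := fun i =>
    continuous_of_le_mul_norm hR.le fun z => (hle i z).trans (hNmR z)
  have hNmc : Continuous Nm := continuous_of_le_mul_norm hR.le hNmR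
  have hL0 : (0 : ℝ) < L := by rw [hL]; positivity
  have hκ0 : 0 < κ := by rw [hκ]; positivity
  have hB : S ^ 2 * (12 * R ^ 2 * √(2 * ℓD) ^ 2) ≤ (S / √L * κ) ^ 2 * (1 / 4) := by
    have e1 : (S / √L * κ) ^ 2 = S ^ 2 * R ^ 2 * (324 * (ℓ * ℓD)) / L := by
      rw [hκ, mul_pow, div_pow, Real.sq_sqrt hL0.le, mul_pow, hsq]
      field_simp
    rw [e1, div_mul_eq_mul_div, le_div_iff₀ hL0, Real.sq_sqrt (by linarith)]
    have h0 : 0 ≤ S ^ 2 * R ^ 2 * ℓD := mul_nonneg (by positivity) (by linarith)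
    nlinarith [mul_le_mul_of_nonneg_left hL3 h0, mul_nonneg h0 (by linarith : 0 ≤ ℓ)]
  obtain ⟨s, hs⟩ := exists_signs_sum_sq_le (N := N) (Nm := Nm) hle hNmR hR
    (by rw [hκ]; nlinarith : R ≤ κ) hS (by omega : 1 ≤ L) hE (by omega) hnL hι
    fun α hα hαS => half_le_gaussianMeasure_near hNc hNmc htail (by positivity) hlam (by positivity)
      hB hα hαS
  refine ⟨s, fun z hz hzS => ?_⟩
  have := hs z ⟨hz, by simpa only [hNsq] using hzS⟩
  simp only [hNsq] at this
  refine this.trans (le_of_eq ?_)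
  rw [hκ]
  ring

end Pairs

/-! ### The balanced split of the weights -/

section MaxOver

variable {X : Type*} {s : Finset X} {f : X → ℝ}

theorem le_maxOver {x : X} (hx : x ∈ s) : f x ≤ maxOver s f := by
  rw [maxOver, dif_pos ⟨x, hx⟩]
  exact Finset.le_sup' f hx

theorem maxOver_eq_zero_or : (s = ∅ ∧ maxOver s f = 0) ∨ ∃ x ∈ s, maxOver s f = f x := by
  rcases s.eq_empty_or_nonempty with rfl | h
  · left; simp [maxOver]
  · right
    rw [maxOver, dif_pos h]
    exact Finset.exists_mem_eq_sup' h f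

theorem maxOver_nonneg (h : ∀ x ∈ s, 0 ≤ f x) : 0 ≤ maxOver s f := by
  rcases maxOver_eq_zero_or (s := s) (f := f) with ⟨_, h'⟩ | ⟨x, hx, h'⟩ <;> rw [h']
  exact h x hx

end MaxOver

section Energy

variable {V : Type*} [DecidableEq V]

theorem mem_pairs {e : Finset V} {u v : V} : s(u, v) ∈ pairs e ↔ u ∈ e ∧ v ∈ e ∧ u ≠ v := by
  simp [pairs, and_assoc]

omit [DecidableEq V] in
theorem sqDiff_mk (x : V → ℝ) (u v : V) : sqDiff x s(u, v) = (x u - x v) ^ 2 := rfl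

omit [DecidableEq V] in
theorem sqDiff_nonneg (x : V → ℝ) (p : Sym2 V) : 0 ≤ sqDiff x p := by
  induction p using Sym2.ind with
  | _ u v => rw [sqDiff_mk]; positivity

theorem edgeEnergy_nonneg (e : Finset V) (x : V → ℝ) : 0 ≤ edgeEnergy e x :=
  maxOver_nonneg fun p _ => sqDiff_nonneg x p

theorem le_edgeEnergy {e : Finset V} {u v : V} (hu : u ∈ e) (hv : v ∈ e) (x : V → ℝ) :
    (x u - x v) ^ 2 ≤ edgeEnergy e x := by
  by_cases h : u = v
  · subst h
    simpa using edgeEnergy_nonneg e x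
  · exact le_maxOver (f := sqDiff x) (mem_pairs.2 ⟨hu, hv, h⟩)

theorem edgeEnergy_eq_zero_or (e : Finset V) (x : V → ℝ) :
    edgeEnergy e x = 0 ∨ ∃ u ∈ e, ∃ v ∈ e, u ≠ v ∧ edgeEnergy e x = (x u - x v) ^ 2 := by
  rcases maxOver_eq_zero_or (s := pairs e) (f := sqDiff x) with ⟨_, h⟩ | ⟨p, hp, h⟩
  · exact Or.inl h
  · right
    induction p using Sym2.ind with
    | _ u v =>
      obtain ⟨h1, h2, h3⟩ := mem_pairs.1 hp
      exact ⟨u, h1, v, h2, h3, h⟩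

theorem edgeEnergy_congr {e : Finset V} {x y : V → ℝ}
    (h : ∀ u ∈ e, ∀ v ∈ e, x u - x v = y u - y v) : edgeEnergy e x = edgeEnergy e y := by
  apply le_antisymm
  · rcases edgeEnergy_eq_zero_or e x with h0 | ⟨u, hu, v, hv, _, h0⟩ <;> rw [h0]
    · exact edgeEnergy_nonneg e y
    · rw [h u hu v hv]; exact le_edgeEnergy hu hv y
  · rcases edgeEnergy_eq_zero_or e y with h0 | ⟨u, hu, v, hv, _, h0⟩ <;> rw [h0]
    · exact edgeEnergy_nonneg e x
    · rw [← h u hu v hv]; exact le_edgeEnergy hu hv x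

theorem weight_mul_edgeEnergy_nonneg {H : WeightedHypergraph V} {e : Finset V} (he : e ∈ H.edges)
    (x : V → ℝ) : 0 ≤ H.weight e * edgeEnergy e x :=
  mul_nonneg (H.weight_nonneg e he) (edgeEnergy_nonneg e x)

theorem energy_nonneg (H : WeightedHypergraph V) (x : V → ℝ) : 0 ≤ energy H x :=
  Finset.sum_nonneg fun _ he => weight_mul_edgeEnergy_nonneg he x

/-- In a Euclidean realization of the coordinate functions, the energy of a set is the square of
the corresponding seminorm. -/
theorem edgeSeminorm_sq_eq {E : Type*} [NormedAddCommGroup E] [InnerProductSpace ℝ E] {g : V → E}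
    {z : E} {x : V → ℝ} (h : ∀ u, inner ℝ (g u) z = x u) (e : Finset V) :
    edgeSeminorm g e z ^ 2 = edgeEnergy e x := by
  have hd : ∀ u v, |inner ℝ (g u - g v) z| ^ 2 = (x u - x v) ^ 2 := fun u v => by
    rw [inner_sub_left, h, h, sq_abs]
  apply le_antisymm
  · rcases edgeSeminorm_eq g e z with h0 | ⟨p, hp, h0⟩ <;> rw [h0]
    · simpa using edgeEnergy_nonneg e x
    · rw [Finset.mem_offDiag] at hp
      rw [hd]
      exact le_edgeEnergy hp.1 hp.2.1 x
  · rcases edgeEnergy_eq_zero_or e x with h0 | ⟨u, hu, v, hv, hne, h0⟩ <;> rw [h0]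
    · positivity
    · rw [← hd]
      have := le_edgeSeminorm g (p := (u, v)) (Finset.mem_offDiag.2 ⟨hu, hv, hne⟩) z
      gcongr

end Energy

section Coercive

variable {V : Type*} [DecidableEq V] [Fintype V]

/-- The energy is coercive modulo the vectors on which it vanishes: `x` may be replaced by a small
`x'` with the same differences on all hyperedges of positive weight. -/
theorem exists_coercive (H : WeightedHypergraph V) :
    ∃ η : ℝ, 0 < η ∧ ∀ x : V → ℝ, ∃ x' : V → ℝ,
      (∀ e ∈ H.edges, 0 < H.weight e → ∀ u ∈ e, ∀ v ∈ e, x' u - x' v = x u - x v) ∧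
      η * ∑ u, x' u ^ 2 ≤ energy H x := by
  classical
  -- A linear map whose supremum norm bounds the energy from below; `x'` is the image of `Λ x` under
  -- a linear right inverse.
  let Λ : (V → ℝ) →ₗ[ℝ] (Finset V × V × V → ℝ) :=
    { toFun := fun x i => if i.1 ∈ H.edges ∧ i.2.1 ∈ i.1 ∧ i.2.2 ∈ i.1 then
        √(H.weight i.1) * (x i.2.1 - x i.2.2) else 0
      map_add' := fun x y => by
        ext i
        simp only [Pi.add_apply]
        split_ifs <;> ring
      map_smul' := fun a x => by
        ext i
        simp only [Pi.smul_apply, smul_eq_mul, RingHom.id_apply]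
        split_ifs <;> ring }
  have hΛ : ∀ x i, Λ x i = if i.1 ∈ H.edges ∧ i.2.1 ∈ i.1 ∧ i.2.2 ∈ i.1 then
        √(H.weight i.1) * (x i.2.1 - x i.2.2) else 0 := fun x i => rfl
  have hΛE : ∀ x, ‖Λ x‖ ^ 2 ≤ energy H x := by
    intro x
    have h1 : ‖Λ x‖ ≤ √(energy H x) := by
      refine (pi_norm_le_iff_of_nonneg (Real.sqrt_nonneg _)).2 fun i => ?_
      rw [hΛ]
      split_ifs with hi
      · apply Real.le_sqrt_of_sq_le
        rw [Real.norm_eq_abs, sq_abs, mul_pow, Real.sq_sqrt (H.weight_nonneg _ hi.1)]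
        refine le_trans ?_ (Finset.single_le_sum
          (f := fun e => H.weight e * edgeEnergy e x)
          (fun e he => weight_mul_edgeEnergy_nonneg he x) hi.1)
        exact mul_le_mul_of_nonneg_left (le_edgeEnergy hi.2.1 hi.2.2 x) (H.weight_nonneg _ hi.1)
      · simp
    calc ‖Λ x‖ ^ 2 ≤ √(energy H x) ^ 2 := by gcongr
      _ = _ := Real.sq_sqrt (energy_nonneg H x)
  obtain ⟨sec, hsec⟩ := Λ.rangeRestrict.exists_rightInverse_of_surjective
    (LinearMap.range_rangeRestrict Λ)
  set secL := LinearMap.toContinuousLinearMap sec with hsecL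
  refine ⟨1 / (Fintype.card V * ‖secL‖ ^ 2 + 1), by positivity, fun x => ?_⟩
  set x' : V → ℝ := sec (Λ.rangeRestrict x) with hx'
  have hΛx' : Λ x' = Λ x := by
    have := LinearMap.congr_fun hsec (Λ.rangeRestrict x)
    exact congrArg Subtype.val this
  refine ⟨x', fun e he hw u hu v hv => ?_, ?_⟩
  · have h1 := congrFun hΛx' (e, u, v)
    rw [hΛ, hΛ, if_pos ⟨he, hu, hv⟩, if_pos ⟨he, hu, hv⟩] at h1
    exact mul_left_cancel₀ (Real.sqrt_pos.2 hw).ne' h1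
  · have h1 : ‖x'‖ ≤ ‖secL‖ * ‖Λ x‖ := secL.le_opNorm (Λ.rangeRestrict x)
    have h2 : ∑ u, x' u ^ 2 ≤ Fintype.card V * ‖x'‖ ^ 2 := by
      calc ∑ u, x' u ^ 2 ≤ ∑ _u : V, ‖x'‖ ^ 2 := by
            refine Finset.sum_le_sum fun u _ => ?_
            rw [← sq_abs, ← Real.norm_eq_abs]
            gcongr
            exact norm_le_pi_norm x' u
        _ = _ := by rw [Finset.sum_const, Finset.card_univ, nsmul_eq_mul]
    rw [one_div, inv_mul_le_iff₀ (by positivity)]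
    calc ∑ u, x' u ^ 2 ≤ Fintype.card V * ‖x'‖ ^ 2 := h2
      _ ≤ Fintype.card V * (‖secL‖ * ‖Λ x‖) ^ 2 := by gcongr
      _ = Fintype.card V * ‖secL‖ ^ 2 * ‖Λ x‖ ^ 2 := by ring
      _ ≤ Fintype.card V * ‖secL‖ ^ 2 * energy H x := by gcongr; exact hΛE x
      _ ≤ _ := by linarith [energy_nonneg H x]

end Coercive

section Balance

variable {V : Type*} [DecidableEq V] [Fintype V]

omit [Fintype V] in
theorem pairMatrix_mk (u v : V) :
    pairMatrix s(u, v) = Matrix.vecMulVec (basisDiff u v) (basisDiff u v) := rfl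

theorem basisDiff_dotProduct (u v : V) (x : V → ℝ) : basisDiff u v ⬝ᵥ x = x u - x v := by
  simp [basisDiff, sub_dotProduct]

theorem posSemidef_pairMatrix (p : Sym2 V) : (pairMatrix p).PosSemidef := by
  induction p using Sym2.ind with
  | _ u v =>
    rw [pairMatrix_mk]
    simpa using Matrix.posSemidef_vecMulVec_self_star (basisDiff u v)

theorem dotProduct_pairMatrix_mulVec (p : Sym2 V) (x : V → ℝ) :
    x ⬝ᵥ (pairMatrix p *ᵥ x) = sqDiff x p := by
  induction p using Sym2.ind with
  | _ u v =>
    rw [pairMatrix_mk, sqDiff_mk, Matrix.vecMulVec_mulVec, basisDiff_dotProduct, op_smul_eq_smul,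
      dotProduct_smul, dotProduct_comm, basisDiff_dotProduct, smul_eq_mul, sq]

/-- The weighted Laplacian of the graph given by the weights `c e p`, plus `η` times the
identity. -/
def regLaplacian (H : WeightedHypergraph V) (η : ℝ) (c : Finset V → Sym2 V → ℝ) : Matrix V V ℝ :=
  η • (1 : Matrix V V ℝ) + ∑ e ∈ H.edges, ∑ p ∈ pairs e, c e p • pairMatrix p

theorem posDef_regLaplacian (H : WeightedHypergraph V) {η : ℝ} (hη : 0 < η)
    {c : Finset V → Sym2 V → ℝ} (hc : ∀ e ∈ H.edges, ∀ p ∈ pairs e, 0 ≤ c e p) :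
    (regLaplacian H η c).PosDef :=
  (Matrix.PosDef.one.smul hη).add_posSemidef (Matrix.posSemidef_sum _ fun e he =>
    Matrix.posSemidef_sum _ fun p hp => (posSemidef_pairMatrix p).smul (hc e he p hp))

theorem dotProduct_regLaplacian_mulVec (H : WeightedHypergraph V) (η : ℝ)
    (c : Finset V → Sym2 V → ℝ) (x : V → ℝ) :
    x ⬝ᵥ (regLaplacian H η c *ᵥ x) =
      η * ∑ u, x u ^ 2 + ∑ e ∈ H.edges, ∑ p ∈ pairs e, c e p * sqDiff x p := by
  rw [regLaplacian, Matrix.add_mulVec, dotProduct_add, Matrix.smul_mulVec, Matrix.one_mulVec,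
    dotProduct_smul, smul_eq_mul, Matrix.sum_mulVec, dotProduct_sum]
  congr 1
  · congr 1
    exact Finset.sum_congr rfl fun u _ => by rw [sq]
  · refine Finset.sum_congr rfl fun e _ => ?_
    rw [Matrix.sum_mulVec, dotProduct_sum]
    refine Finset.sum_congr rfl fun p _ => ?_
    rw [Matrix.smul_mulVec, dotProduct_smul, smul_eq_mul, dotProduct_pairMatrix_mulVec]

omit [Fintype V] in
/-- The quadratic form of the Laplacian of a split of the weights is at most the energy. -/
theorem sum_split_le_energy {H : WeightedHypergraph V} {c : Finset V → Sym2 V → ℝ}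
    (hc : IsConductanceSplit H c) (x : V → ℝ) :
    ∑ e ∈ H.edges, ∑ p ∈ pairs e, c e p * sqDiff x p ≤ energy H x := by
  refine Finset.sum_le_sum fun e he => ?_
  rw [← hc.2 e he, Finset.sum_mul]
  refine Finset.sum_le_sum fun p hp => mul_le_mul_of_nonneg_left ?_ (hc.1 e he p hp)
  exact le_maxOver (f := sqDiff x) hp

/-- The effective resistance of a pair with respect to a positive definite matrix `B`. -/
noncomputable def pairResistance (B : Matrix V V ℝ) (p : Sym2 V) : ℝ := (B⁻¹ * pairMatrix p).trace

theorem pairResistance_mk (B : Matrix V V ℝ) (u v : V) :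
    pairResistance B s(u, v) = basisDiff u v ⬝ᵥ (B⁻¹ *ᵥ basisDiff u v) := by
  rw [pairResistance, pairMatrix_mk, Matrix.mul_vecMulVec, Matrix.trace_vecMulVec, dotProduct_comm]

theorem pairResistance_nonneg {B : Matrix V V ℝ} (hB : B.PosDef) (p : Sym2 V) :
    0 ≤ pairResistance B p := by
  induction p using Sym2.ind with
  | _ u v =>
    rw [pairResistance_mk]
    simpa using hB.inv.posSemidef.dotProduct_mulVec_nonneg (basisDiff u v)

/-- The determinant along the exchange of weight `t` between two pairs: to first order it grows by
`t` times the difference of the resistances. -/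
theorem det_exchange {B : Matrix V V ℝ} (hB : B.PosDef) (p q : Sym2 V) :
    ∃ k : ℝ, ∀ t : ℝ, (B + t • (pairMatrix p - pairMatrix q)).det =
      B.det * (1 + t * (pairResistance B p - pairResistance B q) + t ^ 2 * k) := by
  induction p using Sym2.ind with
  | _ u v =>
  induction q using Sym2.ind with
  | _ u' v' =>
    set a := basisDiff u v with ha
    set b := basisDiff u' v' with hb
    refine ⟨-(pairResistance B s(u, v) * pairResistance B s(u', v')) +
      (a ⬝ᵥ (B⁻¹ *ᵥ b)) * (b ⬝ᵥ (B⁻¹ *ᵥ a)), fun t => ?_⟩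
    set U : Matrix V (Fin 2) ℝ := (Matrix.of ![t • a, -t • b])ᵀ with hU
    set W : Matrix (Fin 2) V ℝ := Matrix.of ![a, b] with hW
    have e1 : t • (pairMatrix s(u, v) - pairMatrix s(u', v')) = U * W := by
      ext i j
      simp [pairMatrix_mk, ← ha, ← hb, hU, hW, Matrix.mul_apply, Fin.sum_univ_two,
        Matrix.vecMulVec_apply]
      ring
    have hent : ∀ (i j : Fin 2), (W * B⁻¹ * U) i j =
        (![a, b] i) ⬝ᵥ (B⁻¹ *ᵥ (![t • a, -t • b] j)) := by
      intro i j
      rw [Matrix.mul_assoc]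
      simp only [Matrix.mul_apply, dotProduct, Matrix.mulVec, hW, hU, Matrix.of_apply,
        Matrix.transpose_apply]
    rw [e1, Matrix.det_add_mul _ _ ((Matrix.isUnit_iff_isUnit_det _).1 hB.isUnit),
      Matrix.det_fin_two]
    simp only [Matrix.add_apply, hent, pairResistance_mk, ← ha, ← hb]
    congr 1
    simp [Matrix.mulVec_smul, Matrix.mulVec_neg]
    ring

/-- Among all ways to split the hyperedge weights there is a balanced one: on every hyperedge, the
pairs that carry weight have the largest resistance. It maximizes the determinant of the
Laplacian. -/
theorem exists_balanced_split (H : WeightedHypergraph V) {c₀ : Finset V → Sym2 V → ℝ}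
    (hc₀ : IsConductanceSplit H c₀) {η : ℝ} (hη : 0 < η) :
    ∃ c, IsConductanceSplit H c ∧ ∀ e ∈ H.edges, ∀ p ∈ pairs e, ∀ q ∈ pairs e, 0 < c e q →
      pairResistance (regLaplacian H η c) p ≤ pairResistance (regLaplacian H η c) q := by
  classical
  set W := ∑ e ∈ H.edges, H.weight e with hW
  have hWe : ∀ e ∈ H.edges, H.weight e ≤ W := fun e he =>
    Finset.single_le_sum (f := H.weight) H.weight_nonneg he
  have hsplitW : ∀ c, IsConductanceSplit H c → ∀ e ∈ H.edges, ∀ p ∈ pairs e, c e p ≤ W := by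
    intro c hc e he p hp
    refine le_trans ?_ (hWe e he)
    rw [← hc.2 e he]
    exact Finset.single_le_sum (f := c e) (hc.1 e he) hp
  have hW0 : 0 ≤ W := Finset.sum_nonneg H.weight_nonneg
  set P : Set (Finset V → Sym2 V → ℝ) := Set.Icc 0 (fun _ _ => W) ∩
    {c | ∀ e ∈ H.edges, ∑ p ∈ pairs e, c e p = H.weight e} with hP
  have hPsplit : ∀ c ∈ P, IsConductanceSplit H c := fun c hc =>
    ⟨fun e _ p _ => hc.1.1 e p, hc.2⟩
  have hclosed : IsClosed {c : Finset V → Sym2 V → ℝ |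
      ∀ e ∈ H.edges, ∑ p ∈ pairs e, c e p = H.weight e} := by
    have : {c : Finset V → Sym2 V → ℝ | ∀ e ∈ H.edges, ∑ p ∈ pairs e, c e p = H.weight e} =
        ⋂ e ∈ H.edges, {c | ∑ p ∈ pairs e, c e p = H.weight e} := by
      ext c; simp
    rw [this]
    exact isClosed_biInter fun e _ => isClosed_eq (by fun_prop) continuous_const
  have hcomp : IsCompact P := isCompact_Icc.inter_right hclosed
  have hne : P.Nonempty := by
    refine ⟨fun e p => if e ∈ H.edges ∧ p ∈ pairs e then c₀ e p else 0, ⟨?_, ?_⟩, ?_⟩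
    · intro e p
      simp only [Pi.zero_apply]
      split_ifs with h
      · exact hc₀.1 e h.1 p h.2
      · exact le_rfl
    · intro e p
      simp only
      split_ifs with h
      · exact hsplitW c₀ hc₀ e h.1 p h.2
      · exact hW0
    · intro e he
      rw [← hc₀.2 e he]
      exact Finset.sum_congr rfl fun p hp => if_pos ⟨he, hp⟩
  have hcont : Continuous fun c => (regLaplacian H η c).det := by
    unfold regLaplacian
    fun_prop
  obtain ⟨c, hcP, hmax⟩ := hcomp.exists_isMaxOn hne hcont.continuousOn
  have hc := hPsplit c hcP
  refine ⟨c, hc, fun e he p hp q hq hcq => ?_⟩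
  set B := regLaplacian H η c with hB
  have hBpd : B.PosDef := posDef_regLaplacian H hη hc.1
  obtain ⟨k, hk⟩ := det_exchange hBpd p q
  by_contra! hlt
  have hpq : p ≠ q := by rintro rfl; exact lt_irrefl _ hlt
  set d := pairResistance B p - pairResistance B q with hd
  have hd0 : 0 < d := by rw [hd]; linarith
  have hstep : ∀ t, 0 ≤ t → t ≤ c e q → 1 + t * d + t ^ 2 * k ≤ 1 := by
    intro t ht htc
    set c' : Finset V → Sym2 V → ℝ :=
      fun e' p' => c e' p' + if e' = e then (if p' = p then t else 0) - (if p' = q then t else 0)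
        else 0 with hc'
    have hsum : ∀ e' ∈ H.edges, ∑ p' ∈ pairs e', c' e' p' = H.weight e' := by
      intro e' he'
      simp only [hc']
      rw [Finset.sum_add_distrib, hc.2 e' he']
      by_cases h : e' = e
      · subst h
        simp [Finset.sum_sub_distrib, hp, hq]
      · simp [h]
    have hc'0 : ∀ e' p', 0 ≤ c' e' p' := by
      intro e' p'
      have h0 : 0 ≤ c e' p' := hcP.1.1 e' p'
      simp only [hc']
      split_ifs with h1 h2 h3 h3
      · exact absurd (h2.symm.trans h3) hpq
      · linarith
      · subst h1; subst h3; linarith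
      · linarith
      · linarith
    have hc's : IsConductanceSplit H c' := ⟨fun e' _ p' _ => hc'0 e' p', hsum⟩
    have hc'P : c' ∈ P := by
      refine ⟨⟨fun e' p' => hc'0 e' p', fun e' p' => ?_⟩, hsum⟩
      by_cases h : e' ∈ H.edges ∧ p' ∈ pairs e'
      · exact hsplitW c' hc's e' h.1 p' h.2
      · have : c' e' p' = c e' p' := by
          simp only [hc']
          split_ifs with h1 h2 h3 h3
          · exact absurd (h2.symm.trans h3) hpq
          · subst h1; subst h2; exact absurd ⟨he, hp⟩ h
          · subst h1; subst h3; exact absurd ⟨he, hq⟩ h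
          · simp
          · simp
        rw [this]
        exact hcP.1.2 e' p'
    have hL : regLaplacian H η c' = B + t • (pairMatrix p - pairMatrix q) := by
      rw [hB, regLaplacian, regLaplacian, add_assoc]
      congr 1
      simp only [hc', add_smul, Finset.sum_add_distrib]
      congr 1
      rw [Finset.sum_eq_single_of_mem e he]
      · simp [sub_smul, Finset.sum_sub_distrib, ite_smul, hp, hq, smul_sub]
      · intro e' _ hne'
        simp [hne']
    have := hmax hc'P
    simp only [Set.mem_ofPred_eq] at this
    rw [hL, hk t] at this
    have hdet := hBpd.det_pos
    by_contra! hgt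
    nlinarith
  -- For small `t` the linear term dominates.
  set t := min (c e q) (d / (2 * (|k| + 1))) with ht
  have hk0 : 0 < |k| + 1 := by positivity
  have ht0 : 0 < t := lt_min hcq (by positivity)
  have htk : t * (|k| + 1) ≤ d / 2 := by
    calc t * (|k| + 1) ≤ d / (2 * (|k| + 1)) * (|k| + 1) := by
          gcongr; exact min_le_right _ _
      _ = d / 2 := by field_simp
  have h1 := hstep t ht0.le (min_le_left _ _)
  have h2 : -|k| ≤ k := neg_abs_le k
  have h3 : t * (d + t * k) ≤ 0 := by linarith
  have h4 : 0 < d + t * k := by nlinarith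
  nlinarith

open scoped MatrixOrder in
/-- The invertible symmetric square root of a positive definite matrix. -/
theorem exists_symm_sqrt {B : Matrix V V ℝ} (hB : B.PosDef) :
    ∃ A : Matrix V V ℝ, Aᵀ = A ∧ A * A = B ∧ IsUnit A.det := by
  have h0 : 0 ≤ B := Matrix.nonneg_iff_posSemidef.2 hB.posSemidef
  refine ⟨CFC.sqrt B, ?_, CFC.sqrt_mul_sqrt_self B h0, ?_⟩
  · have := (Matrix.nonneg_iff_posSemidef.1 (CFC.sqrt_nonneg B)).isHermitian
    simpa [Matrix.IsHermitian] using this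
  · have h1 : (CFC.sqrt B).det * (CFC.sqrt B).det = B.det := by
      rw [← Matrix.det_mul, CFC.sqrt_mul_sqrt_self B h0]
    have := hB.det_pos
    exact isUnit_iff_ne_zero.2 fun h => by rw [h] at h1; linarith

/-- A Euclidean realization `x ↦ Φ x` of the coordinate functions whose squared norm is at most
twice the energy, while the hyperedge weights times the largest squared lengths of the
differences `g u - g v` in the hyperedge sum to at most the dimension. -/
theorem exists_balanced_realization (H : WeightedHypergraph V) {c₀ : Finset V → Sym2 V → ℝ}
    (hc₀ : IsConductanceSplit H c₀) :
    ∃ (Φ : (V → ℝ) → EuclideanSpace ℝ V) (g : V → EuclideanSpace ℝ V) (ρ : Finset V → ℝ),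
      (∀ u x, inner ℝ (g u) (Φ x) = x u) ∧
      (∀ e, 0 ≤ ρ e) ∧ (∀ e, ∀ u ∈ e, ∀ v ∈ e, ‖g u - g v‖ ^ 2 ≤ ρ e) ∧
      ∑ e ∈ H.edges, H.weight e * ρ e ≤ Fintype.card V ∧
      ∀ x : V → ℝ, ∃ x' : V → ℝ,
        (∀ e ∈ H.edges, 0 < H.weight e → ∀ u ∈ e, ∀ v ∈ e, x' u - x' v = x u - x v) ∧
        ‖Φ x'‖ ^ 2 ≤ 2 * energy H x := by
  obtain ⟨η, hη, hcoer⟩ := exists_coercive H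
  obtain ⟨c, hc, hbal⟩ := exists_balanced_split H hc₀ hη
  set B := regLaplacian H η c with hB
  have hBpd : B.PosDef := posDef_regLaplacian H hη hc.1
  obtain ⟨A, hAt, hAA, hAu⟩ := exists_symm_sqrt hBpd
  set Φ : (V → ℝ) → EuclideanSpace ℝ V := fun x => WithLp.toLp 2 (A *ᵥ x) with hΦ
  set g : V → EuclideanSpace ℝ V := fun u => WithLp.toLp 2 (A⁻¹ *ᵥ Pi.single u 1) with hg
  have hAit : (A⁻¹)ᵀ = A⁻¹ := by rw [Matrix.transpose_nonsing_inv, hAt]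
  have hinner : ∀ y z : V → ℝ, inner ℝ (WithLp.toLp 2 y : EuclideanSpace ℝ V) (WithLp.toLp 2 z) =
      y ⬝ᵥ z := by
    intro y z
    simp [PiLp.inner_apply, dotProduct, mul_comm]
  have hinv : ∀ y z : V → ℝ, (A⁻¹ *ᵥ y) ⬝ᵥ z = y ⬝ᵥ (A⁻¹ *ᵥ z) := by
    intro y z
    rw [Matrix.dotProduct_mulVec, ← Matrix.mulVec_transpose, hAit]
  have hgΦ : ∀ u x, inner ℝ (g u) (Φ x) = x u := by
    intro u x
    rw [hg, hΦ, hinner, hinv, Matrix.mulVec_mulVec, Matrix.nonsing_inv_mul _ hAu,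
      Matrix.one_mulVec]
    simp
  have hgR : ∀ u v, ‖g u - g v‖ ^ 2 = pairResistance B s(u, v) := by
    intro u v
    have e1 : g u - g v = WithLp.toLp 2 (A⁻¹ *ᵥ basisDiff u v) := by
      rw [hg, basisDiff, Matrix.mulVec_sub]
      rfl
    have e2 : B⁻¹ = A⁻¹ * A⁻¹ := by rw [← hAA, Matrix.mul_inv_rev]
    rw [e1, ← real_inner_self_eq_norm_sq, hinner, hinv, Matrix.mulVec_mulVec, ← e2,
      pairResistance_mk]
  refine ⟨Φ, g, fun e => maxOver (pairs e) (pairResistance B), hgΦ, ?_, ?_, ?_, ?_⟩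
  · exact fun e => maxOver_nonneg fun p _ => pairResistance_nonneg hBpd p
  · intro e u hu v hv
    by_cases h : u = v
    · subst h
      simpa using maxOver_nonneg fun p _ => pairResistance_nonneg hBpd p
    · rw [hgR]
      exact le_maxOver (mem_pairs.2 ⟨hu, hv, h⟩)
  · have h1 : ∀ e ∈ H.edges, H.weight e * maxOver (pairs e) (pairResistance B) =
        ∑ p ∈ pairs e, c e p * pairResistance B p := by
      intro e he
      rw [← hc.2 e he, Finset.sum_mul]
      refine Finset.sum_congr rfl fun q hq => ?_
      rcases (hc.1 e he q hq).eq_or_lt with h0 | h0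
      · rw [← h0, zero_mul, zero_mul]
      · congr 1
        apply le_antisymm _ (le_maxOver hq)
        rcases maxOver_eq_zero_or (s := pairs e) (f := pairResistance B) with ⟨_, h⟩ | ⟨p, hp, h⟩
        · rw [h]; exact pairResistance_nonneg hBpd q
        · rw [h]; exact hbal e he p hp q hq h0
    rw [Finset.sum_congr rfl h1]
    -- As in Foster's theorem, conductances times resistances sum to a trace, at most the dimension.
    have h2 : ∑ e ∈ H.edges, ∑ p ∈ pairs e, c e p * pairResistance B p =
        (B⁻¹ * (B - η • (1 : Matrix V V ℝ))).trace := by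
      have : B - η • (1 : Matrix V V ℝ) = ∑ e ∈ H.edges, ∑ p ∈ pairs e, c e p • pairMatrix p := by
        rw [hB, regLaplacian, add_sub_cancel_left]
      rw [this]
      simp only [Matrix.mul_sum, Matrix.trace_sum, Matrix.mul_smul, Matrix.trace_smul,
        smul_eq_mul, pairResistance]
    rw [h2, Matrix.mul_sub, Matrix.nonsing_inv_mul _
      ((Matrix.isUnit_iff_isUnit_det _).1 hBpd.isUnit), Matrix.trace_sub, Matrix.trace_one,
      Matrix.mul_smul, Matrix.mul_one, Matrix.trace_smul, smul_eq_mul]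
    have := hBpd.inv.posSemidef.trace_nonneg
    nlinarith
  · intro x
    obtain ⟨x', hx', hηx⟩ := hcoer x
    refine ⟨x', hx', ?_⟩
    have e1 : energy H x' = energy H x := by
      refine Finset.sum_congr rfl fun e he => ?_
      rcases (H.weight_nonneg e he).eq_or_lt with h0 | h0
      · rw [← h0, zero_mul, zero_mul]
      · rw [edgeEnergy_congr (hx' e he h0)]
    have e2 : ‖Φ x'‖ ^ 2 = x' ⬝ᵥ (B *ᵥ x') := by
      rw [← real_inner_self_eq_norm_sq, hΦ, hinner, ← hAA, ← Matrix.mulVec_mulVec,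
        Matrix.dotProduct_mulVec x' A, ← Matrix.mulVec_transpose, hAt]
    rw [e2, hB, dotProduct_regLaplacian_mulVec]
    have := sum_split_le_energy hc x'
    linarith

end Balance

/-! ### Sparsification by repeated halving -/

section Halving

variable {V : Type*} [DecidableEq V] [Fintype V]

/-- One round of the sparsification: every light hyperedge, with `w e * ρ e ≤ R ^ 2`, is deleted or
doubled, so that the energy changes little and the total mass does not grow. -/
theorem exists_halving {H : WeightedHypergraph V} {Φ : (V → ℝ) → EuclideanSpace ℝ V}
    {g : V → EuclideanSpace ℝ V} {ρ : Finset V → ℝ}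
    (hg : ∀ u x, inner ℝ (g u) (Φ x) = x u)
    (hρ : ∀ e, ∀ u ∈ e, ∀ v ∈ e, ‖g u - g v‖ ^ 2 ≤ ρ e)
    (hΦ : ∀ x : V → ℝ, ∃ x' : V → ℝ,
      (∀ e ∈ H.edges, 0 < H.weight e → ∀ u ∈ e, ∀ v ∈ e, x' u - x' v = x u - x v) ∧
      ‖Φ x'‖ ^ 2 ≤ 2 * energy H x)
    (hV : 2 ≤ Fintype.card V) {D : ℕ} (hD : 2 ≤ D) (hcard : ∀ e ∈ H.edges, e.card ≤ D)
    {w : Finset V → ℝ} (hw : ∀ e ∈ H.edges, 0 ≤ w e)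
    (hwH : ∀ e ∈ H.edges, 0 < w e → 0 < H.weight e)
    (hwE : ∀ x, ∑ e ∈ H.edges, w e * edgeEnergy e x ≤ 2 * energy H x) {R : ℝ} (hR : 0 < R) :
    ∃ w' : Finset V → ℝ, (∀ e ∈ H.edges, w' e = w e ∧ (0 < w e → R ^ 2 < w e * ρ e) ∨
        w' e = 0 ∨ w' e = 2 * w e) ∧
      ∑ e ∈ H.edges, w' e * ρ e ≤ ∑ e ∈ H.edges, w e * ρ e ∧
      ∀ x, |∑ e ∈ H.edges, w' e * edgeEnergy e x - ∑ e ∈ H.edges, w e * edgeEnergy e x| ≤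
        720000000 * √(Real.log (Fintype.card V) * Real.log D) * R * energy H x := by
  classical
  have hgne : ∀ u v, u ≠ v → g u ≠ g v := by
    intro u v huv h
    have h1 := hg u (Pi.single u 1)
    rw [h, hg] at h1
    simp [huv.symm] at h1
  set A := H.edges.filter fun e => 0 < w e ∧ w e * ρ e ≤ R ^ 2 with hA
  have hAE : A ⊆ H.edges := Finset.filter_subset _ _
  have hAmem : ∀ e ∈ A, e ∈ H.edges ∧ 0 < w e ∧ w e * ρ e ≤ R ^ 2 := fun e he =>
    Finset.mem_filter.1 he
  obtain ⟨s, hs⟩ := exists_signs_edges g hgne hV (by simp) hD (fun i : A => i.1)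
    (fun i => hcard _ (hAE i.2)) (fun i : A => w i.1) (fun i => hw _ (hAE i.2)) hR one_pos
    (fun i u hu v hv => (mul_le_mul_of_nonneg_left (hρ i.1 u hu v hv) (hw _ (hAE i.2))).trans
      (hAmem _ i.2).2.2)
    (by
      rw [Fintype.card_coe]
      refine (Finset.card_le_univ A).trans ?_
      rw [Fintype.card_finset]
      exact Nat.pow_le_pow_left (by norm_num) _)
  set t : Finset V → ℝ := fun e => if h : e ∈ A then ((s ⟨e, h⟩ : ℤ) : ℝ) else 0 with ht
  have htA : ∀ e ∈ A, t e = 1 ∨ t e = -1 := by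
    intro e he
    simp only [ht, dif_pos he]
    rcases Int.units_eq_one_or (s ⟨e, he⟩) with h | h <;> simp [h]
  have ht0 : ∀ e, e ∉ A → t e = 0 := fun e he => by simp only [ht, dif_neg he]
  have hsum : ∀ f : Finset V → ℝ, signSum s (fun i : A => f i.1) = ∑ e ∈ H.edges, t e * f e := by
    intro f
    rw [← Finset.sum_subset hAE fun e _ he => by rw [ht0 e he, zero_mul], signSum,
      ← Finset.sum_coe_sort A]
    exact Finset.sum_congr rfl fun i _ => by simp [ht]
  have hbound : ∀ x, |∑ e ∈ H.edges, t e * (w e * edgeEnergy e x)| ≤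
      720000000 * √(Real.log (Fintype.card V) * Real.log D) * R * energy H x := by
    intro x
    rcases (energy_nonneg H x).eq_or_lt' with h0 | h0
    · have hz : ∀ e ∈ H.edges, t e * (w e * edgeEnergy e x) = 0 := by
        intro e he
        have h1 := (Finset.sum_eq_zero_iff_of_nonneg
          fun e he => weight_mul_edgeEnergy_nonneg he x).1 h0 e he
        rcases (hw e he).eq_or_lt' with h2 | h2
        · rw [h2]; ring
        · rw [(mul_eq_zero.1 h1).resolve_left (hwH e he h2).ne']; ring
      rw [Finset.sum_eq_zero hz, h0]
      simp
    -- Rescaled to energy `1 / 2`, the point `Φ x'` lies in the unit ball.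
    · obtain ⟨x', hx', hn⟩ := hΦ x
      set q := energy H x with hq
      set a := (√(2 * q))⁻¹ with ha
      have ha2 : a ^ 2 = (2 * q)⁻¹ := by rw [ha, inv_pow, Real.sq_sqrt (by positivity)]
      have hsn : ∀ e ∈ A, edgeSeminorm g e (a • Φ x') ^ 2 = a ^ 2 * edgeEnergy e x := by
        intro e he
        rw [map_smul_eq_mul, mul_pow, Real.norm_eq_abs, sq_abs,
          edgeSeminorm_sq_eq (fun u => hg u x'),
          edgeEnergy_congr (hx' e (hAE he) (hwH e (hAE he) (hAmem e he).2.1))]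
      have hz : ‖a • Φ x'‖ ≤ 1 := by
        rw [← sq_le_one_iff₀ (norm_nonneg _), norm_smul, mul_pow, Real.norm_eq_abs, sq_abs, ha2,
          inv_mul_le_iff₀ (by positivity)]
        linarith
      have hcongr : (fun i : A => w i.1 * edgeSeminorm g i.1 (a • Φ x') ^ 2) =
          fun i : A => (fun e => w e * (a ^ 2 * edgeEnergy e x)) i.1 := by
        ext i
        rw [hsn _ i.2]
      have h1 := hs (a • Φ x') hz (by
        rw [hcongr, Finset.sum_coe_sort A fun e => w e * (a ^ 2 * edgeEnergy e x)]
        calc ∑ e ∈ A, w e * (a ^ 2 * edgeEnergy e x)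
            ≤ ∑ e ∈ H.edges, w e * (a ^ 2 * edgeEnergy e x) :=
              Finset.sum_le_sum_of_subset_of_nonneg hAE fun e he _ =>
                mul_nonneg (hw e he) (mul_nonneg (sq_nonneg a) (edgeEnergy_nonneg e x))
          _ = a ^ 2 * ∑ e ∈ H.edges, w e * edgeEnergy e x := by
              rw [Finset.mul_sum]
              exact Finset.sum_congr rfl fun e _ => by ring
          _ ≤ a ^ 2 * (2 * q) := by gcongr; exact hwE x
          _ = 1 ^ 2 := by rw [ha2]; field_simp)
      rw [hcongr, hsum fun e => w e * (a ^ 2 * edgeEnergy e x)] at h1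
      have h2 : ∑ e ∈ H.edges, t e * (w e * (a ^ 2 * edgeEnergy e x)) =
          a ^ 2 * ∑ e ∈ H.edges, t e * (w e * edgeEnergy e x) := by
        rw [Finset.mul_sum]
        exact Finset.sum_congr rfl fun e _ => by ring
      rw [h2, abs_mul, abs_of_nonneg (sq_nonneg a), ha2, inv_mul_le_iff₀ (by positivity)] at h1
      refine h1.trans (le_of_eq ?_)
      ring
  -- Of the two opposite sign patterns, one does not increase the mass.
  obtain ⟨σ, hσ, hmass⟩ : ∃ σ : ℝ, (σ = 1 ∨ σ = -1) ∧
      σ * ∑ e ∈ H.edges, t e * (w e * ρ e) ≤ 0 := by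
    rcases le_total (∑ e ∈ H.edges, t e * (w e * ρ e)) 0 with h | h
    · exact ⟨1, Or.inl rfl, by linarith⟩
    · exact ⟨-1, Or.inr rfl, by linarith⟩
  have hσ1 : |σ| = 1 := by rcases hσ with h | h <;> simp [h]
  have hsplit : ∀ f : Finset V → ℝ, ∑ e ∈ H.edges, (w e + σ * t e * w e) * f e =
      ∑ e ∈ H.edges, w e * f e + σ * ∑ e ∈ H.edges, t e * (w e * f e) := by
    intro f
    rw [Finset.mul_sum, ← Finset.sum_add_distrib]
    exact Finset.sum_congr rfl fun e _ => by ring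
  refine ⟨fun e => w e + σ * t e * w e, fun e he => ?_, ?_, fun x => ?_⟩
  · by_cases h : e ∈ A
    · right
      rcases hσ with h1 | h1 <;> rcases htA e h with h2 | h2 <;> simp only [h1, h2]
      · right; ring
      · left; ring
      · left; ring
      · right; ring
    · left
      refine ⟨by simp [ht0 e h], fun hpos => ?_⟩
      by_contra! hle
      exact h (Finset.mem_filter.2 ⟨he, hpos, hle⟩)
  · rw [hsplit ρ]
    linarith
  · rw [hsplit fun e => edgeEnergy e x, add_sub_cancel_left, abs_mul, hσ1, one_mul]
    exact hbound x

/-- Rounds of halving with geometrically growing thresholds, until every remaining hyperedge is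
heavy: the errors form a geometric series, dominated by the last round. -/
theorem exists_reweighting {H : WeightedHypergraph V} {Φ : (V → ℝ) → EuclideanSpace ℝ V}
    {g : V → EuclideanSpace ℝ V} {ρ : Finset V → ℝ}
    (hg : ∀ u x, inner ℝ (g u) (Φ x) = x u)
    (hρ : ∀ e, ∀ u ∈ e, ∀ v ∈ e, ‖g u - g v‖ ^ 2 ≤ ρ e)
    (hΦ : ∀ x : V → ℝ, ∃ x' : V → ℝ,
      (∀ e ∈ H.edges, 0 < H.weight e → ∀ u ∈ e, ∀ v ∈ e, x' u - x' v = x u - x v) ∧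
      ‖Φ x'‖ ^ 2 ≤ 2 * energy H x)
    (hV : 2 ≤ Fintype.card V) {D : ℕ} (hD : 2 ≤ D) (hcard : ∀ e ∈ H.edges, e.card ≤ D)
    {τ : ℝ} (hτ : 0 < τ) {B : ℝ}
    (hB : 720000000 * √(Real.log (Fintype.card V) * Real.log D) * √τ = B) (J : ℕ)
    {w : Finset V → ℝ} (hw : ∀ e ∈ H.edges, 0 ≤ w e)
    (hwH : ∀ e ∈ H.edges, 0 < w e → 0 < H.weight e)
    (hwE : ∀ x, ∑ e ∈ H.edges, w e * edgeEnergy e x ≤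
      (2 - 4 * B * (1 - (3 / 4) ^ J)) * energy H x)
    (hwτ : ∀ e ∈ H.edges, 0 < w e → τ / 2 ^ J < w e * ρ e) :
    ∃ w' : Finset V → ℝ, (∀ e ∈ H.edges, 0 ≤ w' e) ∧
      (∀ e ∈ H.edges, 0 < w' e → τ < w' e * ρ e) ∧
      ∑ e ∈ H.edges, w' e * ρ e ≤ ∑ e ∈ H.edges, w e * ρ e ∧
      ∀ x, |∑ e ∈ H.edges, w' e * edgeEnergy e x - ∑ e ∈ H.edges, w e * edgeEnergy e x| ≤
        4 * B * (1 - (3 / 4) ^ J) * energy H x := by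
  have hB0 : 0 ≤ B := by rw [← hB]; positivity
  induction J generalizing w with
  | zero => exact ⟨w, hw, by simpa using hwτ, le_rfl, fun x => by simp⟩
  | succ J ih =>
    have hpow : ((3 : ℝ) / 4) ^ J ≤ 1 := pow_le_one₀ (by norm_num) (by norm_num)
    have hR : √(τ / 2 ^ J) ≤ √τ * (3 / 4) ^ J := by
      rw [Real.sqrt_le_left (by positivity), mul_pow, Real.sq_sqrt hτ.le, ← pow_mul, mul_comm J,
        pow_mul, div_eq_mul_inv, ← inv_pow]
      gcongr
      norm_num
    have hR2 : √(τ / 2 ^ J) ^ 2 = τ / 2 ^ J := Real.sq_sqrt (by positivity)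
    obtain ⟨w₁, h1, h2, h3⟩ := exists_halving hg hρ hΦ hV hD hcard hw hwH
      (fun x => (hwE x).trans (by
        have h4 := energy_nonneg H x
        have h5 : 0 ≤ 4 * B * (1 - (3 / 4) ^ (J + 1)) := by
          rw [pow_succ]
          refine mul_nonneg (by positivity) (by linarith)
        gcongr
        linarith)) (R := √(τ / 2 ^ J)) (Real.sqrt_pos.2 (by positivity))
    have herr : ∀ x, |∑ e ∈ H.edges, w₁ e * edgeEnergy e x -
        ∑ e ∈ H.edges, w e * edgeEnergy e x| ≤ B * (3 / 4) ^ J * energy H x := by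
      intro x
      refine (h3 x).trans (mul_le_mul_of_nonneg_right ?_ (energy_nonneg H x))
      rw [← hB, mul_assoc _ (√τ)]
      gcongr
    have hgeom : 4 * B * (1 - (3 / 4) ^ (J + 1)) = 4 * B * (1 - (3 / 4) ^ J) + B * (3 / 4) ^ J := by
      rw [pow_succ]; ring
    have hw₁ : ∀ e ∈ H.edges, 0 ≤ w₁ e ∧ (0 < w₁ e → 0 < w e ∧ τ / 2 ^ J < w₁ e * ρ e) := by
      intro e he
      rcases h1 e he with ⟨h4, h5⟩ | h4 | h4
      · rw [h4]
        refine ⟨hw e he, fun h6 => ⟨h6, ?_⟩⟩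
        rw [← hR2]
        exact h5 h6
      · rw [h4]
        exact ⟨le_rfl, fun h => absurd h (lt_irrefl _)⟩
      · rw [h4]
        refine ⟨by linarith [hw e he], fun h6 => ?_⟩
        have h7 : 0 < w e := by linarith
        have h8 := hwτ e he h7
        rw [pow_succ, ← div_div, div_lt_iff₀ two_pos] at h8
        exact ⟨h7, by linarith⟩
    obtain ⟨w', h4, h5, h6, h7⟩ := ih (w := w₁) (fun e he => (hw₁ e he).1)
      (fun e he h => hwH e he ((hw₁ e he).2 h).1)
      (fun x => by
        have h8 := hwE x
        have h9 := (abs_le.1 (herr x)).2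
        rw [hgeom] at h8
        linarith)
      (fun e he h => ((hw₁ e he).2 h).2)
    refine ⟨w', h4, h5, h6.trans h2, fun x => ?_⟩
    have h8 := abs_sub_le (∑ e ∈ H.edges, w' e * edgeEnergy e x)
      (∑ e ∈ H.edges, w₁ e * edgeEnergy e x) (∑ e ∈ H.edges, w e * edgeEnergy e x)
    rw [hgeom]
    linarith [h7 x, herr x]

omit [Fintype V] in
/-- A hyperedge of positive weight contains a pair of positive conductance. -/
theorem exists_pair_of_weight_pos {H : WeightedHypergraph V} {c : Finset V → Sym2 V → ℝ}
    (hc : IsConductanceSplit H c) {e : Finset V} (he : e ∈ H.edges) (hw : 0 < H.weight e) :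
    ∃ p ∈ pairs e, 0 < c e p := by
  by_contra! h
  have := Finset.sum_nonpos h
  rw [hc.2 e he] at this
  linarith

/-- Sparsification with a bound that does not involve the given conductances. At the end every
hyperedge has mass more than `τ`, out of a total mass of at most `n`. -/
theorem exists_sparsifier_card_le (H : WeightedHypergraph V) {c : Finset V → Sym2 V → ℝ}
    (hc : IsConductanceSplit H c) (hV : 2 ≤ Fintype.card V) {D : ℕ} (hD : 2 ≤ D)
    (hcard : ∀ e ∈ H.edges, e.card ≤ D) {ε : ℝ} (hε : 0 < ε) (hε1 : ε ≤ 1) :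
    ∃ Ht : WeightedHypergraph V, IsSpectralSparsifier ε H Ht ∧
      (Ht.edges.card : ℝ) ≤ 16 * 720000000 ^ 2 * ((Real.log D / ε ^ 2) *
        (Fintype.card V : ℝ) * Real.log (Fintype.card V)) := by
  classical
  obtain ⟨Φ, g, ρ, hg, hρ0, hρ, hmass, hΦ⟩ := exists_balanced_realization H hc
  set ℓ := Real.log (Fintype.card V) * Real.log D with hℓ
  have hlogV : 0 < Real.log (Fintype.card V) := Real.log_pos (by exact_mod_cast hV)
  have hlogD : 0 < Real.log D := Real.log_pos (by exact_mod_cast hD)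
  have hℓ0 : 0 < ℓ := mul_pos hlogV hlogD
  -- The threshold for which the geometric series of errors has sum `ε`.
  set τ := (ε / (4 * (720000000 * √ℓ))) ^ 2 with hτ
  have hτ0 : 0 < τ := by positivity
  have hB : 720000000 * √ℓ * √τ = ε / 4 := by
    rw [hτ, Real.sqrt_sq (by positivity)]
    field_simp
  have hgne : ∀ u v, u ≠ v → 0 < ‖g u - g v‖ ^ 2 := by
    intro u v huv
    have h2 : g u - g v ≠ 0 := by
      intro h
      have h1 := hg u (Pi.single u 1)
      rw [sub_eq_zero.1 h, hg] at h1
      simp [huv.symm] at h1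
    positivity
  have hρpos : ∀ e ∈ H.edges, 0 < H.weight e → 0 < H.weight e * ρ e := by
    intro e he hw
    obtain ⟨p, hp, -⟩ := exists_pair_of_weight_pos hc he hw
    induction p using Sym2.ind with
    | _ u v =>
      obtain ⟨hu, hv, huv⟩ := mem_pairs.1 hp
      exact mul_pos hw ((hgne u v huv).trans_le (hρ e u hu v hv))
  obtain ⟨J, hJ⟩ : ∃ J : ℕ, ∀ e ∈ H.edges, 0 < H.weight e → τ / 2 ^ J < H.weight e * ρ e := by
    have htend : Filter.Tendsto (fun J : ℕ => τ / 2 ^ J) Filter.atTop (nhds 0) :=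
      tendsto_const_nhds.div_atTop (tendsto_pow_atTop_atTop_of_one_lt (by norm_num))
    refine (((Finset.eventually_all H.edges).2 fun e he => ?_) :
      ∀ᶠ J : ℕ in Filter.atTop, _).exists
    by_cases hw : 0 < H.weight e
    · filter_upwards [htend.eventually_lt_const (hρpos e he hw)] with J hJ _ using hJ
    · exact Filter.Eventually.of_forall fun J h => absurd h hw
  have hpow : (0 : ℝ) ≤ (3 / 4) ^ J := by positivity
  obtain ⟨w, hw0, hwτ, hwm, hwE⟩ := exists_reweighting hg hρ hΦ hV hD hcard hτ0 hB J
    H.weight_nonneg (fun _ _ h => h)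
    (fun x => by
      have h1 := energy_nonneg H x
      have h2 : 1 ≤ 2 - 4 * (ε / 4) * (1 - (3 / 4) ^ J) := by nlinarith
      calc energy H x = 1 * energy H x := (one_mul _).symm
        _ ≤ _ := by gcongr) hJ
  refine ⟨⟨H.edges.filter fun e => 0 < w e, w, fun e he => (Finset.mem_filter.1 he).2.le⟩,
    ⟨Finset.filter_subset _ _, fun x => ?_⟩, ?_⟩
  · have h1 : energy ⟨H.edges.filter fun e => 0 < w e, w,
        fun e he => (Finset.mem_filter.1 he).2.le⟩ x = ∑ e ∈ H.edges, w e * edgeEnergy e x := by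
      rw [energy]
      refine Finset.sum_filter_of_ne fun e he h => (hw0 e he).lt_of_ne' ?_
      exact left_ne_zero_of_mul h
    rw [h1, abs_sub_comm]
    refine (hwE x).trans (mul_le_mul_of_nonneg_right ?_ (energy_nonneg H x))
    nlinarith
  · have h1 : ((H.edges.filter fun e => 0 < w e).card : ℝ) * τ ≤ Fintype.card V := by
      refine le_trans ?_ (hwm.trans hmass)
      rw [← nsmul_eq_mul, ← Finset.sum_const]
      refine (Finset.sum_le_sum fun e he => ?_).trans
        (Finset.sum_le_sum_of_subset_of_nonneg (Finset.filter_subset (fun e => 0 < w e) H.edges)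
          fun e he _ => mul_nonneg (hw0 e he) (hρ0 e))
      rw [Finset.mem_filter] at he
      exact (hwτ e he.1 he.2).le
    rw [← le_div_iff₀ hτ0] at h1
    refine h1.trans (le_of_eq ?_)
    rw [hτ, div_pow, mul_pow, mul_pow, Real.sq_sqrt hℓ0.le, hℓ]
    field_simp
    norm_num

end Halving

/-! ### The balance ratio and the conclusion -/

section BalanceRatio

variable {V : Type*} [DecidableEq V] [Fintype V]

theorem balanceRatio_nonneg (H : WeightedHypergraph V) (c : Finset V → Sym2 V → ℝ) :
    0 ≤ balanceRatio H c := by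
  have hR : ∀ p, 0 ≤ resistance H c p := fun p => by
    induction p using Sym2.ind with
    | _ u v => exact sq_nonneg _
  refine maxOver_nonneg fun e _ => maxOver_nonneg fun p _ => ?_
  split_ifs
  · exact div_nonneg (maxOver_nonneg fun q _ => hR q) (hR p)
  · exact le_rfl

theorem posSemidef_laplacian {H : WeightedHypergraph V} {c : Finset V → Sym2 V → ℝ}
    (hc : IsConductanceSplit H c) : (laplacian H c).PosSemidef := by
  refine Matrix.posSemidef_sum _ fun p _ => (posSemidef_pairMatrix p).smul ?_
  exact Finset.sum_nonneg fun e he =>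
    hc.1 e (Finset.mem_filter.1 he).1 p (Finset.mem_filter.1 he).2

open scoped MatrixOrder in
/-- A vector that is killed by `L^{+/2}` is killed by `L`. -/
theorem mulVec_eq_zero_of_pinvSqrt {L : Matrix V V ℝ} (hL : L.PosSemidef)
    {x : V → ℝ} (hx : pinvSqrt L *ᵥ x = 0) : L *ᵥ x = 0 := by
  have hfin : (spectrum ℝ L).Finite := Matrix.finite_real_spectrum
  have h1 : L = cfc (fun t : ℝ => t * √t) L * pinvSqrt L := by
    rw [pinvSqrt, ← cfc_mul _ _ L (hfin.continuousOn _) (hfin.continuousOn _)]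
    conv_lhs => rw [← cfc_id ℝ L hL.isHermitian]
    refine cfc_congr fun t ht => ?_
    have ht0 : 0 ≤ t := spectrum_nonneg_of_nonneg (Matrix.nonneg_iff_posSemidef.2 hL) ht
    rcases ht0.eq_or_lt with h | h
    · simp [← h]
    · have := (Real.sqrt_pos.2 h).ne'
      simp only [id]
      field_simp
  rw [h1, ← Matrix.mulVec_mulVec, hx, Matrix.mulVec_zero]

/-- The resistance of a pair of positive conductance is positive. -/
theorem resistance_pos {H : WeightedHypergraph V} {c : Finset V → Sym2 V → ℝ}
    (hc : IsConductanceSplit H c) {e : Finset V} (he : e ∈ H.edges) {p : Sym2 V}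
    (hp : p ∈ pairs e) (hcp : 0 < c e p) : 0 < resistance H c p := by
  induction p using Sym2.ind with
  | _ u v =>
    have hL := posSemidef_laplacian hc
    obtain ⟨-, -, huv⟩ := mem_pairs.1 hp
    rcases (sq_nonneg ‖WithLp.toLp 2 (pinvSqrt (laplacian H c) *ᵥ basisDiff u v)‖).eq_or_lt'
      with h | h
    · exfalso
      have h1 : pinvSqrt (laplacian H c) *ᵥ basisDiff u v = 0 := by simpa using h
      have h2 := mulVec_eq_zero_of_pinvSqrt hL h1
      have h3 : basisDiff u v ⬝ᵥ (laplacian H c *ᵥ basisDiff u v) =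
          ∑ q ∈ auxEdges H, conductance H c q * sqDiff (basisDiff u v) q := by
        rw [laplacian, Matrix.sum_mulVec, dotProduct_sum]
        refine Finset.sum_congr rfl fun q _ => ?_
        rw [Matrix.smul_mulVec, dotProduct_smul, smul_eq_mul, dotProduct_pairMatrix_mulVec]
      rw [h2, dotProduct_zero] at h3
      have hcond : ∀ q, 0 ≤ conductance H c q := fun q => Finset.sum_nonneg fun e he =>
        hc.1 e (Finset.mem_filter.1 he).1 q (Finset.mem_filter.1 he).2
      have h4 := (Finset.sum_eq_zero_iff_of_nonneg fun q _ =>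
        mul_nonneg (hcond q) (sqDiff_nonneg _ q)).1 h3.symm s(u, v)
        (Finset.mem_biUnion.2 ⟨e, he, hp⟩)
      have h5 : 0 < conductance H c s(u, v) := hcp.trans_le
        (Finset.single_le_sum (f := fun e => c e s(u, v))
          (fun e he => hc.1 e (Finset.mem_filter.1 he).1 _ (Finset.mem_filter.1 he).2)
          (Finset.mem_filter.2 ⟨he, hp⟩))
      have h6 := (mul_eq_zero.1 h4).resolve_left h5.ne'
      rw [sqDiff_mk] at h6
      simp [basisDiff, huv, huv.symm] at h6
    · exact h

/-- Since `R_max(e) / R_ij ≥ 1`, the ratio is at least `1` once some conductance is positive. -/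
theorem one_le_balanceRatio {H : WeightedHypergraph V} {c : Finset V → Sym2 V → ℝ}
    (hc : IsConductanceSplit H c) {e : Finset V} (he : e ∈ H.edges) {p : Sym2 V}
    (hp : p ∈ pairs e) (hcp : 0 < c e p) : 1 ≤ balanceRatio H c := by
  calc (1 : ℝ) ≤ if 0 < c e p then maxResistance H c e / resistance H c p else 0 := by
        rw [if_pos hcp, one_le_div (resistance_pos hc he hp hcp)]
        exact le_maxOver (f := resistance H c) hp
    _ ≤ maxOver (pairs e) fun p =>
        if 0 < c e p then maxResistance H c e / resistance H c p else 0 :=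
        le_maxOver (f := fun p =>
          if 0 < c e p then maxResistance H c e / resistance H c p else 0) hp
    _ ≤ _ := le_maxOver (f := fun e => maxOver (pairs e) fun p =>
        if 0 < c e p then maxResistance H c e / resistance H c p else 0) he

omit [Fintype V] in
/-- If `1 ≤ ε`, or if the energy vanishes, then the hypergraph without edges is a sparsifier. -/
theorem exists_empty_sparsifier {H : WeightedHypergraph V} {ε : ℝ}
    (h : ∀ x, energy H x ≤ ε * energy H x) :
    ∃ Ht : WeightedHypergraph V, IsSpectralSparsifier ε H Ht ∧ Ht.edges.card = 0 := by
  refine ⟨⟨∅, 0, by simp⟩, ⟨Finset.empty_subset _, fun x => ?_⟩, rfl⟩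
  have h1 : energy (⟨∅, 0, by simp⟩ : WeightedHypergraph V) x = 0 := Finset.sum_empty
  rw [h1, sub_zero, abs_of_nonneg (energy_nonneg H x)]
  exact h x

end BalanceRatio

theorem mainTheorem6 :
    ∃ C : ℝ, 0 < C ∧
      ∀ (V : Type*) [Fintype V] [DecidableEq V] (H : WeightedHypergraph V)
        (c : Finset V → Sym2 V → ℝ), IsConductanceSplit H c →
        ∀ ε : ℝ, 0 < ε →
          ∃ Ht : WeightedHypergraph V, IsSpectralSparsifier ε H Ht ∧
            (Ht.edges.card : ℝ) ≤
              C * (balanceRatio H c * (Real.log (rank H) / ε ^ 2) *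
                (Fintype.card V : ℝ) * Real.log (Fintype.card V)) := by
  refine ⟨16 * 720000000 ^ 2, by norm_num, fun V _ _ H c hc ε hε => ?_⟩
  have hK := balanceRatio_nonneg H c
  have hX : 0 ≤ Real.log (rank H) / ε ^ 2 * (Fintype.card V : ℝ) *
      Real.log (Fintype.card V) := by positivity
  have htriv : (∀ x, energy H x ≤ ε * energy H x) →
      ∃ Ht : WeightedHypergraph V, IsSpectralSparsifier ε H Ht ∧
            (Ht.edges.card : ℝ) ≤
              16 * 720000000 ^ 2 * (balanceRatio H c * (Real.log (rank H) / ε ^ 2) *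
                (Fintype.card V : ℝ) * Real.log (Fintype.card V)) := by
    intro h
    obtain ⟨Ht, h1, h2⟩ := exists_empty_sparsifier h
    refine ⟨Ht, h1, ?_⟩
    rw [h2, Nat.cast_zero]
    positivity
  rcases le_total 1 ε with hε1 | hε1
  · exact htriv fun x => le_mul_of_one_le_left (energy_nonneg H x) hε1
  by_cases hpos : ∃ e ∈ H.edges, 0 < H.weight e
  · obtain ⟨e, he, hw⟩ := hpos
    obtain ⟨p, hp, hcp⟩ := exists_pair_of_weight_pos hc he hw
    have hK1 := one_le_balanceRatio hc he hp hcp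
    have hcard : ∀ e ∈ H.edges, e.card ≤ rank H := fun e he => Finset.le_sup (f := Finset.card) he
    have he2 : 2 ≤ e.card := by
      induction p using Sym2.ind with
      | _ u v =>
        obtain ⟨hu, hv, huv⟩ := mem_pairs.1 hp
        exact Finset.one_lt_card.2 ⟨u, hu, v, hv, huv⟩
    obtain ⟨Ht, h1, h2⟩ := exists_sparsifier_card_le H hc (he2.trans (Finset.card_le_univ e))
      (he2.trans (hcard e he)) hcard hε hε1
    refine ⟨Ht, h1, h2.trans ?_⟩
    gcongr
    exact le_mul_of_one_le_left (by positivity) hK1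
  · push Not at hpos
    refine htriv fun x => ?_
    have h0 : energy H x = 0 := Finset.sum_eq_zero fun e he => by
      rw [le_antisymm (hpos e he) (H.weight_nonneg e he), zero_mul]
    rw [h0, mul_zero]
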